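/- Model. Let $G$ be a simple undirected graph on $n$ numbered nodes (connectivity is not required). A turnstile stream of $G$ is a finite sequence, of any length and in any order, of insertions and deletions of pairs $\{u,v\}$ with $u \neq v$, such that for each pair the number of its insertions minus the number of its deletions is $1$ if the pair is an edge of $G$ and $0$ otherwise. A randomized streaming algorithm is given $n$, $c$, $k$ and a list of $c$ sources. It reads the same stream from beginning to end in several passes, and computes, after every symbol read (an update or the end of a pass), a new memory content from the parameters, the old memory content, the symbol, and a block of fresh independent fair random bits; after the last pass it computes its output from the memory alone. All these functions are computable, uniformly in $n,c,k$. Its space is the maximum, over all moments and all outcomes of the random bits, of the number of bits in the memory plus the number of random bits drawn in one step. To solve the BFS instance with source $s$ means to output, for each node $v$ reachable from $s$, the distance $\operatorname{dist}(s,v)$ and, if $v \ne s$, a parent of $v$, i.e. a neighbour $q$ of $v$ with $\operatorname{dist}(s,q)+1=\operatorname{dist}(s,v)$, so that the parents form a BFS tree rooted at $s$ (the root is recorded as its own parent); nodes that are not reachable from $s$ are reported as such. Theorem. There are a single randomized streaming algorithm and constants $C>0$, $a \in \mathbb{N}$, $\delta>0$ such that for all integers $1\le c\le k\le n$, every simple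 undirected graph $G$ on $n$ nodes, all sources $s_1,\dots,s_c$ in $G$, and every turnstile stream of $G$, the algorithm makes at most $C\,\frac{n}{k}\,(1+\log n)^a$ passes (that is, $\tilde O(n/k)$), uses at most $C\,(cn+k^2)\,(1+\log n)^a$ bits of space (that is, $\tilde O(cn+k^2)$), and with probability at least $1-1/n^{\delta}$ solves all $c$ BFS instances with sources $s_1,\dots,s_c$ simultaneously. -/

import Mathlib

/-! Multi-pass streaming algorithms over turnstile graph streams, and batched BFS. -/

namespace GraphStream

/-- An update `(u, v, b)` of a graph on `n` nodes: the edge `{u, v}` is inserted if `b = true`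
and deleted if `b = false`. -/
abbrev Update (n : ℕ) : Type := Fin n × Fin n × Bool

/-- The number of insertions minus the number of deletions of `e` in the stream. -/
def netCount {n : ℕ} (σ : List (Update n)) (e : Sym2 (Fin n)) : ℤ :=
  (σ.map fun t => if s(t.1, t.2.1) = e then (if t.2.2 then (1 : ℤ) else -1) else 0).sum

open scoped Classical in
/-- `σ` is a turnstile stream (insertions and deletions, in any order) of the simple graph `G`:
no update concerns a loop, and the final multiplicity of every pair is `1` if the pair is an edge
of `G` and `0` otherwise. Intermediate multiplicities are not restricted. -/
def IsTurnstileStream {n : ℕ} (σ : List (Update n)) (G : SimpleGraph (Fin n)) : Prop :=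
  (∀ t ∈ σ, t.1 ≠ t.2.1) ∧
    ∀ e : Sym2 (Fin n), netCount σ e = if e ∈ G.edgeSet then 1 else 0

/-- What the algorithm reads: an edge update with nodes given by their numbers, or `none`, the
marker for the end of a pass. -/
abbrev TapeSymbol : Type := Option (ℕ × ℕ × Bool)

/-- The symbols read in a single pass over the stream `σ`. -/
def onePass {n : ℕ} (σ : List (Update n)) : List TapeSymbol :=
  (σ.map fun t => some ((t.1 : ℕ), (t.2.1 : ℕ), t.2.2)) ++ [none]

/-- The symbols read in `P` passes over the same stream `σ`. -/
def tape {n : ℕ} (P : ℕ) (σ : List (Update n)) : List TapeSymbol :=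
  (List.replicate P (onePass σ)).flatten

/-- The numbers `(n, c, k)`. -/
abbrev Params : Type := ℕ × ℕ × ℕ

/-- A (uniform) randomized multi-pass streaming algorithm for batched BFS. Its memory holds a
string of bits. Initially the memory is computed from the parameters and the list of sources;
from then on, every symbol read changes the memory through `step`, which sees the parameters, the
memory, the symbol, and `coins` fresh random bits. Nothing else is kept from one symbol to the
next. After the last pass the answer for the `i`-th source and the node `v` is
`output (params, memory, i, v)`: `none` (not reachable) or `some (distance, parent)`. -/
structure Algorithm where
  passes : Params → ℕ
  coins : Params → ℕ
  init : Params × List ℕ → List Bool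
  step : Params × List Bool × TapeSymbol × List Bool → List Bool
  output : Params × List Bool × ℕ × ℕ → Option (ℕ × ℕ)
  passes_computable : Computable passes
  coins_computable : Computable coins
  init_computable : Computable init
  step_computable : Computable step
  output_computable : Computable output

namespace Algorithm

/-- The distribution of the memory after reading one symbol: the coins are uniform, and
independent of all earlier ones. -/
noncomputable def stepDist (A : Algorithm) (p : Params) (m : List Bool) (a : TapeSymbol) :
    PMF (List Bool) :=
  (PMF.uniformOfFintype (Fin (A.coins p) → Bool)).map fun ω => A.step (p, m, a, List.ofFn ω)

/-- The distribution of the memory after reading the symbols in `w`, from the memory `m`. -/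
noncomputable def runFrom (A : Algorithm) (p : Params) (m : List Bool) (w : List TapeSymbol) :
    PMF (List Bool) :=
  w.foldl (fun μ a => μ.bind fun m' => A.stepDist p m' a) (PMF.pure m)

/-- The initial memory for the sources `src`. -/
def start (A : Algorithm) (p : Params) {n c : ℕ} (src : Fin c → Fin n) : List Bool :=
  A.init (p, List.ofFn fun i => (src i : ℕ))

/-- The distribution of the memory after all passes over `σ`. -/
noncomputable def finalDist (A : Algorithm) (p : Params) {n c : ℕ} (src : Fin c → Fin n)
    (σ : List (Update n)) : PMF (List Bool) :=
  A.runFrom p (A.start p src) (tape (A.passes p) σ)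

/-- On the stream `σ` the algorithm uses at most `S` bits of space, whatever the coins show: at
each moment of each pass, the memory together with the block of random bits drawn for the next
step has at most `S` bits. -/
def SpaceAtMost (A : Algorithm) (p : Params) {n c : ℕ} (src : Fin c → Fin n)
    (σ : List (Update n)) (S : ℝ) : Prop :=
  ∀ w, w <+: tape (A.passes p) σ →
    ∀ m ∈ (A.runFrom p (A.start p src) w).support, ((m.length + A.coins p : ℕ) : ℝ) ≤ S

end Algorithm

/-- `L` solves the BFS instance of `G` with root `s`: a node that cannot be reached from `s` gets
`none`, every other node `v` gets its distance from `s` and its parent in a BFS tree rooted at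
`s`, that is, a neighbour of `v` one step closer to `s` (the root is its own parent). -/
def IsBFSSolution {n : ℕ} (G : SimpleGraph (Fin n)) (s : Fin n)
    (L : Fin n → Option (ℕ × ℕ)) : Prop :=
  ∀ v : Fin n,
    (¬ G.Reachable s v → L v = none) ∧
    (G.Reachable s v → ∃ q : Fin n, L v = some (G.dist s v, (q : ℕ)) ∧
      (v = s → q = s) ∧ (v ≠ s → G.Adj q v ∧ G.dist s q + 1 = G.dist s v))

/-- The final memories from which all `c` BFS instances are answered correctly. -/
def Algorithm.correctMemories (A : Algorithm) (p : Params) {n c : ℕ} (G : SimpleGraph (Fin n))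
    (src : Fin c → Fin n) : Set (List Bool) :=
  {m | ∀ i : Fin c, IsBFSSolution G (src i) fun v => A.output (p, m, (i : ℕ), (v : ℕ))}

end GraphStream

-- Besides the `c` sources, take `k` random nodes as further roots and search from every root only
-- to a depth `R` of order `(n / k) log n`. A shortest path with `R` candidate nodes is missed by
-- all random roots with probability at most `exp (-k R / N)`, where `N ≤ 2 n`, which is
-- polynomially small (`card_missed_le`). So with high probability every node reachable from a
-- source, other than the source, has on some shortest path from that source a root at most `R`
-- steps before it (`Covered`). Distances from the sources then split into short hops between roots
-- and one last short hop.
--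
-- Running `c + k` searches in parallel could fill memory of order `k n`. Each search therefore
-- starts after an independent random delay below `R`. At a fixed moment a search reaches on average
-- at most `n / R` nodes, so all of them together reach `O(k ^ 2)`. Each contributes at most `n`, so
-- an exponential Markov inequality bounds the load at all moments by `O(k ^ 2 + n log n)`
-- (`card_congested_le`); as `c ≥ 1`, this is within the space bound.
--
-- One layer of all searches is found deterministically in `O(log n)` passes. A code of (root, new
-- node, parent) is determined bit by bit, with one counter per candidate prefix. A counter is
-- linear in the stream, hence counts edges of the final graph, and its modulus exceeds the number
-- of pairs, so it vanishes only if no edge fits (`counter_ne_zero_iff`). Among prefixes that differ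
-- only in parent bits the least is kept, so the number of prefixes is bounded by the load, not by
-- the number of edges (`mem_refinePrefixes`, `length_prefixes_le`).
--
-- The search trees themselves are too large to store. In a first period of `2 R` moments only the
-- tree edges that end in roots are kept, at most one per pair of roots; relaxing along them makes
-- the distances from sources to roots exact (`rootsExact_iterate`). A second period repeats the
-- same searches, and every tree edge found is used at once to settle the entry of its node, then
-- forgotten (`Progress.succ`). An entry is a pair of distance and parent whose parent is at
-- distance at most one less than recorded, so an exact distance makes the parent correct as well
-- (`ValSpec`, `isBFSSolution`).
--
-- Coins matter only at the end of the first pass. Given good coins, the run is deterministic and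
-- described by an invariant (`AtMoment`), so probabilities reduce to counting coin outcomes. For
-- bad coins the memory is erased when it exceeds the cap, which makes the space bound
-- unconditional.

-- Closure rules for primitive recursive functions.

attribute [fun_prop] Primrec

namespace Primrec

variable {α β γ : Type*} [Primcodable α] [Primcodable β] [Primcodable γ]

@[fun_prop] theorem fun_id : Primrec fun a : α => a := Primrec.id

@[fun_prop] theorem fun_const (b : β) : Primrec fun _ : α => b := Primrec.const b

@[fun_prop] theorem fun_comp {f : β → γ} {g : α → β} (hf : Primrec f) (hg : Primrec g) :
    Primrec fun a => f (g a) := hf.comp hg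

@[fun_prop] theorem fun_fst {f : α → β × γ} (hf : Primrec f) : Primrec fun a => (f a).1 :=
  Primrec.fst.comp hf

@[fun_prop] theorem fun_snd {f : α → β × γ} (hf : Primrec f) : Primrec fun a => (f a).2 :=
  Primrec.snd.comp hf

@[fun_prop] theorem fun_mk {f : α → β} {g : α → γ} (hf : Primrec f) (hg : Primrec g) :
    Primrec fun a => (f a, g a) := hf.pair hg

@[fun_prop] theorem fun_some {f : α → β} (hf : Primrec f) : Primrec fun a => some (f a) :=
  Primrec.option_some.comp hf

@[fun_prop] theorem fun_isSome {f : α → Option β} (hf : Primrec f) :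
    Primrec fun a => (f a).isSome := Primrec.option_isSome.comp hf

@[fun_prop] theorem fun_optionGetD {f : α → Option β} {g : α → β} (hf : Primrec f)
    (hg : Primrec g) : Primrec fun a => (f a).getD (g a) := Primrec.option_getD.comp hf hg

section Nat

variable {f g : α → ℕ}

@[fun_prop] theorem fun_add (hf : Primrec f) (hg : Primrec g) : Primrec fun a => f a + g a :=
  Primrec.nat_add.comp hf hg

@[fun_prop] theorem fun_sub (hf : Primrec f) (hg : Primrec g) : Primrec fun a => f a - g a :=
  Primrec.nat_sub.comp hf hg

@[fun_prop] theorem fun_mul (hf : Primrec f) (hg : Primrec g) : Primrec fun a => f a * g a :=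
  Primrec.nat_mul.comp hf hg

@[fun_prop] theorem fun_div (hf : Primrec f) (hg : Primrec g) : Primrec fun a => f a / g a :=
  Primrec.nat_div.comp hf hg

@[fun_prop] theorem fun_mod (hf : Primrec f) (hg : Primrec g) : Primrec fun a => f a % g a :=
  Primrec.nat_mod.comp hf hg

@[fun_prop] theorem fun_pow (hf : Primrec f) (hg : Primrec g) : Primrec fun a => f a ^ g a :=
  (Primrec₂.unpaired'.1 Nat.Primrec.pow).comp hf hg

@[fun_prop] theorem fun_min (hf : Primrec f) (hg : Primrec g) :
    Primrec fun a => min (f a) (g a) := Primrec.nat_min.comp hf hg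

@[fun_prop] theorem fun_decide_lt (hf : Primrec f) (hg : Primrec g) :
    Primrec fun a => decide (f a < g a) := (Primrec.nat_lt.comp hf hg).decide

@[fun_prop] theorem fun_decide_le (hf : Primrec f) (hg : Primrec g) :
    Primrec fun a => decide (f a ≤ g a) := (Primrec.nat_le.comp hf hg).decide

-- The logarithm is a bounded search: the greatest `i ≤ m` with `2 ^ i ≤ m`.
@[fun_prop] theorem fun_log_two (hf : Primrec f) : Primrec fun a => Nat.log 2 (f a) := by
  have h : Primrec fun m : ℕ => Nat.findGreatest (fun i => 2 ^ i ≤ m) m := by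
    refine Primrec.nat_findGreatest Primrec.id (p := fun m i => 2 ^ i ≤ m) ?_
    refine Primrec.nat_le.comp ?_ ?_ <;> fun_prop
  refine (h.of_eq fun m => ?_).comp hf
  rw [Nat.findGreatest_eq_iff]
  refine ⟨Nat.log_le_self 2 m, fun h0 => Nat.pow_log_le_self 2 ?_, fun i hi _ => not_le.2
    (Nat.lt_pow_of_log_lt Nat.one_lt_two hi)⟩
  rintro rfl
  simp at h0

end Nat

@[fun_prop] theorem fun_decide_eq [DecidableEq β] {f g : α → β} (hf : Primrec f)
    (hg : Primrec g) : Primrec fun a => decide (f a = g a) := (Primrec.eq.comp hf hg).decide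

section Bool

variable {p q : α → Bool}

@[fun_prop] theorem fun_and (hp : Primrec p) (hq : Primrec q) : Primrec fun a => p a && q a :=
  Primrec.and.comp hp hq

@[fun_prop] theorem fun_or (hp : Primrec p) (hq : Primrec q) : Primrec fun a => p a || q a :=
  Primrec.or.comp hp hq

@[fun_prop] theorem fun_not (hp : Primrec p) : Primrec fun a => !p a := Primrec.not.comp hp

@[fun_prop] theorem fun_toNat (hp : Primrec p) : Primrec fun a => (p a).toNat :=
  (Primrec.dom_bool Bool.toNat).comp hp

@[fun_prop] theorem fun_cond {f g : α → β} (hp : Primrec p) (hf : Primrec f) (hg : Primrec g) :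
    Primrec fun a => bif p a then f a else g a := Primrec.cond hp hf hg

end Bool

section List

variable {l : α → List β}

@[fun_prop] theorem fun_range {f : α → ℕ} (hf : Primrec f) :
    Primrec fun a => List.range (f a) := Primrec.list_range.comp hf

@[fun_prop] theorem fun_cons {f : α → β} (hf : Primrec f) (hl : Primrec l) :
    Primrec fun a => f a :: l a := Primrec.list_cons.comp hf hl

@[fun_prop] theorem fun_append {l' : α → List β} (hl : Primrec l) (hl' : Primrec l') :
    Primrec fun a => l a ++ l' a := Primrec.list_append.comp hl hl'

@[fun_prop] theorem fun_length (hl : Primrec l) : Primrec fun a => (l a).length :=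
  Primrec.list_length.comp hl

@[fun_prop] theorem fun_tail (hl : Primrec l) : Primrec fun a => (l a).tail :=
  Primrec.list_tail.comp hl

@[fun_prop] theorem fun_headI [Inhabited β] (hl : Primrec l) : Primrec fun a => (l a).headI :=
  Primrec.list_headI.comp hl

@[fun_prop] theorem fun_getD {f : α → ℕ} (d : β) (hl : Primrec l) (hf : Primrec f) :
    Primrec fun a => (l a).getD (f a) d := (Primrec.list_getD d).comp hl hf

@[fun_prop] theorem fun_map {g : α → β → γ} (hl : Primrec l)
    (hg : Primrec fun p : α × β => g p.1 p.2) : Primrec fun a => (l a).map (g a) :=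
  Primrec.list_map hl hg

@[fun_prop] theorem fun_flatMap {g : α → β → List γ} (hl : Primrec l)
    (hg : Primrec fun p : α × β => g p.1 p.2) : Primrec fun a => (l a).flatMap (g a) :=
  Primrec.list_flatMap hl hg

@[fun_prop] theorem fun_foldl {s : α → γ} {g : α → γ → β → γ}
    (hg : Primrec fun p : α × (γ × β) => g p.1 p.2.1 p.2.2) (hs : Primrec s) (hl : Primrec l) :
    Primrec fun a => (l a).foldl (g a) (s a) :=
  Primrec.list_foldl (h := fun a p => g a p.1 p.2) hl hs hg

@[fun_prop] theorem fun_foldr {s : α → γ} {g : α → β → γ → γ}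
    (hg : Primrec fun p : α × (β × γ) => g p.1 p.2.1 p.2.2) (hs : Primrec s) (hl : Primrec l) :
    Primrec fun a => (l a).foldr (g a) (s a) :=
  Primrec.list_foldr (h := fun a p => g a p.1 p.2) hl hs hg

@[fun_prop] theorem fun_filter {g : α → β → Bool}
    (hg : Primrec fun p : α × β => g p.1 p.2) (hl : Primrec l) :
    Primrec fun a => (l a).filter (g a) := by
  have h : Primrec fun a => (l a).flatMap fun b => bif g a b then [b] else [] := by fun_prop
  refine h.of_eq fun a => ?_
  induction l a with
  | nil => rfl
  | cons b l ih => cases hb : g a b <;> simp [hb, ih]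

@[fun_prop] theorem fun_any {g : α → β → Bool} (hl : Primrec l)
    (hg : Primrec fun p : α × β => g p.1 p.2) : Primrec fun a => (l a).any (g a) := by
  have h : Primrec fun a => (l a).foldr (fun b r => g a b || r) false := by fun_prop
  refine h.of_eq fun a => ?_
  induction l a with
  | nil => rfl
  | cons b l ih => simp [ih]

@[fun_prop] theorem fun_decide_mem [DecidableEq β] {f : α → β} (hf : Primrec f)
    (hl : Primrec l) : Primrec fun a => decide (f a ∈ l a) := by
  have h : Primrec fun a => (l a).any fun b => decide (f a = b) := by fun_prop
  refine h.of_eq fun a => ?_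
  rw [Bool.eq_iff_iff]
  simp

@[fun_prop] theorem fun_iterate {k : α → ℕ} {s : α → γ} {g : α → γ → γ} (hk : Primrec k)
    (hg : Primrec fun p : α × γ => g p.1 p.2) (hs : Primrec s) :
    Primrec fun a => (g a)^[k a] (s a) := Primrec.nat_iterate hk hs hg

end List

end Primrec

/-! ### The algorithm: parameters, state, transitions, encoding. -/

namespace GraphStream.BatchedBFS

/-- The number of bits of a node. -/
def nodeBits (p : Params) : ℕ := Nat.log 2 p.1 + 1

/-- A power of two above `n`, so that the components of a code are blocks of bits and a prefix of a
code makes sense. -/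
def nodeBase (p : Params) : ℕ := 2 ^ nodeBits p

/-- The number of bits of a code `(j * N + v) * N + q` of a root index and two nodes. -/
def codeBits (p : Params) : ℕ := 3 * nodeBits p + 1

def codeBase (p : Params) : ℕ := 2 ^ codeBits p

/-- The factor `8` gives `8 * nodeBits * n ≤ radius * k`, which drives both probability estimates.
The radius is a power of two so that a uniform block of bits splits exactly into a delay and node
bits. -/
def radiusBits (p : Params) : ℕ := Nat.log 2 (8 * (p.1 / p.2.2 + 1) * nodeBits p) + 1

/-- The depth to which the graph is searched from each root. -/
def radius (p : Params) : ℕ := 2 ^ radiusBits p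

/-- The number of roots: the sources and `k` random nodes. -/
def rootCount (p : Params) : ℕ := p.2.1 + p.2.2

/-- The number of layers after which all the searches have ended. -/
def period (p : Params) : ℕ := 2 * radius p

/-- One pass to draw the roots, then two periods with one pass per bit of a code at each moment. -/
def passCount (p : Params) : ℕ := 1 + 2 * period p * codeBits p

def blockBits (p : Params) : ℕ := nodeBits p + radiusBits p

def coinCount (p : Params) : ℕ := rootCount p * blockBits p

def spaceCap (p : Params) : ℕ := 6000 * (p.2.1 * p.1 + p.2.2 ^ 2) * nodeBits p ^ 2

/-- The code of the `j`-th root, the node `v` and its parent `q`. -/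
def code (p : Params) (j v q : ℕ) : ℕ := (j * nodeBase p + v) * nodeBase p + q

/-- The node of a root; a root is stored as `delay * N + node`. -/
def rootNode (p : Params) (roots : List ℕ) (j : ℕ) : ℕ := roots.getD j 0 % nodeBase p

/-- The moment in each period when the search from a root starts. -/
def rootDelay (p : Params) (roots : List ℕ) (j : ℕ) : ℕ := roots.getD j 0 / nodeBase p

/-- The edge from `q` to `v` leads the `j`-th search to a new node `v`. -/
def fresh (p : Params) (cur prev : List ℕ) (j q v : ℕ) : Bool :=
  decide (j * nodeBase p + q ∈ cur) && (!decide (j * nodeBase p + v ∈ cur) &&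
    !decide (j * nodeBase p + v ∈ prev))

/-- The edge `{a, b}` yields a code with quotient `z` by `2 ^ r`. -/
def hits (p : Params) (r : ℕ) (cur prev : List ℕ) (a b z : ℕ) : Bool :=
  (List.range (rootCount p)).any fun j =>
    (fresh p cur prev j a b && decide (code p j b a / 2 ^ r = z)) ||
      (fresh p cur prev j b a && decide (code p j a b / 2 ^ r = z))

/-- A counter is stored as `prefix * M + value`, with the value modulo `M`. -/
def bump (p : Params) (r : ℕ) (cur prev : List ℕ) (a b : ℕ) (s : Bool) (w : ℕ) : ℕ :=
  bif hits p r cur prev a b (w / codeBase p) then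
    w / codeBase p * codeBase p +
      (w % codeBase p + bif s then 1 else codeBase p - 1) % codeBase p
  else w

/-- The prefixes of nonzero counters. -/
def survivors (p : Params) (W : List ℕ) : List ℕ :=
  (W.filter fun w => !decide (w % codeBase p = 0)).map fun w => w / codeBase p

/-- The prefixes of `ℓ + 1` bits that are kept: the nonzero ones, and among those that differ
only in the bits of the parent only the smallest. -/
def refinePrefixes (p : Params) (ℓ : ℕ) (W : List ℕ) : List ℕ :=
  (List.range (2 ^ (ℓ + 1))).filter fun z =>
    decide (z ∈ survivors p W) && !(survivors p W).any fun z' =>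
      -- The truncated difference is the number of parent bits already in the prefix. If it is zero,
      -- the two conditions contradict each other and nothing is discarded.
      decide (z' < z) && decide (z' / 2 ^ (ℓ + 1 + nodeBits p - codeBits p) =
        z / 2 ^ (ℓ + 1 + nodeBits p - codeBits p))

/-- Zero counters for the extensions of the prefixes in `Z` by one bit. -/
def children (p : Params) (Z : List ℕ) : List ℕ :=
  Z.flatMap fun z => [2 * z * codeBase p, (2 * z + 1) * codeBase p]

/-- The search with key `y = j * N + v` starts at the moment `ρ` of the period. -/
def starts (p : Params) (roots : List ℕ) (ρ y : ℕ) : Bool :=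
  decide (rootDelay p roots (y / nodeBase p) = ρ) &&
    decide (y % nodeBase p = rootNode p roots (y / nodeBase p))

/-- The layers at the moment `ρ`, where `found` are the codes found at the previous one. -/
def nextLayers (p : Params) (roots : List ℕ) (ρ : ℕ) (found : List ℕ) : List ℕ :=
  (List.range (rootCount p * nodeBase p)).filter fun y =>
    (decide (y ∈ found.map fun x => x / nodeBase p) &&
      decide (ρ < rootDelay p roots (y / nodeBase p) + radius p)) || starts p roots ρ y

/-- The codes found at the moment `ρ`, with their depths. -/
def withDepth (p : Params) (roots : List ℕ) (ρ : ℕ) (found : List ℕ) : List ℕ :=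
  found.map fun x =>
    (ρ + 1 - rootDelay p roots (x / nodeBase p / nodeBase p)) * codeBase p + x

def itemDepth (p : Params) (e : ℕ) : ℕ := e / codeBase p

def itemRoot (p : Params) (e : ℕ) : ℕ := e % codeBase p / nodeBase p / nodeBase p

def itemNode (p : Params) (e : ℕ) : ℕ := e % codeBase p / nodeBase p % nodeBase p

def itemParent (p : Params) (e : ℕ) : ℕ := e % codeBase p % nodeBase p

def isRoot (p : Params) (roots : List ℕ) (v : ℕ) : Bool :=
  roots.any fun x => decide (x % nodeBase p = v)

/-- The pairs of roots found so far, after a further layer. -/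
def addEdges (p : Params) (roots E items : List ℕ) : List ℕ :=
  E ++ items.filter fun e => isRoot p roots (itemNode p e) && !decide (e ∈ E)

/-- The entry of the item `e` for the `i`-th source: an entry is `distance * N + parent`. -/
def candidate (p : Params) (roots val : List ℕ) (i e : ℕ) : ℕ :=
  (val.getD (i * p.1 + rootNode p roots (itemRoot p e)) 0 / nodeBase p + itemDepth p e) *
    nodeBase p + itemParent p e

/-- One round of relaxation of all entries by the given items. -/
def relax (p : Params) (roots items val : List ℕ) : List ℕ :=
  (List.range (p.2.1 * p.1)).map fun y =>
    items.foldl (fun acc e =>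
      bif decide (itemNode p e = y % p.1) then min acc (candidate p roots val (y / p.1) e)
      else acc) (val.getD y 0)

/-- The roots obtained from the sources and the random number `V`. -/
def makeRoots (p : Params) (src : List ℕ) (V : ℕ) : List ℕ :=
  (List.range (rootCount p)).map fun j =>
    V / (2 ^ blockBits p) ^ j % 2 ^ blockBits p / nodeBase p * nodeBase p +
      bif decide (j < p.2.1) then src.getD j 0
      -- Reduction modulo `n` makes the node non-uniform, but every node keeps probability at least
      -- `1 / nodeBase`, which is all that is needed.
      else V / (2 ^ blockBits p) ^ j % 2 ^ blockBits p % nodeBase p % p.1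

/-- The value `n * nodeBase` has distance part `n` and stands for infinity; a source has distance
`0` and itself as parent. -/
def initialValues (p : Params) (src : List ℕ) : List ℕ :=
  (List.range (p.2.1 * p.1)).map fun y =>
    bif decide (y % p.1 = src.getD (y / p.1) 0) then y % p.1 else p.1 * nodeBase p

/-- The state: the number of completed passes, the roots, the current and the previous layers,
the counters, the pairs of roots found, and the entries of the answer. -/
def mkState (cnt : ℕ) (roots cur prev W E val : List ℕ) : List (List ℕ) :=
  [[cnt], roots, cur, prev, W, E, val]

def initialState (p : Params) (src : List ℕ) : List (List ℕ) :=
  mkState 0 src [] [] [] [] (initialValues p src)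

/-- The step at the end of the first pass, which draws the roots. -/
def stepStart (p : Params) (src val : List ℕ) (V : ℕ) : List (List ℕ) :=
  mkState 1 (makeRoots p src V) (nextLayers p (makeRoots p src V) 0 []) [] (children p [0]) [] val

/-- The step after the last bit of the codes for the moment `t`. -/
def stepLayer (p : Params) (cnt t : ℕ) (roots cur found E val : List ℕ) : List (List ℕ) :=
  mkState (cnt + 1) roots (nextLayers p roots ((t + 1) % period p) found) cur (children p [0])
    (addEdges p roots E (withDepth p roots (t % period p) found))
    ((relax p roots (addEdges p roots E (withDepth p roots (t % period p) found) ++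
      withDepth p roots (t % period p) found))^[p.1] val)

/-- The step at the end of a later pass. -/
def stepSearch (p : Params) (cnt : ℕ) (roots cur prev W E val : List ℕ) : List (List ℕ) :=
  bif decide ((cnt - 1) % codeBits p + 1 < codeBits p) then
    mkState (cnt + 1) roots cur prev
      (children p (refinePrefixes p ((cnt - 1) % codeBits p) W)) E val
  else
    stepLayer p cnt ((cnt - 1) / codeBits p) roots cur
      (refinePrefixes p ((cnt - 1) % codeBits p) W) E val

def stepEnd (p : Params) (V cnt : ℕ) (roots cur prev W E val : List ℕ) : List (List ℕ) :=
  bif decide (cnt = 0) then stepStart p roots val V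
  else stepSearch p cnt roots cur prev W E val

/-- The step at an edge of the stream. -/
def stepEdge (p : Params) (a b : ℕ) (s : Bool) (cnt : ℕ) (roots cur prev W E val : List ℕ) :
    List (List ℕ) :=
  mkState cnt roots cur prev
    (W.map (bump p (codeBits p - 1 - (cnt - 1) % codeBits p) cur prev a b s)) E val

def stepState (p : Params) (st : List (List ℕ)) (a : TapeSymbol) (V : ℕ) : List (List ℕ) :=
  bif a.isSome then
    stepEdge p (a.getD (0, 0, false)).1 (a.getD (0, 0, false)).2.1 (a.getD (0, 0, false)).2.2
      (st.getD 0 []).headI (st.getD 1 []) (st.getD 2 []) (st.getD 3 []) (st.getD 4 [])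
      (st.getD 5 []) (st.getD 6 [])
  else
    stepEnd p V (st.getD 0 []).headI (st.getD 1 []) (st.getD 2 []) (st.getD 3 []) (st.getD 4 [])
      (st.getD 5 []) (st.getD 6 [])

def outputState (p : Params) (st : List (List ℕ)) (i v : ℕ) : Option (ℕ × ℕ) :=
  bif decide ((st.getD 6 []).getD (i * p.1 + v) 0 / nodeBase p < p.1) then
    some ((st.getD 6 []).getD (i * p.1 + v) 0 / nodeBase p,
      (st.getD 6 []).getD (i * p.1 + v) 0 % nodeBase p)
  else none

/-- The bits of a number, each preceded by `true`, and an end mark. -/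
def encodeNat (a : ℕ) : List Bool :=
  ((List.range (Nat.log 2 a + 1)).flatMap fun i => [true, decide (a / 2 ^ i % 2 = 1)]) ++
    [false, false]

def encodeState (st : List (List ℕ)) : List Bool :=
  st.flatMap fun l => l.flatMap encodeNat ++ [false, true]

/-- The effect of a pair of bits in front of the encoding of a state. -/
def decodePair (a b : Bool) (st : List (List ℕ)) : List (List ℕ) :=
  bif a then ((2 * st.headI.headI + b.toNat) :: st.headI.tail) :: st.tail
  else bif b then [] :: st else (0 :: st.headI) :: st.tail

/-- Bits are consumed from the right in pairs; the first component holds a bit that waits for its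
partner. -/
def decodeStep (a : Bool) (x : Option Bool × List (List ℕ)) : Option Bool × List (List ℕ) :=
  bif x.1.isSome then (none, decodePair a (x.1.getD false) x.2) else (some a, x.2)

def decodeState (m : List Bool) : List (List ℕ) := (m.foldr decodeStep (none, [])).2

def bitsValue (ω : List Bool) : ℕ := ω.foldr (fun b r => 2 * r + b.toNat) 0

/-- A memory over the space bound is erased. -/
def capped (p : Params) (m : List Bool) : List Bool :=
  bif decide (m.length ≤ spaceCap p) then m else []

/-! ### Computability of the components of the algorithm. -/

section Primrec

variable {α : Type*} [Primcodable α] {p : α → Params} {a b c d e f r : α → ℕ} {s : α → Bool}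
  {l l₁ l₂ l₃ l₄ l₅ : α → List ℕ} {st : α → List (List ℕ)}

open Primrec

@[fun_prop] theorem primrec_nodeBits (hp : Primrec p) : Primrec fun x => nodeBits (p x) := by
  unfold nodeBits; fun_prop

@[fun_prop] theorem primrec_nodeBase (hp : Primrec p) : Primrec fun x => nodeBase (p x) := by
  unfold nodeBase; fun_prop

@[fun_prop] theorem primrec_codeBits (hp : Primrec p) : Primrec fun x => codeBits (p x) := by
  unfold codeBits; fun_prop

@[fun_prop] theorem primrec_codeBase (hp : Primrec p) : Primrec fun x => codeBase (p x) := by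
  unfold codeBase; fun_prop

@[fun_prop] theorem primrec_radiusBits (hp : Primrec p) :
    Primrec fun x => radiusBits (p x) := by
  unfold radiusBits; fun_prop

@[fun_prop] theorem primrec_radius (hp : Primrec p) : Primrec fun x => radius (p x) := by
  unfold radius; fun_prop

@[fun_prop] theorem primrec_rootCount (hp : Primrec p) : Primrec fun x => rootCount (p x) := by
  unfold rootCount; fun_prop

@[fun_prop] theorem primrec_period (hp : Primrec p) : Primrec fun x => period (p x) := by
  unfold period; fun_prop

@[fun_prop] theorem primrec_passCount (hp : Primrec p) : Primrec fun x => passCount (p x) := by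
  unfold passCount; fun_prop

@[fun_prop] theorem primrec_blockBits (hp : Primrec p) : Primrec fun x => blockBits (p x) := by
  unfold blockBits; fun_prop

@[fun_prop] theorem primrec_coinCount (hp : Primrec p) : Primrec fun x => coinCount (p x) := by
  unfold coinCount; fun_prop

@[fun_prop] theorem primrec_spaceCap (hp : Primrec p) : Primrec fun x => spaceCap (p x) := by
  unfold spaceCap; fun_prop

@[fun_prop] theorem primrec_code (hp : Primrec p) (ha : Primrec a) (hb : Primrec b)
    (hc : Primrec c) : Primrec fun x => code (p x) (a x) (b x) (c x) := by
  unfold code; fun_prop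

@[fun_prop] theorem primrec_rootNode (hp : Primrec p) (hl : Primrec l) (ha : Primrec a) :
    Primrec fun x => rootNode (p x) (l x) (a x) := by
  unfold rootNode; fun_prop

@[fun_prop] theorem primrec_rootDelay (hp : Primrec p) (hl : Primrec l) (ha : Primrec a) :
    Primrec fun x => rootDelay (p x) (l x) (a x) := by
  unfold rootDelay; fun_prop

@[fun_prop] theorem primrec_fresh (hp : Primrec p) (hl : Primrec l) (hl₁ : Primrec l₁)
    (ha : Primrec a) (hb : Primrec b) (hc : Primrec c) :
    Primrec fun x => fresh (p x) (l x) (l₁ x) (a x) (b x) (c x) := by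
  unfold fresh; fun_prop

@[fun_prop] theorem primrec_hits (hp : Primrec p) (hr : Primrec r) (hl : Primrec l)
    (hl₁ : Primrec l₁) (ha : Primrec a) (hb : Primrec b) (hc : Primrec c) :
    Primrec fun x => hits (p x) (r x) (l x) (l₁ x) (a x) (b x) (c x) := by
  unfold hits; fun_prop

@[fun_prop] theorem primrec_bump (hp : Primrec p) (hr : Primrec r) (hl : Primrec l)
    (hl₁ : Primrec l₁) (ha : Primrec a) (hb : Primrec b) (hs : Primrec s) (hc : Primrec c) :
    Primrec fun x => bump (p x) (r x) (l x) (l₁ x) (a x) (b x) (s x) (c x) := by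
  unfold bump; fun_prop

@[fun_prop] theorem primrec_survivors (hp : Primrec p) (hl : Primrec l) :
    Primrec fun x => survivors (p x) (l x) := by
  unfold survivors; fun_prop

@[fun_prop] theorem primrec_refinePrefixes (hp : Primrec p) (ha : Primrec a) (hl : Primrec l) :
    Primrec fun x => refinePrefixes (p x) (a x) (l x) := by
  unfold refinePrefixes; fun_prop

@[fun_prop] theorem primrec_children (hp : Primrec p) (hl : Primrec l) :
    Primrec fun x => children (p x) (l x) := by
  unfold children; fun_prop

@[fun_prop] theorem primrec_starts (hp : Primrec p) (hl : Primrec l) (ha : Primrec a)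
    (hb : Primrec b) : Primrec fun x => starts (p x) (l x) (a x) (b x) := by
  unfold starts; fun_prop

@[fun_prop] theorem primrec_nextLayers (hp : Primrec p) (hl : Primrec l) (ha : Primrec a)
    (hl₁ : Primrec l₁) : Primrec fun x => nextLayers (p x) (l x) (a x) (l₁ x) := by
  unfold nextLayers
  exact fun_filter (fun_or (fun_and (fun_decide_mem (by fun_prop) (by fun_prop))
    (fun_decide_lt (by fun_prop) (by fun_prop))) (by fun_prop)) (by fun_prop)

@[fun_prop] theorem primrec_withDepth (hp : Primrec p) (hl : Primrec l) (ha : Primrec a)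
    (hl₁ : Primrec l₁) : Primrec fun x => withDepth (p x) (l x) (a x) (l₁ x) := by
  unfold withDepth; fun_prop

@[fun_prop] theorem primrec_itemDepth (hp : Primrec p) (ha : Primrec a) :
    Primrec fun x => itemDepth (p x) (a x) := by
  unfold itemDepth; fun_prop

@[fun_prop] theorem primrec_itemRoot (hp : Primrec p) (ha : Primrec a) :
    Primrec fun x => itemRoot (p x) (a x) := by
  unfold itemRoot; fun_prop

@[fun_prop] theorem primrec_itemNode (hp : Primrec p) (ha : Primrec a) :
    Primrec fun x => itemNode (p x) (a x) := by
  unfold itemNode; fun_prop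

@[fun_prop] theorem primrec_itemParent (hp : Primrec p) (ha : Primrec a) :
    Primrec fun x => itemParent (p x) (a x) := by
  unfold itemParent; fun_prop

@[fun_prop] theorem primrec_isRoot (hp : Primrec p) (hl : Primrec l) (ha : Primrec a) :
    Primrec fun x => isRoot (p x) (l x) (a x) := by
  unfold isRoot; fun_prop

@[fun_prop] theorem primrec_addEdges (hp : Primrec p) (hl : Primrec l) (hl₁ : Primrec l₁)
    (hl₂ : Primrec l₂) : Primrec fun x => addEdges (p x) (l x) (l₁ x) (l₂ x) := by
  unfold addEdges; fun_prop

@[fun_prop] theorem primrec_candidate (hp : Primrec p) (hl : Primrec l) (hl₁ : Primrec l₁)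
    (ha : Primrec a) (hb : Primrec b) :
    Primrec fun x => candidate (p x) (l x) (l₁ x) (a x) (b x) := by
  unfold candidate; fun_prop

@[fun_prop] theorem primrec_relax (hp : Primrec p) (hl : Primrec l) (hl₁ : Primrec l₁)
    (hl₂ : Primrec l₂) : Primrec fun x => relax (p x) (l x) (l₁ x) (l₂ x) := by
  unfold relax; fun_prop

@[fun_prop] theorem primrec_makeRoots (hp : Primrec p) (hl : Primrec l) (ha : Primrec a) :
    Primrec fun x => makeRoots (p x) (l x) (a x) := by
  unfold makeRoots; fun_prop

@[fun_prop] theorem primrec_initialValues (hp : Primrec p) (hl : Primrec l) :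
    Primrec fun x => initialValues (p x) (l x) := by
  unfold initialValues; fun_prop

@[fun_prop] theorem primrec_mkState (ha : Primrec a) (hl : Primrec l) (hl₁ : Primrec l₁)
    (hl₂ : Primrec l₂) (hl₃ : Primrec l₃) (hl₄ : Primrec l₄) (hl₅ : Primrec l₅) :
    Primrec fun x => mkState (a x) (l x) (l₁ x) (l₂ x) (l₃ x) (l₄ x) (l₅ x) := by
  unfold mkState; fun_prop

@[fun_prop] theorem primrec_initialState (hp : Primrec p) (hl : Primrec l) :
    Primrec fun x => initialState (p x) (l x) := by
  unfold initialState; fun_prop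

@[fun_prop] theorem primrec_stepStart (hp : Primrec p) (hl : Primrec l) (hl₁ : Primrec l₁)
    (ha : Primrec a) : Primrec fun x => stepStart (p x) (l x) (l₁ x) (a x) := by
  unfold stepStart; fun_prop

@[fun_prop] theorem primrec_stepLayer (hp : Primrec p) (ha : Primrec a) (hb : Primrec b)
    (hl : Primrec l) (hl₁ : Primrec l₁) (hl₂ : Primrec l₂) (hl₃ : Primrec l₃)
    (hl₄ : Primrec l₄) :
    Primrec fun x => stepLayer (p x) (a x) (b x) (l x) (l₁ x) (l₂ x) (l₃ x) (l₄ x) := by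
  unfold stepLayer; fun_prop

@[fun_prop] theorem primrec_stepSearch (hp : Primrec p) (ha : Primrec a)
    (hl : Primrec l) (hl₁ : Primrec l₁) (hl₂ : Primrec l₂) (hl₃ : Primrec l₃)
    (hl₄ : Primrec l₄) (hl₅ : Primrec l₅) :
    Primrec fun x => stepSearch (p x) (a x) (l x) (l₁ x) (l₂ x) (l₃ x) (l₄ x) (l₅ x) := by
  unfold stepSearch; fun_prop

@[fun_prop] theorem primrec_stepEnd (hp : Primrec p) (ha : Primrec a) (hb : Primrec b)
    (hl : Primrec l) (hl₁ : Primrec l₁) (hl₂ : Primrec l₂) (hl₃ : Primrec l₃)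
    (hl₄ : Primrec l₄) (hl₅ : Primrec l₅) :
    Primrec fun x => stepEnd (p x) (a x) (b x) (l x) (l₁ x) (l₂ x) (l₃ x) (l₄ x) (l₅ x) := by
  unfold stepEnd; fun_prop

@[fun_prop] theorem primrec_stepEdge (hp : Primrec p) (ha : Primrec a) (hb : Primrec b)
    (hs : Primrec s) (hc : Primrec c)
    (hl : Primrec l) (hl₁ : Primrec l₁) (hl₂ : Primrec l₂) (hl₃ : Primrec l₃)
    (hl₄ : Primrec l₄) (hl₅ : Primrec l₅) :
    Primrec fun x => stepEdge (p x) (a x) (b x) (s x) (c x) (l x) (l₁ x) (l₂ x) (l₃ x) (l₄ x)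
      (l₅ x) := by
  unfold stepEdge; fun_prop

@[fun_prop] theorem primrec_stepState {y : α → TapeSymbol} (hp : Primrec p) (hst : Primrec st)
    (hy : Primrec y) (ha : Primrec a) :
    Primrec fun x => stepState (p x) (st x) (y x) (a x) := by
  have h : ∀ i, Primrec fun x => (st x).getD i [] := fun i => by fun_prop
  have h₀ : Primrec fun x => ((st x).getD 0 []).headI := by fun_prop
  have hy' : Primrec fun x => (y x).getD (0, 0, false) := by fun_prop
  exact fun_cond (by fun_prop)
    (primrec_stepEdge hp (fun_fst hy') (fun_fst (fun_snd hy')) (fun_snd (fun_snd hy')) h₀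
      (h 1) (h 2) (h 3) (h 4) (h 5) (h 6))
    (primrec_stepEnd hp ha h₀ (h 1) (h 2) (h 3) (h 4) (h 5) (h 6))

@[fun_prop] theorem primrec_outputState (hp : Primrec p) (hst : Primrec st)
    (ha : Primrec a) (hb : Primrec b) :
    Primrec fun x => outputState (p x) (st x) (a x) (b x) := by
  unfold outputState; fun_prop

@[fun_prop] theorem primrec_encodeNat (ha : Primrec a) : Primrec fun x => encodeNat (a x) := by
  unfold encodeNat; fun_prop

@[fun_prop] theorem primrec_encodeState (hst : Primrec st) :
    Primrec fun x => encodeState (st x) := by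
  unfold encodeState; fun_prop

@[fun_prop] theorem primrec_decodePair {t : α → Bool} (hs : Primrec s) (ht : Primrec t)
    (hst : Primrec st) : Primrec fun x => decodePair (s x) (t x) (st x) := by
  unfold decodePair; fun_prop

@[fun_prop] theorem primrec_decodeStep {y : α → Option Bool × List (List ℕ)} (hs : Primrec s)
    (hy : Primrec y) : Primrec fun x => decodeStep (s x) (y x) := by
  unfold decodeStep; fun_prop

@[fun_prop] theorem primrec_decodeState {m : α → List Bool} (hm : Primrec m) :
    Primrec fun x => decodeState (m x) := by
  unfold decodeState; fun_prop

@[fun_prop] theorem primrec_bitsValue {m : α → List Bool} (hm : Primrec m) :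
    Primrec fun x => bitsValue (m x) := by
  unfold bitsValue; fun_prop

@[fun_prop] theorem primrec_capped {m : α → List Bool} (hp : Primrec p) (hm : Primrec m) :
    Primrec fun x => capped (p x) (m x) := by
  unfold capped; fun_prop

end Primrec

/-- Batched breadth-first search from the sources and `k` random nodes, with random delays. -/
def algorithm : Algorithm where
  passes := passCount
  coins := coinCount
  init x := capped x.1 (encodeState (initialState x.1 x.2))
  step x := capped x.1
    (encodeState (stepState x.1 (decodeState x.2.1) x.2.2.1 (bitsValue x.2.2.2)))
  output x := outputState x.1 (decodeState x.2.1) x.2.2.1 x.2.2.2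
  passes_computable := (by fun_prop : Primrec passCount).to_comp
  coins_computable := (by fun_prop : Primrec coinCount).to_comp
  init_computable := Primrec.to_comp (by fun_prop)
  step_computable := Primrec.to_comp (by fun_prop)
  output_computable := Primrec.to_comp (by fun_prop)

end GraphStream.BatchedBFS

/-! ### Runs of a streaming algorithm. -/

namespace GraphStream

namespace Algorithm

variable (A : Algorithm) (p : Params)

theorem foldl_bind_eq (w : List TapeSymbol) (μ : PMF (List Bool)) :
    w.foldl (fun μ a => μ.bind fun m' => A.stepDist p m' a) μ =
      μ.bind fun m => A.runFrom p m w := by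
  induction w generalizing μ with
  | nil => simp [runFrom]
  | cons a w ih =>
    rw [List.foldl_cons, ih, PMF.bind_bind]
    congr 1
    funext m
    rw [runFrom, List.foldl_cons, PMF.pure_bind, ih]

theorem runFrom_append (m : List Bool) (w₁ w₂ : List TapeSymbol) :
    A.runFrom p m (w₁ ++ w₂) = (A.runFrom p m w₁).bind fun m' => A.runFrom p m' w₂ := by
  rw [runFrom, List.foldl_append, foldl_bind_eq]
  rfl

theorem runFrom_singleton (m : List Bool) (a : TapeSymbol) :
    A.runFrom p m [a] = A.stepDist p m a := by
  simp [runFrom]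

/-- Whatever the coins show, reading `w` turns the memory `m` into `m'`. -/
def Leads (m : List Bool) (w : List TapeSymbol) (m' : List Bool) : Prop :=
  A.runFrom p m w = PMF.pure m'

variable {A p}

theorem Leads.nil (m : List Bool) : A.Leads p m [] m := rfl

theorem Leads.append {m₁ m₂ m₃ : List Bool} {w₁ w₂ : List TapeSymbol}
    (h₁ : A.Leads p m₁ w₁ m₂) (h₂ : A.Leads p m₂ w₂ m₃) : A.Leads p m₁ (w₁ ++ w₂) m₃ := by
  rw [Leads, runFrom_append, h₁, PMF.pure_bind, h₂]

theorem Leads.singleton {m m' : List Bool} {a : TapeSymbol}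
    (h : ∀ ω : Fin (A.coins p) → Bool, A.step (p, m, a, List.ofFn ω) = m') :
    A.Leads p m [a] m' := by
  rw [Leads, runFrom_singleton, stepDist]
  simp_rw [h]
  exact PMF.map_const _ _

/-- Used for the space bound, which has to hold for every outcome of the coins. -/
theorem support_runFrom_subset {S : Set (List Bool)} {m : List Bool} (hm : m ∈ S)
    (hS : ∀ m a ω, A.step (p, m, a, ω) ∈ S) (w : List TapeSymbol) :
    (A.runFrom p m w).support ⊆ S := by
  induction w using List.reverseRecOn with
  | nil => simpa [runFrom] using hm
  | append_singleton w a _ =>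
    intro m' h
    rw [runFrom_append, PMF.mem_support_bind_iff] at h
    obtain ⟨m₁, _, h⟩ := h
    rw [runFrom_singleton, stepDist, PMF.mem_support_map_iff] at h
    obtain ⟨ω, _, rfl⟩ := h
    exact hS _ _ _

/-- If the coins matter only at the symbol `a`, and a fraction `1 - ε` of their outcomes leads to
memories in `S`, then the final memory is in `S` with probability at least `1 - ε`. -/
theorem le_toOuterMeasure_runFrom {m : List Bool} {w₁ w₂ : List TapeSymbol} {a : TapeSymbol}
    {m₁ : List Bool} (h₁ : A.Leads p m w₁ m₁) {S : Set (List Bool)}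
    {good : Finset (Fin (A.coins p) → Bool)} {ε : ℝ}
    (hgood : ∀ ω ∈ good, ∃ m' ∈ S, A.Leads p (A.step (p, m₁, a, List.ofFn ω)) w₂ m')
    (hε : (1 - ε) * 2 ^ A.coins p ≤ good.card) :
    1 - ε ≤ ((A.runFrom p m (w₁ ++ a :: w₂)).toOuterMeasure S).toReal := by
  have hrun : A.runFrom p m (w₁ ++ a :: w₂) =
      (PMF.uniformOfFintype (Fin (A.coins p) → Bool)).bind fun ω =>
        A.runFrom p (A.step (p, m₁, a, List.ofFn ω)) w₂ := by
    rw [runFrom_append, h₁, PMF.pure_bind, ← List.singleton_append, runFrom_append,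
      runFrom_singleton, stepDist, PMF.bind_map]
    rfl
  have hle : ((good.card : ENNReal) * ((2 ^ A.coins p : ℕ) : ENNReal)⁻¹) ≤
      (A.runFrom p m (w₁ ++ a :: w₂)).toOuterMeasure S := by
    -- Only the good outcomes are kept in the sum; each adds its full weight `2 ^ (-coins)`, as the
    -- rest of the run is then deterministic and ends in `S`.
    rw [hrun, PMF.toOuterMeasure_bind_apply]
    refine le_trans ?_ (ENNReal.sum_le_tsum good)
    rw [← nsmul_eq_mul, ← Finset.sum_const]
    refine Finset.sum_le_sum fun ω hω => ?_
    obtain ⟨m', hm', hl⟩ := hgood ω hω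
    rw [hl, PMF.toOuterMeasure_pure_apply, if_pos hm', PMF.uniformOfFintype_apply, mul_one]
    simp
  -- Needed for monotonicity of `toReal`, which sends `⊤` to `0`.
  have hfin : (A.runFrom p m (w₁ ++ a :: w₂)).toOuterMeasure S ≠ ⊤ := by
    refine ne_top_of_le_ne_top ENNReal.one_ne_top ?_
    rw [PMF.toOuterMeasure_apply, ← PMF.tsum_coe (A.runFrom p m (w₁ ++ a :: w₂))]
    exact ENNReal.tsum_le_tsum fun x => Set.indicator_le_self _ _ x
  have := ENNReal.toReal_mono hfin hle
  refine le_trans ?_ this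
  rw [ENNReal.toReal_mul, ENNReal.toReal_inv, ENNReal.toReal_natCast, ENNReal.toReal_natCast,
    ← div_eq_mul_inv, le_div_iff₀ (by positivity)]
  push_cast
  exact hε

end Algorithm

namespace BatchedBFS

/-! ### The encoding of states by bits is injective and short. -/

section Codec

/-- The decoder read from the right. -/
theorem foldr_decodeStep_pair {m : List Bool} {st : List (List ℕ)}
    (h : m.foldr decodeStep (none, []) = (none, st)) (a b : Bool) :
    (a :: b :: m).foldr decodeStep (none, []) = (none, decodePair a b st) := by
  simp [h, decodeStep]

/-- Horner's scheme: the fold from the right meets the high digits first, so an accumulated `x` is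
shifted by the `i` lower digits. -/
theorem foldr_decodeStep_digits {m : List Bool} {x : ℕ} {l : List ℕ} {st : List (List ℕ)} (a : ℕ)
    (h : m.foldr decodeStep (none, []) = (none, (x :: l) :: st)) (i : ℕ) :
    (((List.range i).flatMap fun i => [true, decide (a / 2 ^ i % 2 = 1)]) ++ m).foldr
      decodeStep (none, []) = (none, ((x * 2 ^ i + a % 2 ^ i) :: l) :: st) := by
  induction i generalizing m x with
  | zero => simpa [Nat.mod_one] using h
  | succ i ih =>
    rw [List.range_succ, List.flatMap_append, List.append_assoc]
    refine (ih (foldr_decodeStep_pair h _ _)).trans ?_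
    have hx : (2 * x + (decide (a / 2 ^ i % 2 = 1)).toNat) * 2 ^ i + a % 2 ^ i =
        x * 2 ^ (i + 1) + a % 2 ^ (i + 1) := by
      rw [Nat.mod_pow_succ]
      rcases Nat.mod_two_eq_zero_or_one (a / 2 ^ i) with h | h <;> simp [h] <;> ring
    simp [hx]

theorem foldr_decodeStep_encodeNat {m : List Bool} {l : List ℕ} {st : List (List ℕ)} (a : ℕ)
    (h : m.foldr decodeStep (none, []) = (none, l :: st)) :
    (encodeNat a ++ m).foldr decodeStep (none, []) = (none, (a :: l) :: st) := by
  have h₁ := foldr_decodeStep_digits (x := 0) (l := l) (st := st) a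
    (foldr_decodeStep_pair h false false) (Nat.log 2 a + 1)
  rw [zero_mul, zero_add, Nat.mod_eq_of_lt (Nat.lt_pow_succ_log_self Nat.one_lt_two a)] at h₁
  rw [encodeNat, List.append_assoc]
  exact h₁

theorem foldr_decodeStep_flatMap {m : List Bool} {l : List ℕ} {st : List (List ℕ)} (l' : List ℕ)
    (h : m.foldr decodeStep (none, []) = (none, l :: st)) :
    (l'.flatMap encodeNat ++ m).foldr decodeStep (none, []) = (none, (l' ++ l) :: st) := by
  induction l' with
  | nil => exact h
  | cons a l' ih =>
    rw [List.flatMap_cons, List.append_assoc]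
    exact foldr_decodeStep_encodeNat a ih

theorem foldr_decodeStep_encodeState (st : List (List ℕ)) :
    (encodeState st).foldr decodeStep (none, []) = (none, st) := by
  induction st with
  | nil => rfl
  | cons l st ih =>
    rw [encodeState, List.flatMap_cons, List.append_assoc]
    simpa [encodeState] using foldr_decodeStep_flatMap l (foldr_decodeStep_pair ih false true)

theorem decodeState_encodeState (st : List (List ℕ)) : decodeState (encodeState st) = st := by
  rw [decodeState, foldr_decodeStep_encodeState]

theorem length_encodeNat_le {a K : ℕ} (hK : 0 < K) (ha : a < 2 ^ K) :
    (encodeNat a).length ≤ 2 * K + 2 := by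
  have := Nat.log_lt_of_lt_pow' hK.ne' ha
  simp [encodeNat]
  omega

theorem length_encodeState_le {K : ℕ} (hK : 0 < K) {st : List (List ℕ)}
    (h : ∀ l ∈ st, ∀ a ∈ l, a < 2 ^ K) :
    (encodeState st).length ≤ (2 * K + 2) * (st.map List.length).sum + 2 * st.length := by
  have hl : ∀ l : List ℕ, (∀ a ∈ l, a < 2 ^ K) →
      (l.flatMap encodeNat).length ≤ (2 * K + 2) * l.length := by
    intro l hl
    induction l with
    | nil => simp
    | cons a l ih =>
      have h₁ := length_encodeNat_le hK (hl a (by simp))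
      have h₂ := ih fun b hb => hl b (by simp [hb])
      rw [List.flatMap_cons, List.length_append, List.length_cons]
      linarith
  induction st with
  | nil => simp [encodeState]
  | cons l st ih =>
    have h₁ := hl l (h l (by simp))
    have h₂ := ih fun l' hl' => h l' (by simp [hl'])
    rw [encodeState] at h₂ ⊢
    simp only [List.flatMap_cons, List.length_append, List.map_cons, List.sum_cons,
      List.length_cons, List.length_nil]
    linarith

end Codec

theorem capped_of_le {p : Params} {m : List Bool} (h : m.length ≤ spaceCap p) :
    capped p m = m := by
  simp [capped, h]

theorem length_capped_le (p : Params) (m : List Bool) : (capped p m).length ≤ spaceCap p := by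
  by_cases h : m.length ≤ spaceCap p <;> simp [capped, h]

/-- The state `st` fits into the memory. -/
def Fits (p : Params) (st : List (List ℕ)) : Prop := (encodeState st).length ≤ spaceCap p

theorem step_encodeState {p : Params} {st st' : List (List ℕ)} {a : TapeSymbol} {ω : List Bool}
    (h : stepState p st a (bitsValue ω) = st') (hst' : Fits p st') :
    algorithm.step (p, encodeState st, a, ω) = encodeState st' := by
  subst h
  simp only [algorithm, decodeState_encodeState]
  exact capped_of_le hst'

theorem leads_singleton {p : Params} {st st' : List (List ℕ)} {a : TapeSymbol}
    (h : ∀ V, stepState p st a V = st') (hst' : Fits p st') :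
    algorithm.Leads p (encodeState st) [a] (encodeState st') :=
  Algorithm.Leads.singleton fun _ => step_encodeState (h _) hst'

end BatchedBFS

end GraphStream

/-! ### Linear counters over turnstile streams. -/

namespace GraphStream

section NetCount

variable {n : ℕ}

theorem netCount_cons (t : Update n) (σ : List (Update n)) (e : Sym2 (Fin n)) :
    netCount (t :: σ) e =
      (if s(t.1, t.2.1) = e then (if t.2.2 then (1 : ℤ) else -1) else 0) + netCount σ e := by
  simp [netCount]

/-- A linear sketch of the stream depends only on the net counts. -/
theorem sum_map_eq_sum_netCount (f : Sym2 (Fin n) → ℤ) (σ : List (Update n)) :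
    (σ.map fun t => (if t.2.2 then (1 : ℤ) else -1) * f s(t.1, t.2.1)).sum =
      ∑ e, netCount σ e * f e := by
  induction σ with
  | nil => simp [netCount]
  | cons t σ ih =>
    simp_rw [netCount_cons, add_mul, Finset.sum_add_distrib, ← ih, ite_mul, zero_mul]
    simp

theorem card_sym2_le (n : ℕ) : Fintype.card (Sym2 (Fin n)) ≤ n * n := by
  have h := Fintype.card_le_of_surjective (fun x : Fin n × Fin n => s(x.1, x.2))
    fun e => by induction e with | _ a b => exact ⟨(a, b), rfl⟩
  simpa using h

open scoped Classical in
-- The net count of a turnstile stream is the indicator of the edge set, so a signed sum over the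
-- updates counts edges.
theorem IsTurnstileStream.sum_indicator {σ : List (Update n)} {G : SimpleGraph (Fin n)}
    (h : IsTurnstileStream σ G) (P : Sym2 (Fin n) → Prop) :
    (σ.map fun t => (if t.2.2 then (1 : ℤ) else -1) * if P s(t.1, t.2.1) then 1 else 0).sum =
      ((Finset.univ.filter fun e => e ∈ G.edgeSet ∧ P e).card : ℤ) := by
  rw [sum_map_eq_sum_netCount fun e => if P e then 1 else 0, Finset.card_filter]
  push_cast
  refine Finset.sum_congr rfl fun e _ => ?_
  rw [h.2 e]
  by_cases h₁ : e ∈ G.edgeSet <;> by_cases h₂ : P e <;> simp [h₁, h₂]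

end NetCount

namespace BatchedBFS

section Sketch

variable (p : Params) (r : ℕ) (cur prev : List ℕ)

theorem hits_comm (a b z : ℕ) : hits p r cur prev a b z = hits p r cur prev b a z := by
  simp only [hits, Bool.or_comm]

/-- The value modulo `M` of the counter of `z` after the updates in `σ`. -/
def counter {n : ℕ} (σ : List (Update n)) (z : ℕ) : ℕ :=
  ((σ.map fun t => (if t.2.2 then (1 : ℤ) else -1) *
    if hits p r cur prev t.1 t.2.1 z then 1 else 0).sum % (codeBase p : ℤ)).toNat

theorem codeBase_pos : 0 < codeBase p := by
  unfold codeBase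
  positivity

theorem counter_lt {n : ℕ} (σ : List (Update n)) (z : ℕ) :
    counter p r cur prev σ z < codeBase p := by
  have h := codeBase_pos p
  have := Int.emod_lt_of_pos (σ.map fun t => (if t.2.2 then (1 : ℤ) else -1) *
    if hits p r cur prev t.1 t.2.1 z then 1 else 0).sum (b := (codeBase p : ℤ)) (by omega)
  unfold counter
  omega

theorem bump_counter {n : ℕ} (σ : List (Update n)) (t : Update n) (z : ℕ) :
    bump p r cur prev t.1 t.2.1 t.2.2 (z * codeBase p + counter p r cur prev σ z) =
      z * codeBase p + counter p r cur prev (σ ++ [t]) z := by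
  have hM := codeBase_pos p
  have hlt := counter_lt p r cur prev σ z
  have h₁ : (z * codeBase p + counter p r cur prev σ z) / codeBase p = z := by
    rw [mul_comm, Nat.mul_add_div hM, Nat.div_eq_of_lt hlt, add_zero]
  have h₂ : (z * codeBase p + counter p r cur prev σ z) % codeBase p =
      counter p r cur prev σ z := by
    rw [mul_comm, Nat.mul_add_mod, Nat.mod_eq_of_lt hlt]
  rw [bump, h₁, h₂]
  by_cases h : hits p r cur prev t.1 t.2.1 z
  · rw [h, cond_true]
    congr 1
    zify
    unfold counter
    rw [List.map_append, List.sum_append]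
    set S := (σ.map fun t => (if t.2.2 then (1 : ℤ) else -1) *
      if hits p r cur prev t.1 t.2.1 z then 1 else 0).sum
    have hM' : (codeBase p : ℤ) ≠ 0 := by omega
    rw [Int.toNat_of_nonneg (Int.emod_nonneg _ hM'), Int.toNat_of_nonneg (Int.emod_nonneg _ hM')]
    cases hs : t.2.2
    · simp only [List.map_cons, hs, h, List.map_nil, List.sum_cons, List.sum_nil, cond_false]
      rw [Nat.cast_sub (by omega), Int.emod_add_emod]
      -- A deletion adds `codeBase - 1`, that is, `-1` modulo `codeBase`.
      rw [show S + ((codeBase p : ℤ) - (1 : ℕ)) = S - 1 + codeBase p by push_cast; ring,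
        Int.add_emod_right]
      simp [sub_eq_add_neg]
    · simp [hs, h]
  · simp [h, counter]

theorem survivors_map {n : ℕ} (σ : List (Update n)) (L : List ℕ) (z : ℕ) :
    z ∈ survivors p (L.map fun z => z * codeBase p + counter p r cur prev σ z) ↔
      z ∈ L ∧ counter p r cur prev σ z ≠ 0 := by
  have hM := codeBase_pos p
  have h₁ : ∀ z, (z * codeBase p + counter p r cur prev σ z) / codeBase p = z := fun z => by
    rw [mul_comm, Nat.mul_add_div hM, Nat.div_eq_of_lt (counter_lt p r cur prev σ z), add_zero]
  have h₂ : ∀ z, (z * codeBase p + counter p r cur prev σ z) % codeBase p =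
      counter p r cur prev σ z := fun z => by
    rw [mul_comm, Nat.mul_add_mod, Nat.mod_eq_of_lt (counter_lt p r cur prev σ z)]
  simp only [survivors, List.mem_map, List.mem_filter]
  constructor
  · rintro ⟨_, ⟨⟨y, hy, rfl⟩, h⟩, rfl⟩
    rw [h₁]
    rw [h₂] at h
    exact ⟨hy, by simpa using h⟩
  · rintro ⟨hz, h⟩
    exact ⟨_, ⟨⟨z, hz, rfl⟩, by simpa [h₂] using h⟩, h₁ z⟩

/-- The graph on the numbers of the nodes. -/
abbrev natGraph {n : ℕ} (G : SimpleGraph (Fin n)) : SimpleGraph ℕ := G.map Fin.valEmbedding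

/-- The edge from `q` to `v` leads the `j`-th search to a new node, and `x` is its code. -/
def IsCode {n : ℕ} (G : SimpleGraph (Fin n)) (x : ℕ) : Prop :=
  ∃ j < rootCount p, ∃ q v, (natGraph G).Adj q v ∧ fresh p cur prev j q v ∧ x = code p j v q

/-- The counter counts edges rather than codes: an edge adds one however many searches it serves.
The count is thus at most `n * n`, less than the modulus, and cannot wrap around to zero. -/
theorem counter_ne_zero_iff {n : ℕ} {σ : List (Update n)} {G : SimpleGraph (Fin n)}
    (h : IsTurnstileStream σ G) (hn : n * n < codeBase p) (z : ℕ) :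
    counter p r cur prev σ z ≠ 0 ↔ ∃ x, IsCode p cur prev G x ∧ x / 2 ^ r = z := by
  classical
  -- A hit does not depend on the order of the endpoints, so it is a property of the unordered pair.
  set P : Sym2 (Fin n) → Prop := fun e => ∃ a b : Fin n, s(a, b) = e ∧ hits p r cur prev a b z
  have hP : ∀ a b : Fin n, P s(a, b) ↔ hits p r cur prev a b z = true := by
    intro a b
    constructor
    · rintro ⟨a', b', he, hh⟩
      rcases Sym2.eq_iff.1 he with ⟨rfl, rfl⟩ | ⟨rfl, rfl⟩
      · exact hh
      · rw [hits_comm]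
        exact hh
    · exact fun hh => ⟨a, b, rfl, hh⟩
  have hc : counter p r cur prev σ z =
      (Finset.univ.filter fun e => e ∈ G.edgeSet ∧ P e).card := by
    have h₁ := IsTurnstileStream.sum_indicator h P
    simp_rw [hP] at h₁
    rw [counter, h₁]
    have h₂ : (Finset.univ.filter fun e => e ∈ G.edgeSet ∧ P e).card < codeBase p :=
      lt_of_le_of_lt ((Finset.card_le_univ _).trans (card_sym2_le n)) hn
    rw [← Int.natCast_mod, Int.toNat_natCast]
    convert Nat.mod_eq_of_lt h₂
  rw [hc, Finset.card_ne_zero]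
  constructor
  · rintro ⟨e, he⟩
    rw [Finset.mem_filter] at he
    obtain ⟨-, he, a, b, rfl, hh⟩ := he
    have hadj : (natGraph G).Adj a b := by
      rw [SimpleGraph.map_adj]
      exact ⟨a, b, he, rfl, rfl⟩
    simp only [hits, List.any_eq_true, List.mem_range, Bool.or_eq_true, Bool.and_eq_true,
      decide_eq_true_eq] at hh
    obtain ⟨j, hj, ⟨hf, hz⟩ | ⟨hf, hz⟩⟩ := hh
    · exact ⟨_, ⟨j, hj, a, b, hadj, hf, rfl⟩, hz⟩
    · exact ⟨_, ⟨j, hj, b, a, hadj.symm, hf, rfl⟩, hz⟩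
  · rintro ⟨_, ⟨j, hj, q, v, hadj, hf, rfl⟩, hz⟩
    rw [SimpleGraph.map_adj] at hadj
    obtain ⟨a, b, hab, rfl, rfl⟩ := hadj
    refine ⟨s(a, b), Finset.mem_filter.2 ⟨Finset.mem_univ _, hab, a, b, rfl, ?_⟩⟩
    simp only [hits, List.any_eq_true, List.mem_range, Bool.or_eq_true, Bool.and_eq_true,
      decide_eq_true_eq]
    exact ⟨j, hj, Or.inl ⟨hf, hz⟩⟩

end Sketch

section Pass

variable {p : Params}

theorem children_eq (Z : List ℕ) :
    children p Z = (Z.flatMap fun z => [2 * z, 2 * z + 1]).map (· * codeBase p) := by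
  simp [children, List.map_flatMap]

theorem mem_flatMap_bits {Z : List ℕ} {z : ℕ} :
    z ∈ (Z.flatMap fun z => [2 * z, 2 * z + 1]) ↔ z / 2 ∈ Z := by
  simp only [List.mem_flatMap, List.mem_cons, List.not_mem_nil, or_false]
  constructor
  · rintro ⟨y, hy, rfl | rfl⟩
    · rwa [Nat.mul_div_cancel_left _ two_pos]
    · rwa [show (2 * y + 1) / 2 = y by omega]
  · exact fun h => ⟨_, h, by omega⟩

/-- During the updates of a pass only the counters change. The case `L = []` also covers the first
pass, which has no counters. -/
theorem leads_edges {n : ℕ} (σ : List (Update n)) {cnt : ℕ} {roots cur prev E val L : List ℕ}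
    (hL : ∀ z ∈ L, z < codeBase p)
    (hfit : ∀ W : List ℕ, W.length = L.length → (∀ w ∈ W, w < codeBase p * codeBase p) →
      Fits p (mkState cnt roots cur prev W E val)) :
    algorithm.Leads p (encodeState (mkState cnt roots cur prev (L.map (· * codeBase p)) E val))
      (σ.map fun t => some ((t.1 : ℕ), (t.2.1 : ℕ), t.2.2))
      (encodeState (mkState cnt roots cur prev (L.map fun z => z * codeBase p +
        counter p (codeBits p - 1 - (cnt - 1) % codeBits p) cur prev σ z) E val)) := by
  induction σ using List.reverseRecOn with
  | nil =>
    have : ∀ z, counter p (codeBits p - 1 - (cnt - 1) % codeBits p) cur prev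
      ([] : List (Update n)) z = 0 := fun z => by simp [counter]
    simp only [this, add_zero]
    exact Algorithm.Leads.nil _
  | append_singleton σ t ih =>
    rw [List.map_append]
    refine ih.append (leads_singleton (fun V => ?_) (hfit _ (by simp) ?_))
    · simp only [stepState, mkState, stepEdge, Option.isSome_some, cond_true, Option.getD_some,
        List.getD_cons_zero, List.getD_cons_succ, List.headI_cons, List.map_map]
      congr 5
      exact List.map_congr_left fun z _ => bump_counter p _ cur prev σ t z
    · intro w hw
      obtain ⟨z, hz, rfl⟩ := List.mem_map.1 hw
      have h₁ := counter_lt p (codeBits p - 1 - (cnt - 1) % codeBits p) cur prev (σ ++ [t]) z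
      have h₂ := hL z hz
      calc _ < z * codeBase p + codeBase p := by omega
        _ = (z + 1) * codeBase p := by ring
        _ ≤ _ := Nat.mul_le_mul_right _ h₂

/-- A pass that finds out which extensions of the prefixes in `Z` occur. -/
theorem leads_onePass {n : ℕ} {σ : List (Update n)} {G : SimpleGraph (Fin n)}
    (hσ : IsTurnstileStream σ G) (hn : n * n < codeBase p) {cnt : ℕ}
    {roots cur prev E val Z : List ℕ} (hcnt : cnt ≠ 0) (hZ : ∀ z ∈ Z, 2 * z + 1 < codeBase p)
    (hfit : ∀ W : List ℕ, W.length = 2 * Z.length → (∀ w ∈ W, w < codeBase p * codeBase p) →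
      Fits p (mkState cnt roots cur prev W E val)) :
    ∃ W, (∀ z, z ∈ survivors p W ↔ z / 2 ∈ Z ∧ ∃ x, IsCode p cur prev G x ∧
        x / 2 ^ (codeBits p - 1 - (cnt - 1) % codeBits p) = z) ∧
      ∀ st, stepSearch p cnt roots cur prev W E val = st → Fits p st →
        algorithm.Leads p (encodeState (mkState cnt roots cur prev (children p Z) E val))
          (onePass σ) (encodeState st) := by
  set L := Z.flatMap fun z => [2 * z, 2 * z + 1] with hL
  have hlen : L.length = 2 * Z.length := by
    rw [hL]
    induction Z with
    | nil => rfl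
    | cons z Z _ => simp; omega
  refine ⟨L.map fun z => z * codeBase p +
    counter p (codeBits p - 1 - (cnt - 1) % codeBits p) cur prev σ z, fun z => ?_,
    fun st hst hfst => ?_⟩
  · rw [survivors_map, counter_ne_zero_iff _ _ _ _ hσ hn, mem_flatMap_bits]
  · rw [onePass, children_eq]
    refine (leads_edges σ (fun z hz => ?_) fun W hW => hfit W (hW.trans hlen)).append
      (leads_singleton (fun V => ?_) hfst)
    · have := hZ _ (mem_flatMap_bits.1 hz)
      omega
    · rw [← hst]
      simp [stepState, mkState, stepEnd, hcnt]

end Pass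

/-! ### Bitwise search for the least codes. -/

section Prefixes

variable {p : Params}

/-- The code `x` is the least one with its root and node. -/
def IsLeast (p : Params) (S : ℕ → Prop) (x : ℕ) : Prop :=
  S x ∧ ∀ x', S x' → x' / nodeBase p = x / nodeBase p → x ≤ x'

theorem exists_isLeast {S : ℕ → Prop} {x : ℕ} (hx : S x) :
    ∃ y, IsLeast p S y ∧ y / nodeBase p = x / nodeBase p ∧ y ≤ x := by
  classical
  have h : ∃ y, S y ∧ y / nodeBase p = x / nodeBase p := ⟨x, hx, rfl⟩
  refine ⟨Nat.find h, ⟨(Nat.find_spec h).1, fun x' hx' he => Nat.find_min' h ⟨hx', ?_⟩⟩,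
    (Nat.find_spec h).2, Nat.find_min' h ⟨hx, rfl⟩⟩
  exact he.trans (Nat.find_spec h).2

/-- The prefix of a least code always survives and is the smallest surviving prefix of its (root,
node) group, so the minimum rule keeps it and removes every other prefix of the group. For `Z` only
one inclusion is assumed, since the initial empty prefix is present even when there are no codes. -/
theorem mem_refinePrefixes {S : ℕ → Prop} (hS : ∀ x, S x → x < codeBase p) {ℓ : ℕ}
    (hℓ : ℓ < codeBits p) {Z W : List ℕ}
    (hZ : ∀ x, IsLeast p S x → x / 2 ^ (codeBits p - ℓ) ∈ Z)
    (hW : ∀ z, z ∈ survivors p W ↔ z / 2 ∈ Z ∧ ∃ x, S x ∧ x / 2 ^ (codeBits p - 1 - ℓ) = z)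
    (z : ℕ) :
    z ∈ refinePrefixes p ℓ W ↔ ∃ x, IsLeast p S x ∧ x / 2 ^ (codeBits p - 1 - ℓ) = z := by
  have hdiv : ∀ x, x / 2 ^ (codeBits p - 1 - ℓ) / 2 = x / 2 ^ (codeBits p - ℓ) := fun x => by
    rw [Nat.div_div_eq_div_mul, ← pow_succ]
    congr 2
    omega
  have hleast : ∀ x, IsLeast p S x → x / 2 ^ (codeBits p - 1 - ℓ) ∈ survivors p W := fun x hx =>
    (hW _).2 ⟨by rw [hdiv]; exact hZ x hx, x, hx.1, rfl⟩
  have hb : nodeBits p ≤ codeBits p := by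
    unfold codeBits
    omega
  have hgroup : ∀ x, 0 < ℓ + 1 + nodeBits p - codeBits p →
      x / 2 ^ (codeBits p - 1 - ℓ) / 2 ^ (ℓ + 1 + nodeBits p - codeBits p) =
        x / nodeBase p := fun x h => by
    rw [Nat.div_div_eq_div_mul, ← pow_add, nodeBase]
    congr 2
    omega
  simp only [refinePrefixes, List.mem_filter, List.mem_range, Bool.and_eq_true, Bool.not_eq_true',
    decide_eq_true_eq, List.any_eq_false, not_and]
  constructor
  · rintro ⟨-, hz, hmin⟩
    obtain ⟨-, x, hx, rfl⟩ := (hW z).1 hz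
    obtain ⟨y, hy, hyx, hle⟩ := exists_isLeast (p := p) hx
    refine ⟨y, hy, ?_⟩
    rcases Nat.eq_zero_or_pos (ℓ + 1 + nodeBits p - codeBits p) with h0 | h0
    -- No parent bit has been reached, so all codes of the group share this prefix.
    · have hs : codeBits p - 1 - ℓ = nodeBits p + (codeBits p - 1 - ℓ - nodeBits p) := by omega
      rw [hs, pow_add, ← Nat.div_div_eq_div_mul, ← Nat.div_div_eq_div_mul]
      exact congrArg (· / _) hyx
    · refine le_antisymm (Nat.div_le_div_right hle) (not_lt.1 fun hlt => ?_)
      refine hmin _ (hleast y hy) hlt ?_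
      rw [hgroup y h0, hgroup x h0, hyx]
  · rintro ⟨x, hx, rfl⟩
    refine ⟨?_, hleast x hx, fun z' hz' hlt he => ?_⟩
    · rw [Nat.div_lt_iff_lt_mul (by positivity), ← pow_add]
      refine (hS x hx.1).trans_le ?_
      unfold codeBase
      exact Nat.pow_le_pow_right two_pos (by omega)
    · obtain ⟨-, x', hx', rfl⟩ := (hW z').1 hz'
      rcases Nat.eq_zero_or_pos (ℓ + 1 + nodeBits p - codeBits p) with h0 | h0
      · rw [h0] at he
        simp at he
        omega
      · rw [hgroup x' h0, hgroup x h0] at he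
        exact absurd (Nat.div_le_div_right (hx.2 x' hx' he)) (not_le.2 hlt)

theorem nodup_refinePrefixes (ℓ : ℕ) (W : List ℕ) : (refinePrefixes p ℓ W).Nodup :=
  List.nodup_range.filter _

end Prefixes

end BatchedBFS

end GraphStream

/-! ### Shortest paths and extended distances. -/

namespace SimpleGraph

variable {V : Type*} {H : SimpleGraph V}

theorem edist_le_add_one_of_adj {q v : V} (u : V) (h : H.Adj q v) :
    H.edist u v ≤ H.edist u q + 1 := by
  rw [← edist_eq_one_iff_adj.2 h]
  exact H.edist_triangle

/-- Cut a shortest walk after `a` steps: the two parts bound the distances from above, and the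
triangle inequality forces equality. -/
theorem exists_edist_eq_of_edist_eq_add {u v : V} {a b : ℕ} (h : H.edist u v = (a + b : ℕ)) :
    ∃ x, H.edist u x = a ∧ H.edist x v = b := by
  obtain ⟨w, hw⟩ := exists_walk_of_edist_eq_coe h
  have h₁ := edist_le (w.take a)
  have h₂ := edist_le (w.drop a)
  rw [Walk.take_length, hw, min_eq_left (by omega)] at h₁
  rw [Walk.drop_length, hw, Nat.add_sub_cancel_left] at h₂
  have h₃ := H.edist_triangle (u := u) (v := w.getVert a) (w := v)
  rw [h] at h₃
  refine ⟨w.getVert a, ?_⟩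
  generalize H.edist u (w.getVert a) = x at *
  generalize H.edist (w.getVert a) v = y at *
  lift x to ℕ using ne_top_of_le_ne_top (ENat.natCast_ne_top _) h₁
  lift y to ℕ using ne_top_of_le_ne_top (ENat.natCast_ne_top _) h₂
  norm_cast at *
  omega

theorem exists_adj_of_edist_eq_succ {u v : V} {d : ℕ} (h : H.edist u v = (d + 1 : ℕ)) :
    ∃ q, H.Adj q v ∧ H.edist u q = d := by
  obtain ⟨q, h₁, h₂⟩ := exists_edist_eq_of_edist_eq_add h
  exact ⟨q, edist_eq_one_iff_adj.1 (by exact_mod_cast h₂), h₁⟩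

end SimpleGraph

namespace GraphStream.BatchedBFS

theorem enat_eq_of_add_one_eq {x : ℕ∞} {d : ℕ} (h : x + 1 = (d + 1 : ℕ)) : x = d := by
  have hx : x ≠ ⊤ := by
    rintro rfl
    rw [top_add] at h
    exact ENat.natCast_ne_top _ h.symm
  lift x to ℕ using hx
  norm_cast at *
  omega

section Numbers

variable (p : Params)

theorem nodeBase_pos : 0 < nodeBase p := by
  unfold nodeBase
  positivity

theorem lt_nodeBase : p.1 < nodeBase p := Nat.lt_pow_succ_log_self Nat.one_lt_two _

theorem nodeBase_le (h : 1 ≤ p.1) : nodeBase p ≤ 2 * p.1 := by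
  rw [nodeBase, nodeBits, pow_succ, mul_comm]
  exact Nat.mul_le_mul_left 2 (Nat.pow_log_le_self 2 (by omega))

theorem codeBase_eq : codeBase p = 2 * nodeBase p * nodeBase p * nodeBase p := by
  rw [codeBase, codeBits, nodeBase]
  ring

theorem radius_pos : 0 < radius p := by
  unfold radius
  positivity

variable {p}

theorem key_div {j v : ℕ} (hv : v < nodeBase p) : (j * nodeBase p + v) / nodeBase p = j := by
  rw [mul_comm, Nat.mul_add_div (nodeBase_pos p), Nat.div_eq_of_lt hv, add_zero]

theorem key_mod {j v : ℕ} (hv : v < nodeBase p) : (j * nodeBase p + v) % nodeBase p = v := by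
  rw [mul_comm, Nat.mul_add_mod, Nat.mod_eq_of_lt hv]

theorem code_div {j v q : ℕ} (hq : q < nodeBase p) :
    code p j v q / nodeBase p = j * nodeBase p + v := key_div hq

theorem code_mod {j v q : ℕ} (hq : q < nodeBase p) : code p j v q % nodeBase p = q := key_mod hq

theorem code_lt {j v q : ℕ} (hJ : rootCount p ≤ 2 * nodeBase p) (hj : j < rootCount p)
    (hv : v < nodeBase p) (hq : q < nodeBase p) : code p j v q < codeBase p := by
  rw [codeBase_eq, code]
  calc (j * nodeBase p + v) * nodeBase p + q < (j * nodeBase p + v + 1) * nodeBase p := by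
        rw [Nat.succ_mul]; omega
    _ ≤ ((j + 1) * nodeBase p) * nodeBase p := by
        refine Nat.mul_le_mul_right _ ?_
        rw [add_mul j]
        omega
    _ ≤ _ := Nat.mul_le_mul_right _ (Nat.mul_le_mul_right _ (by omega))

variable {d x : ℕ}

theorem item_div (hx : x < codeBase p) : (d * codeBase p + x) / codeBase p = d := by
  rw [mul_comm, Nat.mul_add_div (codeBase_pos p), Nat.div_eq_of_lt hx, add_zero]

theorem item_mod (hx : x < codeBase p) : (d * codeBase p + x) % codeBase p = x := by
  rw [mul_comm, Nat.mul_add_mod, Nat.mod_eq_of_lt hx]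

end Numbers

/-! ### The layers of the delayed searches. -/

section Layers

variable (p : Params) (roots : List ℕ) (H : SimpleGraph ℕ)

/-- The parameters, roots and graph are as they should be. -/
structure Admissible : Prop where
  rootCount_le : rootCount p ≤ 2 * nodeBase p
  lt_of_adj : ∀ {a b}, H.Adj a b → a < p.1
  node_lt : ∀ j < rootCount p, rootNode p roots j < p.1
  delay_lt : ∀ j < rootCount p, rootDelay p roots j < radius p
  edist_lt : ∀ j < rootCount p, ∀ (v r : ℕ), H.edist (rootNode p roots j) v = r → r < p.1

/-- The `j`-th search is in progress at the moment `ρ`. -/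
def Active (ρ j : ℕ) : Prop :=
  j < rootCount p ∧ rootDelay p roots j ≤ ρ ∧ ρ < rootDelay p roots j + radius p

/-- `q` is the least parent of `v` in the `j`-th search. -/
def IsParent (j v q : ℕ) : Prop :=
  H.Adj q v ∧ H.edist (rootNode p roots j) q + 1 = H.edist (rootNode p roots j) v ∧
    ∀ q', H.Adj q' v → H.edist (rootNode p roots j) q' + 1 = H.edist (rootNode p roots j) v →
      q ≤ q'

def LayerSpec (ρ : ℕ) (cur : List ℕ) : Prop :=
  ∀ j v, v < nodeBase p → (j * nodeBase p + v ∈ cur ↔ Active p roots ρ j ∧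
    H.edist (rootNode p roots j) v = (ρ - rootDelay p roots j : ℕ))

/-- With `+ 1` on the left, the condition is unsatisfiable at the moment a search starts, when it
has no previous layer. -/
def PrevSpec (ρ : ℕ) (prev : List ℕ) : Prop :=
  ∀ j v, v < nodeBase p → Active p roots ρ j → (j * nodeBase p + v ∈ prev ↔
    H.edist (rootNode p roots j) v + 1 = (ρ - rootDelay p roots j : ℕ))

/-- The codes that the search at the moment `ρ` should find. -/
def IsFound (ρ x : ℕ) : Prop :=
  ∃ j v q, x = code p j v q ∧ Active p roots ρ j ∧
    H.edist (rootNode p roots j) v = (ρ - rootDelay p roots j + 1 : ℕ) ∧ IsParent p roots H j v q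

variable {p roots H}

theorem Admissible.lt_of_edist (h : Admissible p roots H) {j v d : ℕ} (hj : j < rootCount p)
    (hv : H.edist (rootNode p roots j) v = d) : v < p.1 := by
  cases d with
  | zero =>
    rw [Nat.cast_zero, SimpleGraph.edist_eq_zero_iff] at hv
    exact hv ▸ h.node_lt j hj
  | succ d =>
    obtain ⟨q, hq, -⟩ := SimpleGraph.exists_adj_of_edist_eq_succ hv
    exact h.lt_of_adj hq.symm

theorem exists_isParent {j v d : ℕ} (hv : H.edist (rootNode p roots j) v = (d + 1 : ℕ)) :
    ∃ q, IsParent p roots H j v q := by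
  classical
  have h : ∃ q, H.Adj q v ∧
      H.edist (rootNode p roots j) q + 1 = H.edist (rootNode p roots j) v := by
    obtain ⟨q, hq, hd⟩ := SimpleGraph.exists_adj_of_edist_eq_succ hv
    exact ⟨q, hq, by rw [hd, hv]; norm_cast⟩
  exact ⟨Nat.find h, (Nat.find_spec h).1, (Nat.find_spec h).2, fun q' h₁ h₂ =>
    Nat.find_min' h ⟨h₁, h₂⟩⟩

theorem IsParent.unique {j v q q' : ℕ} (h : IsParent p roots H j v q)
    (h' : IsParent p roots H j v q') : q = q' :=
  le_antisymm (h.2.2 _ h'.1 h'.2.1) (h'.2.2 _ h.1 h.2.1)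

theorem Admissible.parent_lt (h : Admissible p roots H) {j v q : ℕ}
    (hq : IsParent p roots H j v q) : v < nodeBase p ∧ q < nodeBase p :=
  ⟨(h.lt_of_adj hq.1.symm).trans (lt_nodeBase p), (h.lt_of_adj hq.1).trans (lt_nodeBase p)⟩

section Found

variable {n : ℕ} {G : SimpleGraph (Fin n)} {ρ : ℕ} {cur prev : List ℕ}

/-- A neighbour of a node at depth `d` has depth `d - 1`, `d` or `d + 1`; excluding the previous and
the current layer leaves `d + 1`. Two layers of memory per search therefore suffice. -/
theorem isCode_iff (h : Admissible p roots (natGraph G))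
    (hcur : LayerSpec p roots (natGraph G) ρ cur) (hprev : PrevSpec p roots (natGraph G) ρ prev)
    (x : ℕ) : IsCode p cur prev G x ↔ ∃ j v q, x = code p j v q ∧ Active p roots ρ j ∧
      (natGraph G).edist (rootNode p roots j) v = (ρ - rootDelay p roots j + 1 : ℕ) ∧
        (natGraph G).Adj q v ∧
      (natGraph G).edist (rootNode p roots j) q = (ρ - rootDelay p roots j : ℕ) := by
  set H := natGraph G
  constructor
  · rintro ⟨j, hj, q, v, hadj, hf, rfl⟩
    have hq := (h.lt_of_adj hadj).trans (lt_nodeBase p)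
    have hv := (h.lt_of_adj hadj.symm).trans (lt_nodeBase p)
    simp only [fresh, Bool.and_eq_true, decide_eq_true_eq, Bool.not_eq_true',
      decide_eq_false_iff_not] at hf
    obtain ⟨hq', hv₁, hv₂⟩ := hf
    rw [hcur j q hq] at hq'
    obtain ⟨hact, hq'⟩ := hq'
    rw [hcur j v hv] at hv₁
    rw [hprev j v hv hact] at hv₂
    refine ⟨j, v, q, rfl, hact, ?_, hadj, hq'⟩
    have h₁ := SimpleGraph.edist_le_add_one_of_adj (rootNode p roots j) hadj
    have h₂ := SimpleGraph.edist_le_add_one_of_adj (rootNode p roots j) hadj.symm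
    replace hv₁ : H.edist (rootNode p roots j) v ≠ (ρ - rootDelay p roots j : ℕ) :=
      fun he => hv₁ ⟨hact, he⟩
    rw [hq'] at h₁ h₂
    generalize H.edist (rootNode p roots j) v = y at *
    lift y to ℕ using ne_top_of_le_ne_top (by simp) h₁
    norm_cast at *
    omega
  · rintro ⟨j, v, q, rfl, hact, hv', hadj, hq'⟩
    have hq := (h.lt_of_adj hadj).trans (lt_nodeBase p)
    have hv := (h.lt_of_adj hadj.symm).trans (lt_nodeBase p)
    refine ⟨j, hact.1, q, v, hadj, ?_, rfl⟩
    simp only [fresh, Bool.and_eq_true, decide_eq_true_eq, Bool.not_eq_true',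
      decide_eq_false_iff_not]
    rw [hcur j q hq, hcur j v hv, hprev j v hv hact, hv']
    refine ⟨⟨hact, hq'⟩, fun he => ?_, fun he => ?_⟩
    · have := he.2
      norm_cast at this
      omega
    · norm_cast at he
      omega

theorem isCode_lt (h : Admissible p roots (natGraph G))
    (x : ℕ) (hx : IsCode p cur prev G x) : x < codeBase p := by
  obtain ⟨j, hj, q, v, hadj, -, rfl⟩ := hx
  exact code_lt h.rootCount_le hj ((h.lt_of_adj hadj.symm).trans (lt_nodeBase p))
    ((h.lt_of_adj hadj).trans (lt_nodeBase p))

/-- The parent occupies the low bits of a code, so within one (root, node) group the least code is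
the one with the least parent. -/
theorem isLeast_isCode_iff (h : Admissible p roots (natGraph G))
    (hcur : LayerSpec p roots (natGraph G) ρ cur) (hprev : PrevSpec p roots (natGraph G) ρ prev)
    (x : ℕ) : IsLeast p (IsCode p cur prev G) x ↔ IsFound p roots (natGraph G) ρ x := by
  have hlt : ∀ {a b}, (natGraph G).Adj a b → a < nodeBase p :=
    fun hab => (h.lt_of_adj hab).trans (lt_nodeBase p)
  simp only [IsLeast, isCode_iff h hcur hprev]
  constructor
  · rintro ⟨⟨j, v, q, rfl, hact, hv, hadj, hq⟩, hmin⟩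
    refine ⟨j, v, q, rfl, hact, hv, hadj, by rw [hq, hv]; norm_cast, fun q' hadj' hq' => ?_⟩
    rw [hv] at hq'
    have hq'' : (natGraph G).edist (rootNode p roots j) q' = (ρ - rootDelay p roots j : ℕ) := by
      exact enat_eq_of_add_one_eq hq'
    have := hmin _ ⟨j, v, q', rfl, hact, hv, hadj', hq''⟩
      (by rw [code_div (hlt hadj'), code_div (hlt hadj)])
    unfold code at this
    omega
  · rintro ⟨j, v, q, rfl, hact, hv, hadj, hq, hmin⟩
    have hq'' : (natGraph G).edist (rootNode p roots j) q = (ρ - rootDelay p roots j : ℕ) := by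
      rw [hv] at hq
      exact enat_eq_of_add_one_eq hq
    refine ⟨⟨j, v, q, rfl, hact, hv, hadj, hq''⟩, ?_⟩
    rintro _ ⟨j', v', q', rfl, -, hv', hadj', hq'⟩ he
    rw [code_div (hlt hadj'), code_div (hlt hadj)] at he
    have hj : j' = j := by
      rw [← key_div (p := p) (j := j') (hlt hadj'.symm), he, key_div (hlt hadj.symm)]
    have hvv : v' = v := by
      rw [← key_mod (p := p) (j := j') (hlt hadj'.symm), he, key_mod (hlt hadj.symm)]
    subst hj hvv
    have := hmin q' hadj' (by rw [hq', hv]; norm_cast)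
    unfold code
    omega

end Found

section Next

variable {ρ : ℕ} {cur found : List ℕ}

theorem nodup_nextLayers : (nextLayers p roots ρ found).Nodup := List.nodup_range.filter _

/-- A delay is at most `R - 1`, so a search is last active at a moment at most `2 R - 2`; the last
moment `2 R - 1` of a period is idle, and the next period starts from empty layers. -/
theorem not_active_period (h : Admissible p roots H) (hρ : ρ + 1 = period p) (j : ℕ) :
    ¬ Active p roots ρ j := by
  rintro ⟨hj, -, h₂⟩
  have := h.delay_lt j hj
  unfold period at hρ
  omega

theorem layerSpec_nextLayers_zero (hf : ∀ x, x ∉ found) :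
    LayerSpec p roots H 0 (nextLayers p roots 0 found) := by
  intro j v hv
  have hR := radius_pos p
  have hfd : found = [] := List.eq_nil_iff_forall_not_mem.2 hf
  simp only [nextLayers, starts, List.mem_filter, List.mem_range, hfd, key_div hv, key_mod hv,
    Bool.or_eq_true, Bool.and_eq_true, decide_eq_true_eq, List.map_nil, List.not_mem_nil,
    false_and, false_or, Active, Nat.zero_sub, Nat.cast_zero, SimpleGraph.edist_eq_zero_iff]
  constructor
  · rintro ⟨h₁, h₂, h₃⟩
    have hj : j < rootCount p := by
      by_contra hj
      have := Nat.mul_le_mul_right (nodeBase p) (not_lt.1 hj)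
      omega
    exact ⟨⟨hj, by omega, by omega⟩, h₃.symm⟩
  · rintro ⟨⟨h₁, h₂, h₃⟩, h₄⟩
    have := Nat.mul_le_mul_right (nodeBase p) h₁
    rw [Nat.succ_mul] at this
    exact ⟨by omega, by omega, h₄.symm⟩

theorem layerSpec_nextLayers_succ (h : Admissible p roots H)
    (hf : ∀ x, x ∈ found ↔ IsFound p roots H ρ x) :
    LayerSpec p roots H (ρ + 1) (nextLayers p roots (ρ + 1) found) := by
  intro j v hv
  have hR := radius_pos p
  have hmap : j * nodeBase p + v ∈ found.map (fun x => x / nodeBase p) ↔ Active p roots ρ j ∧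
      H.edist (rootNode p roots j) v = (ρ - rootDelay p roots j + 1 : ℕ) := by
    simp only [List.mem_map, hf]
    constructor
    · rintro ⟨_, ⟨j', v', q, rfl, hact, hv', hq⟩, he⟩
      obtain ⟨h₁, h₂⟩ := h.parent_lt hq
      rw [code_div h₂] at he
      have hj : j' = j := by
        rw [← key_div (p := p) (j := j') h₁, he, key_div hv]
      have hvv : v' = v := by
        rw [← key_mod (p := p) (j := j') h₁, he, key_mod hv]
      subst hj hvv
      exact ⟨hact, hv'⟩
    · rintro ⟨hact, hv'⟩
      obtain ⟨q, hq⟩ := exists_isParent hv'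
      exact ⟨_, ⟨j, v, q, rfl, hact, hv', hq⟩, code_div (h.parent_lt hq).2⟩
  simp only [nextLayers, starts, List.mem_filter, List.mem_range, key_div hv, key_mod hv,
    Bool.or_eq_true, Bool.and_eq_true, decide_eq_true_eq, hmap, Active]
  have hkey : j < rootCount p → j * nodeBase p + v < rootCount p * nodeBase p := fun hj => by
    have := Nat.mul_le_mul_right (nodeBase p) hj
    rw [Nat.succ_mul] at this
    omega
  constructor
  · rintro ⟨h₁, ⟨⟨⟨h₂, h₃, h₄⟩, h₅⟩, h₆⟩ | ⟨h₂, h₃⟩⟩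
    · exact ⟨⟨h₂, by omega, h₆⟩, by rw [h₅]; congr 1; omega⟩
    · have hj : j < rootCount p := by
        by_contra hj
        have := Nat.mul_le_mul_right (nodeBase p) (not_lt.1 hj)
        omega
      refine ⟨⟨hj, by omega, by omega⟩, ?_⟩
      rw [h₂, Nat.sub_self, Nat.cast_zero, SimpleGraph.edist_eq_zero_iff, h₃]
  · rintro ⟨⟨h₁, h₂, h₃⟩, h₄⟩
    refine ⟨hkey h₁, ?_⟩
    rcases Nat.lt_or_ge ρ (rootDelay p roots j) with hlt | hge
    · right
      rw [show ρ + 1 - rootDelay p roots j = 0 by omega, Nat.cast_zero,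
        SimpleGraph.edist_eq_zero_iff] at h₄
      exact ⟨by omega, h₄.symm⟩
    · left
      exact ⟨⟨⟨h₁, hge, by omega⟩, by rw [h₄]; congr 1; omega⟩, h₃⟩

theorem prevSpec_zero (hcur : ∀ y, y ∉ cur) : PrevSpec p roots H 0 cur := by
  intro j v _ _
  simp [hcur]

theorem prevSpec_succ (hcur : LayerSpec p roots H ρ cur) : PrevSpec p roots H (ρ + 1) cur := by
  intro j v hv hact
  rw [hcur j v hv]
  obtain ⟨h₁, h₂, h₃⟩ := hact
  rcases Nat.lt_or_ge ρ (rootDelay p roots j) with hlt | hge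
  · rw [show ρ + 1 - rootDelay p roots j = 0 by omega]
    constructor
    · rintro ⟨⟨-, h, -⟩, -⟩
      omega
    · intro h
      simp at h
  · rw [show ρ + 1 - rootDelay p roots j = ρ - rootDelay p roots j + 1 by omega]
    constructor
    · rintro ⟨-, h⟩
      rw [h]
      norm_cast
    · intro h
      refine ⟨⟨h₁, hge, by omega⟩, ?_⟩
      exact enat_eq_of_add_one_eq h

/-- The layers at the moment `t + 1`, in the period of its own. -/
theorem layerSpec_step (h : Admissible p roots H) {t : ℕ}
    (hcur : LayerSpec p roots H (t % period p) cur)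
    (hf : ∀ x, x ∈ found ↔ IsFound p roots H (t % period p) x) :
    LayerSpec p roots H ((t + 1) % period p) (nextLayers p roots ((t + 1) % period p) found) ∧
      PrevSpec p roots H ((t + 1) % period p) cur := by
  have hT : 0 < period p := by
    have := radius_pos p
    unfold period
    omega
  rcases Nat.lt_or_ge (t % period p + 1) (period p) with hlt' | hge
  · have : (t + 1) % period p = t % period p + 1 := by
      rw [Nat.add_mod, Nat.mod_eq_of_lt (a := 1) (by omega), Nat.mod_eq_of_lt hlt']
    rw [this]
    exact ⟨layerSpec_nextLayers_succ h hf, prevSpec_succ hcur⟩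
  · have heq : t % period p + 1 = period p := le_antisymm (Nat.mod_lt _ hT) hge
    have : (t + 1) % period p = 0 := by
      rw [← Nat.mod_add_mod, heq, Nat.mod_self]
    rw [this]
    have hna := not_active_period h heq
    refine ⟨layerSpec_nextLayers_zero fun x hx => ?_, prevSpec_zero fun y hy => ?_⟩
    · obtain ⟨j, v, q, -, hact, -⟩ := (hf x).1 hx
      exact hna j hact
    · have := (hcur (y / nodeBase p) (y % nodeBase p) (Nat.mod_lt _ (nodeBase_pos p))).1
        (by rwa [mul_comm, Nat.div_add_mod])
      exact hna _ this.1

end Next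

end Layers

end GraphStream.BatchedBFS

/-! ### Tree edges found by the searches, and the stored pairs of roots. -/

namespace GraphStream.BatchedBFS

variable {p : Params} {roots : List ℕ} {H : SimpleGraph ℕ}

section Items

variable (p roots H) in
/-- The `j`-th search reaches `v` at depth `d` within the radius, with least parent `q`. -/
structure IsItem (j v q d : ℕ) : Prop where
  lt_rootCount : j < rootCount p
  one_le : 1 ≤ d
  le_radius : d ≤ radius p
  edist_eq : H.edist (rootNode p roots j) v = d
  isParent : IsParent p roots H j v q

variable (p) in
def item (j v q d : ℕ) : ℕ := d * codeBase p + code p j v q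

variable {j v q d : ℕ}

theorem IsItem.code_lt (hi : IsItem p roots H j v q d) (h : Admissible p roots H) :
    code p j v q < codeBase p :=
  BatchedBFS.code_lt h.rootCount_le hi.1 (h.parent_lt hi.5).1 (h.parent_lt hi.5).2

theorem IsItem.itemDepth (hi : IsItem p roots H j v q d) (h : Admissible p roots H) :
    itemDepth p (item p j v q d) = d := item_div (hi.code_lt h)

theorem IsItem.itemRoot (hi : IsItem p roots H j v q d) (h : Admissible p roots H) :
    itemRoot p (item p j v q d) = j := by
  rw [BatchedBFS.itemRoot, item, item_mod (hi.code_lt h), code_div (h.parent_lt hi.5).2,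
    key_div (h.parent_lt hi.5).1]

theorem IsItem.itemNode (hi : IsItem p roots H j v q d) (h : Admissible p roots H) :
    itemNode p (item p j v q d) = v := by
  rw [BatchedBFS.itemNode, item, item_mod (hi.code_lt h), code_div (h.parent_lt hi.5).2,
    key_mod (h.parent_lt hi.5).1]

theorem IsItem.itemParent (hi : IsItem p roots H j v q d) (h : Admissible p roots H) :
    itemParent p (item p j v q d) = q := by
  rw [BatchedBFS.itemParent, item, item_mod (hi.code_lt h), code_mod (h.parent_lt hi.5).2]

theorem exists_isItem (hj : j < rootCount p) (h1 : 1 ≤ d) (hd : d ≤ radius p)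
    (hv : H.edist (rootNode p roots j) v = d) : ∃ q, IsItem p roots H j v q d := by
  obtain ⟨d, rfl⟩ := Nat.exists_eq_add_of_le' h1
  obtain ⟨q, hq⟩ := exists_isParent hv
  exact ⟨q, hj, h1, hd, hv, hq⟩

/-- A node at depth `d` of the `j`-th search is found while depth `d - 1` is the current layer, at
the moment `delay + d - 1`. -/
theorem mem_withDepth (h : Admissible p roots H) {ρ : ℕ} {found : List ℕ}
    (hf : ∀ x, x ∈ found ↔ IsFound p roots H ρ x) (e : ℕ) :
    e ∈ withDepth p roots ρ found ↔ ∃ j v q d, e = item p j v q d ∧ IsItem p roots H j v q d ∧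
      rootDelay p roots j + d = ρ + 1 := by
  simp only [withDepth, List.mem_map, hf]
  constructor
  · rintro ⟨_, ⟨j, v, q, rfl, ⟨h₁, h₂, h₃⟩, hv, hq⟩, rfl⟩
    refine ⟨j, v, q, ρ - rootDelay p roots j + 1, ?_, ⟨h₁, by omega, by omega, hv, hq⟩, by omega⟩
    rw [code_div (h.parent_lt hq).2, key_div (h.parent_lt hq).1, item]
    congr 2
    omega
  · rintro ⟨j, v, q, d, rfl, hi, hd⟩
    have h₁ := hi.one_le
    have h₂ := hi.le_radius
    refine ⟨_, ⟨j, v, q, rfl, ⟨hi.1, by omega, by omega⟩, ?_, hi.5⟩, ?_⟩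
    · rw [hi.4]
      congr 1
      omega
    · rw [code_div (h.parent_lt hi.5).2, key_div (h.parent_lt hi.5).1, item]
      congr 2
      omega

theorem isRoot_iff {v : ℕ} (hlen : roots.length = rootCount p) :
    isRoot p roots v = true ↔ ∃ j < rootCount p, rootNode p roots j = v := by
  simp only [isRoot, List.any_eq_true, decide_eq_true_eq, rootNode]
  constructor
  · rintro ⟨x, hx, rfl⟩
    obtain ⟨j, hj, rfl⟩ := List.getElem_of_mem hx
    exact ⟨j, by omega, by simp [hj]⟩
  · rintro ⟨j, hj, rfl⟩
    rw [← hlen] at hj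
    exact ⟨roots[j], List.getElem_mem hj, by simp [hj]⟩

variable (p roots H) in
/-- The pairs of roots known at the moment `t`. -/
def EdgeSpec (t : ℕ) (E : List ℕ) : Prop :=
  ∀ e, e ∈ E ↔ ∃ j v q d, e = item p j v q d ∧ IsItem p roots H j v q d ∧
    isRoot p roots v = true ∧ (period p ≤ t ∨ rootDelay p roots j + d ≤ t)

theorem edgeSpec_zero : EdgeSpec p roots H 0 [] := by
  intro e
  have hR := radius_pos p
  simp only [List.not_mem_nil, false_iff, not_exists, not_and]
  rintro j v q d - hi - ht
  have := hi.one_le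
  unfold period at ht
  omega

theorem edgeSpec_succ (h : Admissible p roots H) {t : ℕ} {E found : List ℕ}
    (hE : EdgeSpec p roots H t E)
    (hf : ∀ x, x ∈ found ↔ IsFound p roots H (t % period p) x) :
    EdgeSpec p roots H (t + 1)
      (addEdges p roots E (withDepth p roots (t % period p) found)) := by
  intro e
  have hT : period p = 2 * radius p := rfl
  simp only [addEdges, List.mem_append, List.mem_filter, Bool.and_eq_true, Bool.not_eq_true',
    decide_eq_false_iff_not, mem_withDepth h hf]
  constructor
  · rintro (he | ⟨⟨j, v, q, d, rfl, hi, ht⟩, hr, -⟩)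
    · obtain ⟨j, v, q, d, rfl, hi, hr, ht⟩ := (hE e).1 he
      exact ⟨j, v, q, d, rfl, hi, hr, by omega⟩
    · rw [hi.itemNode h] at hr
      refine ⟨j, v, q, d, rfl, hi, hr, ?_⟩
      rcases Nat.lt_or_ge t (period p) with hlt | hge
      · rw [Nat.mod_eq_of_lt hlt] at ht
        omega
      · omega
  · rintro ⟨j, v, q, d, rfl, hi, hr, ht⟩
    by_cases he : item p j v q d ∈ E
    · exact Or.inl he
    · refine Or.inr ⟨⟨j, v, q, d, rfl, hi, ?_⟩, by rwa [hi.itemNode h], he⟩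
      -- What is not yet in `E` is due exactly now. The end of the period brings nothing further,
      -- because `delay + d < period`.
      have hno : ¬ (period p ≤ t ∨ rootDelay p roots j + d ≤ t) :=
        fun ht' => he ((hE _).2 ⟨j, v, q, d, rfl, hi, hr, ht'⟩)
      have h₁ := h.delay_lt j hi.1
      have h₂ := hi.le_radius
      rw [Nat.mod_eq_of_lt (by omega)]
      omega

theorem nodup_addEdges {ρ : ℕ} {E found : List ℕ} (hE : E.Nodup)
    (hn : found.Nodup) (hlt : ∀ x ∈ found, x < codeBase p) :
    (addEdges p roots E (withDepth p roots ρ found)).Nodup := by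
  refine List.Nodup.append hE (List.Nodup.filter _ ?_) ?_
  · refine hn.map_on fun x hx y hy hxy => ?_
    have h₁ := congrArg (· % codeBase p) hxy
    simpa only [item_mod (hlt x hx), item_mod (hlt y hy)] using h₁
  · intro e he he'
    simp only [List.mem_filter, Bool.and_eq_true, Bool.not_eq_true',
      decide_eq_false_iff_not] at he'
    exact he'.2.2 he

end Items

/-! ### Relaxation of the distance entries. -/

section Values

theorem foldl_min_spec {β : Type*} (P : β → Bool) (f : β → ℕ) (I : List β) (x : ℕ) :
    (I.foldl (fun acc e => bif P e then min acc (f e) else acc) x ≤ x) ∧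
    (∀ e ∈ I, P e = true → I.foldl (fun acc e => bif P e then min acc (f e) else acc) x ≤ f e) ∧
    (I.foldl (fun acc e => bif P e then min acc (f e) else acc) x = x ∨
      ∃ e ∈ I, P e = true ∧
        I.foldl (fun acc e => bif P e then min acc (f e) else acc) x = f e) := by
  induction I generalizing x with
  | nil => simp
  | cons a I ih =>
    rw [List.foldl_cons]
    obtain ⟨h₁, h₂, h₃⟩ := ih (bif P a then min x (f a) else x)
    cases ha : P a
    · simp only [ha, cond_false] at h₁ h₂ h₃ ⊢
      refine ⟨h₁, ?_, ?_⟩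
      · intro e he hP
        rcases List.mem_cons.1 he with rfl | he
        · simp [ha] at hP
        · exact h₂ e he hP
      · rcases h₃ with h₃ | ⟨e, he, h₃⟩
        · exact Or.inl h₃
        · exact Or.inr ⟨e, List.mem_cons_of_mem _ he, h₃⟩
    · simp only [ha, cond_true] at h₁ h₂ h₃ ⊢
      refine ⟨h₁.trans (min_le_left _ _), ?_, ?_⟩
      · intro e he hP
        rcases List.mem_cons.1 he with rfl | he
        · exact h₁.trans (min_le_right _ _)
        · exact h₂ e he hP
      · rcases h₃ with h₃ | ⟨e, he, h₃⟩
        · rcases min_choice x (f a) with hm | hm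
          · exact Or.inl (h₃.trans hm)
          · exact Or.inr ⟨a, List.mem_cons_self, ha, h₃.trans hm⟩
        · exact Or.inr ⟨e, List.mem_cons_of_mem _ he, h₃⟩

variable (p) in
/-- The entry of the node `v` for the `i`-th source. -/
def entry (val : List ℕ) (i v : ℕ) : ℕ := val.getD (i * p.1 + v) 0

theorem entry_index {i v : ℕ} (hi : i < p.2.1) (hv : v < p.1) :
    i * p.1 + v < p.2.1 * p.1 ∧ (i * p.1 + v) / p.1 = i ∧ (i * p.1 + v) % p.1 = v := by
  refine ⟨?_, ?_, ?_⟩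
  · have := Nat.mul_le_mul_right p.1 hi
    rw [Nat.succ_mul] at this
    omega
  · rw [mul_comm, Nat.mul_add_div (by omega), Nat.div_eq_of_lt hv, add_zero]
  · rw [mul_comm, Nat.mul_add_mod, Nat.mod_eq_of_lt hv]

theorem length_relax (I val : List ℕ) : (relax p roots I val).length = p.2.1 * p.1 := by
  simp [relax]

theorem entry_relax {I val : List ℕ} {i v : ℕ} (hi : i < p.2.1) (hv : v < p.1) :
    entry p (relax p roots I val) i v = I.foldl (fun acc e =>
      bif decide (itemNode p e = v) then min acc (candidate p roots val i e) else acc)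
        (entry p val i v) := by
  obtain ⟨h₁, h₂, h₃⟩ := entry_index hi hv
  simp [entry, relax, List.getD_eq_getElem?_getD, h₁, h₂, h₃]

theorem candidate_item (h : Admissible p roots H) {j v q d : ℕ} (hi : IsItem p roots H j v q d)
    (val : List ℕ) (i : ℕ) : candidate p roots val i (item p j v q d) =
      (entry p val i (rootNode p roots j) / nodeBase p + d) * nodeBase p + q := by
  rw [candidate, hi.itemDepth h, hi.itemParent h, hi.itemRoot h, entry]

variable (p roots H) in
/-- Every finite entry comes from a path. -/
structure ValSpec (val : List ℕ) : Prop where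
  length_eq : val.length = p.2.1 * p.1
  le : ∀ i < p.2.1, ∀ v < p.1, entry p val i v ≤ p.1 * nodeBase p
  root_le : ∀ i < p.2.1, entry p val i (rootNode p roots i) ≤ rootNode p roots i
  sound : ∀ i < p.2.1, ∀ v < p.1, entry p val i v / nodeBase p < p.1 →
    (v = rootNode p roots i ∧ entry p val i v = v) ∨
      (H.Adj (entry p val i v % nodeBase p) v ∧
        H.edist (rootNode p roots i) (entry p val i v % nodeBase p) + 1 ≤
          (entry p val i v / nodeBase p : ℕ))

theorem ValSpec.edist_le {val : List ℕ} (hval : ValSpec p roots H val)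
    {i v : ℕ} (hi : i < p.2.1) (hv : v < p.1) (hlt : entry p val i v / nodeBase p < p.1) :
    H.edist (rootNode p roots i) v ≤ (entry p val i v / nodeBase p : ℕ) := by
  rcases hval.sound i hi v hv hlt with ⟨rfl, h₁⟩ | ⟨h₁, h₂⟩
  · simp
  · exact (SimpleGraph.edist_le_add_one_of_adj _ h₁).trans h₂

variable (p roots H) in
def AreItems (I : List ℕ) : Prop :=
  ∀ e ∈ I, ∃ j v q d, e = item p j v q d ∧ IsItem p roots H j v q d

variable {I val : List ℕ}

theorem entry_relax_le {i v : ℕ} (hi : i < p.2.1) (hv : v < p.1) :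
    entry p (relax p roots I val) i v ≤ entry p val i v := by
  rw [entry_relax hi hv]
  exact (foldl_min_spec _ _ _ _).1

theorem entry_iterate_le {i v : ℕ} (hi : i < p.2.1) (hv : v < p.1) (m : ℕ) :
    entry p ((relax p roots I)^[m] val) i v ≤ entry p val i v := by
  induction m with
  | zero => exact le_rfl
  | succ m ih =>
    rw [Function.iterate_succ_apply']
    exact (entry_relax_le hi hv).trans ih

theorem entry_relax_le_of_item (h : Admissible p roots H) {i j v q d : ℕ} (hi : i < p.2.1)
    (hit : IsItem p roots H j v q d) (hmem : item p j v q d ∈ I) :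
    entry p (relax p roots I val) i v / nodeBase p ≤
      entry p val i (rootNode p roots j) / nodeBase p + d := by
  rw [entry_relax hi (h.lt_of_adj hit.5.1.symm)]
  have h₁ := (foldl_min_spec (fun e => decide (itemNode p e = v)) (candidate p roots val i) I
    (entry p val i v)).2.1 _ hmem (by simp [hit.itemNode h])
  refine (Nat.div_le_div_right h₁).trans ?_
  rw [candidate_item h hit, key_div (h.parent_lt hit.5).2]

/-- The parent `q` in the `j`-th search satisfies `dist(j, q) + 1 = d`. Going through the root `j`,
the triangle inequality bounds the distance from the source to `q`, plus one, by the new recorded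
distance. -/
theorem ValSpec.relax (h : Admissible p roots H) (hc : p.2.1 ≤ rootCount p)
    (hI : AreItems p roots H I) (hval : ValSpec p roots H val) :
    ValSpec p roots H (relax p roots I val) := by
  refine ⟨length_relax I val, fun i hi v hv => (entry_relax_le hi hv).trans (hval.le i hi v hv),
    fun i hi => (entry_relax_le hi (h.node_lt i (by omega))).trans (hval.root_le i hi),
    fun i hi v hv hlt => ?_⟩
  rcases (foldl_min_spec (fun e => decide (itemNode p e = v)) (candidate p roots val i) I
    (entry p val i v)).2.2 with heq | ⟨e, he, hP, heq⟩
  · rw [entry_relax hi hv, heq] at hlt ⊢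
    exact hval.sound i hi v hv hlt
  · rw [entry_relax hi hv, heq] at hlt ⊢
    obtain ⟨j, v', q, d, rfl, hit⟩ := hI e he
    rw [decide_eq_true_eq, hit.itemNode h] at hP
    subst hP
    have hq := (h.parent_lt hit.5).2
    rw [candidate_item h hit, key_div hq] at hlt ⊢
    rw [key_mod hq]
    refine Or.inr ⟨hit.5.1, ?_⟩
    have h₁ := hval.edist_le hi (h.node_lt j hit.1) (by omega)
    have h₂ := H.edist_triangle (u := rootNode p roots i) (v := rootNode p roots j) (w := q)
    calc H.edist (rootNode p roots i) q + 1
        ≤ H.edist (rootNode p roots i) (rootNode p roots j) +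
            (H.edist (rootNode p roots j) q + 1) := by
          rw [← add_assoc]
          gcongr
      _ = H.edist (rootNode p roots i) (rootNode p roots j) + d := by rw [hit.5.2.1, hit.4]
      _ ≤ _ := by
          push_cast
          gcongr

theorem ValSpec.iterate (h : Admissible p roots H) (hc : p.2.1 ≤ rootCount p)
    (hI : AreItems p roots H I) (hval : ValSpec p roots H val) (m : ℕ) :
    ValSpec p roots H ((BatchedBFS.relax p roots I)^[m] val) := by
  induction m with
  | zero => exact hval
  | succ m ih =>
    rw [Function.iterate_succ_apply']
    exact ih.relax h hc hI

variable (p roots H) in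
/-- Every node reachable from a source has a root within the radius on a shortest path. -/
def Covered : Prop :=
  ∀ i < p.2.1, ∀ v r : ℕ, H.edist (rootNode p roots i) v = r → r ≠ 0 → ∃ j < rootCount p,
    ∃ d, 1 ≤ d ∧ d ≤ radius p ∧ H.edist (rootNode p roots j) v = d ∧
      H.edist (rootNode p roots i) (rootNode p roots j) + d = r

variable (p roots H) in
-- Only the upper bound is recorded; the lower bound is part of `ValSpec`.
def RootsExact (val : List ℕ) : Prop :=
  ∀ i < p.2.1, ∀ j < rootCount p, ∀ r : ℕ,
    H.edist (rootNode p roots i) (rootNode p roots j) = r →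
      entry p val i (rootNode p roots j) / nodeBase p ≤ r

/-- As in Bellman–Ford: after `m` rounds, roots at distance at most `m` from a source are settled,
because covering supplies a previous root on a shortest path at a positive distance at most `R`.
Finite distances are below `n`, so `n` rounds suffice. -/
theorem rootsExact_iterate (h : Admissible p roots H) (hc : p.2.1 ≤ rootCount p)
    (hcov : Covered p roots H) (hlen : roots.length = rootCount p)
    (hval : ValSpec p roots H val)
    (hE : ∀ j v q d, IsItem p roots H j v q d → isRoot p roots v = true → item p j v q d ∈ I) :
    RootsExact p roots H ((relax p roots I)^[p.1] val) := by
  have key : ∀ m r : ℕ, r ≤ m → ∀ i < p.2.1, ∀ j < rootCount p,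
      H.edist (rootNode p roots i) (rootNode p roots j) = r →
      entry p ((relax p roots I)^[m] val) i (rootNode p roots j) / nodeBase p ≤ r := by
    intro m
    induction m with
    | zero =>
      intro r hr i hi j hj he
      obtain rfl : r = 0 := by omega
      rw [Nat.cast_zero, SimpleGraph.edist_eq_zero_iff] at he
      rw [← he]
      have h₁ := hval.root_le i hi
      have h₂ : rootNode p roots i < nodeBase p := Nat.mod_lt _ (nodeBase_pos p)
      exact (Nat.div_eq_of_lt (h₁.trans_lt h₂)).le
    | succ m ih =>
      intro r hr i hi j hj he
      rw [Function.iterate_succ_apply']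
      rcases Nat.eq_zero_or_pos r with rfl | hr0
      · refine le_trans ?_ (ih 0 (Nat.zero_le _) i hi j hj he)
        exact Nat.div_le_div_right (entry_relax_le hi (h.node_lt j hj))
      · obtain ⟨j', hj', d, hd1, hdR, hd, hsum⟩ := hcov i hi _ r he (by omega)
        obtain ⟨q, hit⟩ := exists_isItem hj' hd1 hdR hd
        have hmem := hE _ _ _ _ hit ((isRoot_iff hlen).2 ⟨j, hj, rfl⟩)
        refine (entry_relax_le_of_item h hi hit hmem).trans ?_
        have hne : H.edist (rootNode p roots i) (rootNode p roots j') ≠ ⊤ := by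
          intro ht
          rw [ht, top_add] at hsum
          exact ENat.natCast_ne_top _ hsum.symm
        obtain ⟨r', hr'⟩ := ENat.ne_top_iff_exists.1 hne
        rw [← hr'] at hsum
        norm_cast at hsum
        have := ih r' (by omega) i hi j' hj' hr'.symm
        omega
  intro i hi j hj r hr
  exact key p.1 r (h.edist_lt i (by omega) _ _ hr).le i hi j hj hr

variable (p roots H) in
/-- What is known of the entries at the moment `t`. -/
structure Progress (t : ℕ) (val : List ℕ) : Prop where
  valSpec : ValSpec p roots H val
  rootsExact : period p ≤ t → RootsExact p roots H val
  reached : ∀ i < p.2.1, ∀ j v q d r, IsItem p roots H j v q d →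
    period p + (rootDelay p roots j + d) ≤ t →
    H.edist (rootNode p roots i) (rootNode p roots j) = (r : ℕ) →
      entry p val i v / nodeBase p ≤ r + d

theorem progress_zero (hval : ValSpec p roots H val) : Progress p roots H 0 val := by
  have hR := radius_pos p
  have hT : period p = 2 * radius p := rfl
  exact ⟨hval, fun h => by omega, fun i _ j v q d r _ h => by omega⟩

/-- The root entries are exact before the second period begins, so a tree edge found in that period
settles its node immediately and need not be stored. -/
theorem Progress.succ (h : Admissible p roots H) (hc : p.2.1 ≤ rootCount p)
    (hcov : Covered p roots H) (hlen : roots.length = rootCount p) {t : ℕ}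
    (ht : t < 2 * period p) {E found : List ℕ} (hE : EdgeSpec p roots H t E)
    (hf : ∀ x, x ∈ found ↔ IsFound p roots H (t % period p) x)
    (hval : Progress p roots H t val) :
    Progress p roots H (t + 1)
      ((relax p roots (addEdges p roots E (withDepth p roots (t % period p) found) ++
        withDepth p roots (t % period p) found))^[p.1] val) := by
  have hE' := edgeSpec_succ h hE hf
  have hT : period p = 2 * radius p := rfl
  have hR := radius_pos p
  set I := addEdges p roots E (withDepth p roots (t % period p) found) ++
    withDepth p roots (t % period p) found with hI
  have hItems : AreItems p roots H I := by
    intro e he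
    rcases List.mem_append.1 he with he | he
    · obtain ⟨j, v, q, d, rfl, hi, -⟩ := (hE' e).1 he
      exact ⟨j, v, q, d, rfl, hi⟩
    · obtain ⟨j, v, q, d, rfl, hi, -⟩ := (mem_withDepth h hf e).1 he
      exact ⟨j, v, q, d, rfl, hi⟩
  refine ⟨hval.valSpec.iterate h hc hItems _, fun ht' => ?_, ?_⟩
  · refine rootsExact_iterate h hc hcov hlen hval.valSpec fun j v q d hi hr => ?_
    exact List.mem_append_left _ ((hE' _).2 ⟨j, v, q, d, rfl, hi, hr, Or.inl ht'⟩)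
  · intro i hi j v q d r hit htime hr
    have hv := h.lt_of_adj hit.5.1.symm
    rcases Nat.lt_or_ge t (period p + (rootDelay p roots j + d)) with hlt | hge
    · have hmem : item p j v q d ∈ I := by
        refine List.mem_append_right _ ((mem_withDepth h hf _).2 ⟨j, v, q, d, rfl, hit, ?_⟩)
        have h1 := hit.one_le
        rw [Nat.mod_eq_sub_mod (by omega), Nat.mod_eq_of_lt (by omega)]
        omega
      -- The first of the `n` rounds already yields the bound; the remaining ones can only decrease
      -- entries.
      obtain ⟨m, hm⟩ : ∃ m, p.1 = m + 1 := ⟨p.1 - 1, by omega⟩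
      rw [hm, Function.iterate_succ_apply]
      refine (Nat.div_le_div_right (entry_iterate_le hi hv m)).trans ?_
      refine (entry_relax_le_of_item h hi hit hmem).trans ?_
      have h1 := hit.one_le
      have := hval.rootsExact (by omega) i hi j hit.1 r hr
      omega
    · exact (Nat.div_le_div_right (entry_iterate_le hi hv _)).trans
        (hval.reached i hi j v q d r hit hge hr)

/-- At the end of the second period all entries are exact. -/
theorem Progress.exact (h : Admissible p roots H) (hc : p.2.1 ≤ rootCount p)
    (hcov : Covered p roots H) {val : List ℕ}
    (hval : Progress p roots H (2 * period p) val) {i v r : ℕ} (hi : i < p.2.1)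
    (hr : H.edist (rootNode p roots i) v = r) : entry p val i v / nodeBase p = r := by
  have hv := h.lt_of_edist (j := i) (by omega) hr
  have hrn := h.edist_lt i (by omega) v r hr
  have hT : period p = 2 * radius p := rfl
  have hle : entry p val i v / nodeBase p ≤ r := by
    rcases Nat.eq_zero_or_pos r with rfl | hr0
    · rw [Nat.cast_zero, SimpleGraph.edist_eq_zero_iff] at hr
      have h₁ := hval.valSpec.root_le i hi
      rw [hr] at h₁
      exact (Nat.div_eq_of_lt (h₁.trans_lt (hv.trans (lt_nodeBase p)))).le
    · obtain ⟨j, hj, d, hd1, hdR, hd, hsum⟩ := hcov i hi v r hr (by omega)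
      obtain ⟨q, hit⟩ := exists_isItem hj hd1 hdR hd
      have hne : H.edist (rootNode p roots i) (rootNode p roots j) ≠ ⊤ := by
        intro ht
        rw [ht, top_add] at hsum
        exact ENat.natCast_ne_top _ hsum.symm
      obtain ⟨r', hr'⟩ := ENat.ne_top_iff_exists.1 hne
      have h₁ := h.delay_lt j hj
      have h₂ := hval.reached i hi j v q d r' hit (by omega) hr'.symm
      rw [← hr'] at hsum
      norm_cast at hsum
      omega
  refine le_antisymm hle ?_
  have h₁ := hval.valSpec.edist_le hi hv (by omega)
  rw [hr] at h₁
  exact_mod_cast h₁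

end Values

end GraphStream.BatchedBFS

/-! ### From exact entries to BFS trees. -/

namespace GraphStream

section NatGraph

open BatchedBFS

variable {n : ℕ} {G : SimpleGraph (Fin n)}

theorem BatchedBFS.natGraph_adj {a b : Fin n} : (natGraph G).Adj a b ↔ G.Adj a b :=
  SimpleGraph.map_adj_apply (f := Fin.valEmbedding)

theorem BatchedBFS.natGraph_lt {a b : ℕ} (h : (natGraph G).Adj a b) : a < n := by
  rw [SimpleGraph.map_adj] at h
  obtain ⟨u, -, -, rfl, -⟩ := h
  exact u.isLt

theorem BatchedBFS.exists_walk_of_natGraph {x y : ℕ} (w : (natGraph G).Walk x y) :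
    ∀ a b : Fin n, (a : ℕ) = x → (b : ℕ) = y → ∃ w' : G.Walk a b, w'.length = w.length := by
  induction w with
  | nil =>
    rintro a b rfl hb
    obtain rfl := Fin.ext hb
    exact ⟨.nil, rfl⟩
  | cons hadj w ih =>
    rintro a b rfl rfl
    obtain ⟨w', hw'⟩ := ih ⟨_, natGraph_lt hadj.symm⟩ b rfl rfl
    exact ⟨.cons (natGraph_adj.1 hadj) w', by simp [hw']⟩

theorem BatchedBFS.natGraph_edist (a b : Fin n) : (natGraph G).edist a b = G.edist a b := by
  refine le_antisymm (le_iInf fun w => ?_) (le_iInf fun w => ?_)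
  · refine (SimpleGraph.edist_le (w.map ⟨Fin.val, fun h => natGraph_adj.2 h⟩)).trans ?_
    simp
  · obtain ⟨w', hw'⟩ := exists_walk_of_natGraph w a b rfl rfl
    exact (SimpleGraph.edist_le w').trans (by rw [hw'])

theorem BatchedBFS.lt_of_natGraph_edist {a : Fin n} {v r : ℕ}
    (h : (natGraph G).edist a v = r) : v < n := by
  cases r with
  | zero =>
    rw [Nat.cast_zero, SimpleGraph.edist_eq_zero_iff] at h
    exact h ▸ a.isLt
  | succ r =>
    obtain ⟨q, hq, -⟩ := SimpleGraph.exists_adj_of_edist_eq_succ h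
    exact natGraph_lt hq.symm

/-- A shortest walk is a path, so its length is below the number of nodes. -/
theorem BatchedBFS.natGraph_edist_lt {a : Fin n} {v r : ℕ}
    (h : (natGraph G).edist a v = r) : r < n := by
  have hv := lt_of_natGraph_edist h
  have h' := natGraph_edist (G := G) a ⟨v, hv⟩
  rw [h] at h'
  have hr : G.Reachable a ⟨v, hv⟩ := by
    rw [← SimpleGraph.edist_ne_top_iff_reachable, ← h']
    exact ENat.natCast_ne_top r
  obtain ⟨w, hw, hl⟩ := hr.exists_path_of_dist
  rw [← hr.coe_dist_eq_edist] at h'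
  norm_cast at h'
  have := hw.length_lt
  rw [Fintype.card_fin] at this
  omega

/-- An exact distance turns the inequality for the stored parent into equality, since `dist(s, v) ≤
dist(s, q) + 1` holds anyway. For an unreachable node, a finite entry would bound an infinite
distance. -/
theorem BatchedBFS.isBFSSolution {c k : ℕ} {roots val : List ℕ} {s : Fin n} {i : ℕ}
    {st : List (List ℕ)}
    (hs : rootNode (n, c, k) roots i = s) (hst : st.getD 6 [] = val)
    (hval : ValSpec (n, c, k) roots (natGraph G) val) (hi : i < c)
    (hex : ∀ v r : ℕ, (natGraph G).edist (rootNode (n, c, k) roots i) v = r →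
      entry (n, c, k) val i v / nodeBase (n, c, k) = r) :
    IsBFSSolution G s fun v => outputState (n, c, k) st i v := by
  intro v
  beta_reduce
  have hout : outputState (n, c, k) st i v =
      bif decide (entry (n, c, k) val i v / nodeBase (n, c, k) < n) then
        some (entry (n, c, k) val i v / nodeBase (n, c, k),
          entry (n, c, k) val i v % nodeBase (n, c, k))
      else none := by
    rw [outputState, hst]
    rfl
  have hd := natGraph_edist (G := G) s v
  have hsound := hval.sound i hi v v.isLt
  have hle := hval.edist_le hi v.isLt
  rw [hs] at hex hsound hle
  constructor
  · intro hr
    rw [hout, decide_eq_false, cond_false]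
    intro hlt
    refine hr (SimpleGraph.edist_ne_top_iff_reachable.1 ?_)
    rw [← hd]
    exact ne_top_of_le_ne_top (ENat.natCast_ne_top _) (hle hlt)
  · intro hr
    rw [← hr.coe_dist_eq_edist] at hd
    have hlt := natGraph_edist_lt hd
    have he := hex v _ hd
    rw [he] at hout hsound
    rw [decide_eq_true hlt, cond_true] at hout
    rcases hsound hlt with ⟨h₁, h₂⟩ | ⟨h₁, h₂⟩
    · obtain rfl := Fin.ext h₁
      refine ⟨v, ?_, fun _ => rfl, fun h => absurd rfl h⟩
      rw [hout, h₂, Nat.mod_eq_of_lt (v.isLt.trans (lt_nodeBase (n, c, k)))]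
    · set q : Fin n := ⟨_, natGraph_lt h₁⟩ with hq
      have hadj : G.Adj q v := natGraph_adj.1 h₁
      have hqr : G.Reachable s q := hr.trans hadj.symm.reachable
      have hqd := natGraph_edist (G := G) s q
      rw [← hqr.coe_dist_eq_edist] at hqd
      have h₃ := SimpleGraph.edist_le_add_one_of_adj s hadj
      rw [← hqr.coe_dist_eq_edist, ← hr.coe_dist_eq_edist] at h₃
      have h₄ : (natGraph G).edist s (q : ℕ) + 1 ≤ (G.dist s v : ℕ) := h₂
      rw [hqd] at h₄
      norm_cast at h₃ h₄
      refine ⟨q, hout, ?_, fun _ => ⟨hadj, by omega⟩⟩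
      -- The source itself cannot be in this case: its parent would satisfy `dist + 1 ≤ 0`.
      rintro rfl
      rw [SimpleGraph.dist_self] at h₄
      omega

end NatGraph

namespace BatchedBFS

/-! ### Space: sizes of the lists and of their entries. -/

section Space

variable {p : Params} {roots : List ℕ} {H : SimpleGraph ℕ}

/-- A bound on the number of nodes in the layers at any moment. -/
def layerCap (p : Params) : ℕ := 4 * p.2.2 ^ 2 + 10 * nodeBits p * p.1

/-- A bound on the number of bits of the numbers in the memory. -/
def entryBits (p : Params) : ℕ := 20 * nodeBits p

theorem one_le_nodeBits (p : Params) : 1 ≤ nodeBits p := Nat.le_add_left _ _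

theorem lt_two_pow_entryBits {p : Params} {x y i j : ℕ} (hx : x ≤ 2 ^ (i + j * nodeBits p))
    (hij : i + j < 20) (hy : y < x) : y < 2 ^ entryBits p := by
  refine hy.trans_le (hx.trans (Nat.pow_le_pow_right two_pos ?_))
  have := one_le_nodeBits p
  unfold entryBits
  nlinarith

theorem radius_le' (p : Params) : radius p ≤ 2 ^ (4 + 2 * nodeBits p) := by
  have h₁ : p.1 / p.2.2 + 1 ≤ 2 ^ nodeBits p :=
    (Nat.div_le_self _ _).trans_lt (lt_nodeBase p)
  have h₂ : nodeBits p ≤ 2 ^ nodeBits p := Nat.lt_two_pow_self.le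
  have h₃ : radius p ≤ 2 * (8 * (p.1 / p.2.2 + 1) * nodeBits p) := by
    rw [radius, radiusBits, pow_succ, mul_comm]
    refine Nat.mul_le_mul_left 2 (Nat.pow_log_le_self 2 ?_)
    have := one_le_nodeBits p
    positivity
  calc radius p ≤ 2 * (8 * (2 ^ nodeBits p) * 2 ^ nodeBits p) :=
        h₃.trans (by gcongr)
    _ = _ := by ring

theorem passCount_le (p : Params) : passCount p + 1 ≤ 2 ^ (10 + 3 * nodeBits p) := by
  have h₁ := radius_le' p
  have h₂ : codeBits p ≤ 4 * 2 ^ nodeBits p := by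
    have : nodeBits p < 2 ^ nodeBits p := Nat.lt_two_pow_self
    have := one_le_nodeBits p
    unfold codeBits
    omega
  have h₃ : 1 ≤ 2 ^ nodeBits p := Nat.one_le_two_pow
  calc passCount p + 1 = 2 * (2 * radius p) * codeBits p + 2 := by unfold passCount period; ring
    _ ≤ 2 * (2 * 2 ^ (4 + 2 * nodeBits p)) * (4 * 2 ^ nodeBits p) +
        2 * (2 ^ nodeBits p * 2 ^ nodeBits p * 2 ^ nodeBits p) := by
      gcongr
      have : 1 ≤ 2 ^ nodeBits p * 2 ^ nodeBits p * 2 ^ nodeBits p := Nat.one_le_iff_ne_zero.2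
        (by positivity)
      omega
    _ = 258 * 2 ^ (3 * nodeBits p) := by ring
    _ ≤ 2 ^ 10 * 2 ^ (3 * nodeBits p) := by gcongr; norm_num
    _ = _ := by ring

theorem fits_mkState (hc : 1 ≤ p.2.1) (hck : p.2.1 ≤ p.2.2) (hkn : p.2.2 ≤ p.1) {cnt : ℕ}
    {roots cur prev W E val : List ℕ} (hcnt : cnt ≤ passCount p)
    (hroots : roots.length ≤ rootCount p) (hroots' : ∀ a ∈ roots, a < 2 ^ entryBits p)
    (hcur : cur.length ≤ layerCap p) (hcur' : ∀ a ∈ cur, a < 2 ^ entryBits p)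
    (hprev : prev.length ≤ layerCap p) (hprev' : ∀ a ∈ prev, a < 2 ^ entryBits p)
    (hW : W.length ≤ 2 * (layerCap p + 1)) (hW' : ∀ a ∈ W, a < codeBase p * codeBase p)
    (hE : E.length ≤ rootCount p ^ 2) (hE' : ∀ a ∈ E, a < 2 ^ entryBits p)
    (hval : val.length = p.2.1 * p.1) (hval' : ∀ a ∈ val, a ≤ p.1 * nodeBase p) :
    Fits p (mkState cnt roots cur prev W E val) := by
  have hb := one_le_nodeBits p
  have h := length_encodeState_le (K := entryBits p) (by unfold entryBits; omega)
    (st := mkState cnt roots cur prev W E val) (by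
      simp only [mkState, List.mem_cons, List.not_mem_nil, or_false]
      rintro l (rfl | rfl | rfl | rfl | rfl | rfl | rfl)
      · simp only [List.mem_cons, List.not_mem_nil, or_false]
        rintro a rfl
        exact lt_two_pow_entryBits (passCount_le p) (by norm_num) (Nat.lt_succ_of_le hcnt)
      · exact hroots'
      · exact hcur'
      · exact hprev'
      · intro a ha
        refine lt_two_pow_entryBits (i := 2) (j := 6) (le_of_eq ?_) (by norm_num) (hW' a ha)
        rw [codeBase, ← pow_add, codeBits]
        ring_nf
      · exact hE'
      · intro a ha
        refine lt_two_pow_entryBits (i := 0) (j := 2) (x := nodeBase p * nodeBase p)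
          (le_of_eq ?_) (by norm_num) ((hval' a ha).trans_lt ?_)
        · rw [nodeBase]
          ring
        · exact Nat.mul_lt_mul_of_pos_right (lt_nodeBase p) (nodeBase_pos p))
  refine h.trans ?_
  simp only [mkState, List.map_cons, List.map_nil, List.sum_cons, List.sum_nil, List.length_cons,
    List.length_nil]
  have hJ : rootCount p ≤ 2 * p.2.2 := by unfold rootCount; omega
  have hJ2 : rootCount p ^ 2 ≤ (2 * p.2.2) ^ 2 := Nat.pow_le_pow_left hJ 2
  obtain ⟨n, c, k⟩ := p
  simp only at *
  set b := nodeBits (n, c, k)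
  set X := c * n + k ^ 2 with hX
  have hk2 : k ≤ k ^ 2 := by nlinarith
  have hcn : n ≤ c * n := by nlinarith
  have hX1 : 1 ≤ X := by nlinarith
  have hXb : X ≤ b * X := by nlinarith
  have hbn : b * n ≤ b * X := Nat.mul_le_mul_left b (by omega)
  have hcap : layerCap (n, c, k) = 4 * k ^ 2 + 10 * (b * n) := by
    show 4 * k ^ 2 + 10 * b * n = _
    ring
  -- Two layers, counters for two extensions of each prefix, the pairs of roots and the roots give
  -- at most `20 k ^ 2 + 2 k + 40 b n`; the entries give `c n`, and a constant remains.
  have hsum : 0 + 1 + (roots.length + (cur.length + (prev.length + (W.length + (E.length +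
      (val.length + 0)))))) ≤ 68 * (b * X) := by
    have : (2 * k) ^ 2 = 4 * k ^ 2 := by ring
    omega
  have hXbb : b * X ≤ b * (b * X) := by nlinarith
  calc _ ≤ (2 * entryBits (n, c, k) + 2) * (68 * (b * X)) + 14 := by gcongr
    _ = 2720 * (b * (b * X)) + 136 * (b * X) + 14 := by
        rw [show entryBits (n, c, k) = 20 * b from rfl]
        ring
    _ ≤ 6000 * (b * (b * X)) := by omega
    _ = spaceCap (n, c, k) := by
        show _ = 6000 * X * b ^ 2
        ring

theorem length_le_card {α : Type*} {L : List ℕ} (hL : L.Nodup) (S : Finset α) (f : α → ℕ)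
    (h : ∀ z ∈ L, ∃ x ∈ S, f x = z) : L.length ≤ S.card := by
  rw [← List.toFinset_card_of_nodup hL]
  refine (Finset.card_le_card fun z hz => ?_).trans (Finset.card_image_le (s := S) (f := f))
  obtain ⟨x, hx, rfl⟩ := h z (List.mem_toFinset.1 hz)
  exact Finset.mem_image_of_mem f hx

open scoped Classical in
variable (p roots H) in
/-- The nodes that the searches reach at the moment `s`. -/
noncomputable def load (s : ℕ) : Finset (ℕ × ℕ) :=
  ((Finset.range (rootCount p)) ×ˢ (Finset.range p.1)).filter fun x =>
    H.edist (rootNode p roots x.1) x.2 + rootDelay p roots x.1 = s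

theorem mem_load (h : Admissible p roots H) {j v d : ℕ} (hj : j < rootCount p)
    (hd : H.edist (rootNode p roots j) v = d) :
    (j, v) ∈ load p roots H (d + rootDelay p roots j) := by
  classical
  simp only [load, Finset.mem_filter, Finset.mem_product, Finset.mem_range]
  exact ⟨⟨hj, h.lt_of_edist hj hd⟩, by rw [hd]; norm_cast⟩

variable (p roots H) in
-- The moment `s = period` is included because the nodes found at `ρ` belong to the load of `ρ + 1`.
def Uncongested : Prop := ∀ s ≤ period p, (load p roots H s).card ≤ layerCap p

theorem lt_mul_of_layerSpec (h : Admissible p roots H) {ρ : ℕ} {cur : List ℕ}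
    (hcur : LayerSpec p roots H ρ cur) {y : ℕ} (hy : y ∈ cur) : y < 2 ^ entryBits p := by
  have hmod := Nat.mod_lt y (nodeBase_pos p)
  have h₁ := (hcur (y / nodeBase p) (y % nodeBase p) hmod).1
    (by rwa [mul_comm, Nat.div_add_mod])
  have h₂ := h₁.1.1.trans_le h.rootCount_le
  rw [Nat.div_lt_iff_lt_mul (nodeBase_pos p)] at h₂
  refine lt_two_pow_entryBits (i := 1) (j := 2) (le_of_eq ?_) (by norm_num) h₂
  rw [nodeBase]
  ring

theorem length_layer_le (h : Admissible p roots H) (hload : Uncongested p roots H) {ρ : ℕ}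
    (hρ : ρ ≤ period p) {cur : List ℕ} (hn : cur.Nodup) (hcur : LayerSpec p roots H ρ cur) :
    cur.length ≤ layerCap p := by
  refine (length_le_card hn (load p roots H ρ) (fun x => x.1 * nodeBase p + x.2)
    fun y hy => ?_).trans (hload ρ hρ)
  have hmod := Nat.mod_lt y (nodeBase_pos p)
  have hy' : y / nodeBase p * nodeBase p + y % nodeBase p = y := by
    rw [mul_comm, Nat.div_add_mod]
  obtain ⟨⟨h₁, h₂, h₃⟩, h₄⟩ := (hcur (y / nodeBase p) (y % nodeBase p) hmod).1 (by rwa [hy'])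
  have h₅ := mem_load h h₁ h₄
  rw [Nat.sub_add_cancel h₂] at h₅
  exact ⟨_, h₅, hy'⟩

/-- The least parent is determined by root and node, so the codes, and with them their prefixes, are
images of the pairs in the load. -/
theorem length_prefixes_le (h : Admissible p roots H) (hload : Uncongested p roots H) {ρ r : ℕ}
    (hρ : ρ < period p) {Z : List ℕ} (hn : Z.Nodup)
    (hZ : ∀ z ∈ Z, ∃ x, IsFound p roots H ρ x ∧ x / r = z) : Z.length ≤ layerCap p := by
  classical
  refine (length_le_card hn (load p roots H (ρ + 1)) (fun x =>
    code p x.1 x.2 (if hq : ∃ q, IsParent p roots H x.1 x.2 q then hq.choose else 0) / r)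
    fun z hz => ?_).trans (hload _ hρ)
  obtain ⟨_, ⟨j, v, q, rfl, ⟨h₁, h₂, h₃⟩, hv, hq⟩, rfl⟩ := hZ z hz
  have h₅ := mem_load h h₁ hv
  rw [show ρ - rootDelay p roots j + 1 + rootDelay p roots j = ρ + 1 by omega] at h₅
  refine ⟨_, h₅, ?_⟩
  have hex : ∃ q, IsParent p roots H j v q := ⟨q, hq⟩
  simp only [dif_pos hex]
  rw [hex.choose_spec.unique hq]

/-- Depth and least parent are determined by the search and the node; as the node is a root, the
item is an image of a pair of root indices. -/
theorem length_edges_le (hlen : roots.length = rootCount p) {t : ℕ} {E : List ℕ} (hn : E.Nodup)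
    (hE : EdgeSpec p roots H t E) : E.length ≤ rootCount p ^ 2 := by
  classical
  refine (length_le_card hn ((Finset.range (rootCount p)) ×ˢ (Finset.range (rootCount p)))
    (fun x => if he : ∃ e q d, e = item p x.1 (rootNode p roots x.2) q d ∧
      IsItem p roots H x.1 (rootNode p roots x.2) q d then he.choose else 0)
    fun e he => ?_).trans (by simp [sq])
  obtain ⟨j, v, q, d, rfl, hi, hr, -⟩ := (hE e).1 he
  obtain ⟨j', hj', rfl⟩ := (isRoot_iff hlen).1 hr
  refine ⟨(j, j'), by simp [hi.1, hj'], ?_⟩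
  have hex : ∃ e q d, e = item p j (rootNode p roots j') q d ∧
      IsItem p roots H j (rootNode p roots j') q d := ⟨_, q, d, rfl, hi⟩
  simp only [dif_pos hex]
  obtain ⟨q', d', heq, hi'⟩ := hex.choose_spec
  have hd : d' = d := by
    have := hi'.4.symm.trans hi.4
    exact_mod_cast this
  rw [heq, hi'.5.unique hi.5, hd]

theorem lt_of_edgeSpec (h : Admissible p roots H) {t : ℕ} {E : List ℕ}
    (hE : EdgeSpec p roots H t E) {e : ℕ} (he : e ∈ E) : e < 2 ^ entryBits p := by
  obtain ⟨j, v, q, d, rfl, hi, -⟩ := (hE e).1 he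
  have h₁ := hi.code_lt h
  have h₂ := hi.le_radius.trans (radius_le' p)
  have h₃ : item p j v q d < (2 ^ (4 + 2 * nodeBits p) + 1) * codeBase p := by
    rw [item, Nat.succ_mul]
    have := Nat.mul_le_mul_right (codeBase p) h₂
    omega
  refine lt_two_pow_entryBits (i := 6) (j := 5) ?_ (by norm_num) h₃
  calc _ ≤ (2 ^ (4 + 2 * nodeBits p) + 2 ^ (4 + 2 * nodeBits p)) * codeBase p := by
        gcongr
        exact Nat.one_le_two_pow
    _ = _ := by
      rw [codeBase, codeBits]
      ring

theorem lt_of_mem_roots (h : Admissible p roots H) (hlen : roots.length = rootCount p) {a : ℕ}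
    (ha : a ∈ roots) : a < 2 ^ entryBits p := by
  obtain ⟨j, hj, rfl⟩ := List.getElem_of_mem ha
  have h₁ := (h.delay_lt j (by omega)).trans_le (radius_le' p)
  rw [rootDelay, List.getD_eq_getElem _ _ hj, Nat.div_lt_iff_lt_mul (nodeBase_pos p)] at h₁
  refine lt_two_pow_entryBits (i := 4) (j := 3) (le_of_eq ?_) (by norm_num) h₁
  rw [nodeBase]
  ring

theorem ValSpec.le_of_mem {val : List ℕ} (hval : ValSpec p roots H val) {a : ℕ} (ha : a ∈ val) :
    a ≤ p.1 * nodeBase p := by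
  obtain ⟨y, hy, rfl⟩ := List.getElem_of_mem ha
  have hy' := hy
  rw [hval.length_eq] at hy'
  have hn : 0 < p.1 := Nat.pos_of_ne_zero fun h0 => by simp [h0] at hy'
  have := hval.le (y / p.1) (Nat.div_lt_of_lt_mul (by rwa [mul_comm])) (y % p.1) (Nat.mod_lt _ hn)
  rw [entry, mul_comm, Nat.div_add_mod, List.getD_eq_getElem _ _ hy] at this
  exact this

end Space

end BatchedBFS

end GraphStream

/-! ### The run of the algorithm for fixed roots. -/

namespace GraphStream

theorem tape_add {n : ℕ} (a b : ℕ) (σ : List (Update n)) :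
    tape (a + b) σ = tape a σ ++ tape b σ := by
  rw [tape, List.replicate_add, List.flatten_append]
  rfl

theorem tape_one {n : ℕ} (σ : List (Update n)) : tape 1 σ = onePass σ := by
  simp [tape]

namespace BatchedBFS

section Run

variable {n c k : ℕ} {roots : List ℕ} {G : SimpleGraph (Fin n)}

theorem sq_lt_codeBase (p : Params) : p.1 * p.1 < codeBase p := by
  have h := lt_nodeBase p
  have h1 := nodeBase_pos p
  rw [codeBase_eq]
  calc p.1 * p.1 < nodeBase p * nodeBase p := by nlinarith
    _ ≤ 2 * nodeBase p * (nodeBase p * nodeBase p) := Nat.le_mul_of_pos_left _ (by omega)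
    _ = _ := by ring

/-- The passes that find the bits of the codes for one moment, except the last of them. -/
theorem leads_search {p : Params} (hp : p.1 = n) {σ : List (Update n)}
    (hσ : IsTurnstileStream σ G)
    (h : Admissible p roots (natGraph G)) (hload : Uncongested p roots (natGraph G)) {ρ t : ℕ}
    (hρ : ρ < period p) {cur prev E val : List ℕ}
    (hcur : LayerSpec p roots (natGraph G) ρ cur) (hprev : PrevSpec p roots (natGraph G) ρ prev)
    (ht : 1 + (t + 1) * codeBits p ≤ passCount p)
    (hfit : ∀ cnt ≤ passCount p, ∀ W : List ℕ, W.length ≤ 2 * (layerCap p + 1) →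
      (∀ w ∈ W, w < codeBase p * codeBase p) → Fits p (mkState cnt roots cur prev W E val))
    (ℓ : ℕ) (hℓ : ℓ < codeBits p) :
    ∃ Z : List ℕ, Z.length ≤ layerCap p + 1 ∧ (∀ z ∈ Z, z < 2 ^ ℓ) ∧
      (∀ x, IsLeast p (IsCode p cur prev G) x → x / 2 ^ (codeBits p - ℓ) ∈ Z) ∧
      algorithm.Leads p
        (encodeState (mkState (1 + t * codeBits p) roots cur prev (children p [0]) E val))
        (tape ℓ σ)
        (encodeState (mkState (1 + t * codeBits p + ℓ) roots cur prev (children p Z) E val)) := by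
  have hlt : ∀ x, IsCode p cur prev G x → x < codeBase p := fun x hx => isCode_lt h x hx
  have hn : n * n < codeBase p := hp ▸ sq_lt_codeBase p
  induction ℓ with
  | zero =>
    -- The empty prefix is present even if no code exists; this is why the bound is `layerCap p +
    -- 1`.
    refine ⟨[0], by simp, by simp, fun x hx => ?_, Algorithm.Leads.nil _⟩
    have := hlt x hx.1
    rw [codeBase] at this
    simp [Nat.div_eq_of_lt this]
  | succ ℓ ih =>
    obtain ⟨Z, hlen, hZlt, hZ, hL⟩ := ih (by omega)
    have hmod : (1 + t * codeBits p + ℓ - 1) % codeBits p = ℓ := by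
      rw [show 1 + t * codeBits p + ℓ - 1 = t * codeBits p + ℓ by omega, mul_comm,
        Nat.mul_add_mod, Nat.mod_eq_of_lt (by omega)]
    have hcnt : 1 + t * codeBits p + (ℓ + 1) ≤ passCount p := by
      rw [Nat.succ_mul] at ht
      omega
    obtain ⟨W, hW, hlead⟩ := leads_onePass (p := p) hσ hn (cnt := 1 + t * codeBits p + ℓ)
      (roots := roots) (cur := cur) (prev := prev) (E := E) (val := val) (Z := Z) (by omega)
      (fun z hz => by
        have h₁ := hZlt z hz
        have h₂ : 2 ^ (ℓ + 1) ≤ codeBase p := Nat.pow_le_pow_right two_pos hℓ.le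
        rw [pow_succ] at h₂
        omega)
      (fun W hW hW' => hfit _ (by omega) W (by omega) hW')
    rw [hmod] at hW
    have hmem := mem_refinePrefixes hlt (by omega) hZ hW
    have hlen' : (refinePrefixes p ℓ W).length ≤ layerCap p := by
      refine length_prefixes_le h hload (r := 2 ^ (codeBits p - 1 - ℓ)) hρ
        (nodup_refinePrefixes ℓ W) fun z hz => ?_
      obtain ⟨x, hx, rfl⟩ := (hmem z).1 hz
      exact ⟨x, (isLeast_isCode_iff h hcur hprev x).1 hx, rfl⟩
    have hlt' : ∀ z ∈ refinePrefixes p ℓ W, z < 2 ^ (ℓ + 1) := fun z hz => by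
      rw [refinePrefixes, List.mem_filter, List.mem_range] at hz
      exact hz.1
    refine ⟨refinePrefixes p ℓ W, by omega, hlt', fun x hx => ?_, ?_⟩
    · rw [show codeBits p - (ℓ + 1) = codeBits p - 1 - ℓ by omega]
      exact (hmem _).2 ⟨x, hx, rfl⟩
    · rw [tape_add, tape_one]
      refine hL.append (hlead _ ?_ (hfit _ hcnt _ ?_ ?_))
      · rw [stepSearch, hmod, decide_eq_true hℓ, cond_true, add_assoc]
      · rw [children_eq, List.length_map, List.length_flatMap]
        simp
        omega
      · intro w hw
        rw [children_eq] at hw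
        obtain ⟨z, hz, rfl⟩ := List.mem_map.1 hw
        have h₁ := hlt' _ (mem_flatMap_bits.1 hz)
        have h₂ : 2 * 2 ^ (ℓ + 1) ≤ codeBase p := by
          rw [← pow_succ', codeBase]
          exact Nat.pow_le_pow_right two_pos hℓ
        exact Nat.mul_lt_mul_of_pos_right (by omega) (codeBase_pos p)

variable (roots G) in
/-- The state at the moment `t`. -/
def AtMoment (p : Params) (t : ℕ) (st : List (List ℕ)) : Prop :=
  ∃ cur prev E val, st = mkState (1 + t * codeBits p) roots cur prev (children p [0]) E val ∧
    cur.Nodup ∧ LayerSpec p roots (natGraph G) (t % period p) cur ∧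
    PrevSpec p roots (natGraph G) (t % period p) prev ∧ prev.length ≤ layerCap p ∧
    (∀ y ∈ prev, y < 2 ^ entryBits p) ∧ E.Nodup ∧ EdgeSpec p roots (natGraph G) t E ∧
    Progress p roots (natGraph G) t val

theorem AtMoment.fits {p : Params} (hc : 1 ≤ p.2.1) (hck : p.2.1 ≤ p.2.2) (hkn : p.2.2 ≤ p.1)
    (h : Admissible p roots (natGraph G)) (hload : Uncongested p roots (natGraph G))
    (hlen : roots.length = rootCount p) {ρ t : ℕ} (hρ : ρ ≤ period p)
    {cur prev E val : List ℕ} (hcur : cur.Nodup) (hcur' : LayerSpec p roots (natGraph G) ρ cur)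
    (hprev : prev.length ≤ layerCap p) (hprev' : ∀ y ∈ prev, y < 2 ^ entryBits p)
    (hE : E.Nodup) (hE' : EdgeSpec p roots (natGraph G) t E)
    (hval : ValSpec p roots (natGraph G) val) :
    ∀ cnt ≤ passCount p, ∀ W : List ℕ, W.length ≤ 2 * (layerCap p + 1) →
      (∀ w ∈ W, w < codeBase p * codeBase p) → Fits p (mkState cnt roots cur prev W E val) :=
  fun _ hcnt _ hW hW' => fits_mkState hc hck hkn hcnt hlen.le
    (fun _ ha => lt_of_mem_roots h hlen ha) (length_layer_le h hload hρ hcur hcur')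
    (fun _ ha => lt_mul_of_layerSpec h hcur' ha) hprev hprev' hW hW'
    (length_edges_le hlen hE hE') (fun _ ha => lt_of_edgeSpec h hE' ha) hval.length_eq
    fun _ ha => hval.le_of_mem ha

theorem children_zero_bounds (p : Params) : (children p [0]).length ≤ 2 * (layerCap p + 1) ∧
    ∀ w ∈ children p [0], w < codeBase p * codeBase p := by
  constructor
  · simp [children]
  · have h : 2 ≤ codeBase p := by
      rw [codeBase_eq]
      have := nodeBase_pos p
      calc 2 = 2 * 1 * 1 * 1 := rfl
        _ ≤ _ := by gcongr <;> omega
    simp only [children, List.flatMap_cons, List.flatMap_nil, List.append_nil, List.mem_cons,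
      List.not_mem_nil, or_false]
    rintro w (rfl | rfl) <;> nlinarith

theorem codeBits_pos (p : Params) : 0 < codeBits p := Nat.succ_pos _

theorem period_pos (p : Params) : 0 < period p := Nat.mul_pos two_pos (radius_pos p)

/-- A moment costs `codeBits` passes: all but the last only refine prefixes, and the last yields the
complete codes, so layers, pairs of roots and entries advance together. -/
theorem AtMoment.succ {p : Params} (hp : p.1 = n) {σ : List (Update n)}
    (hσ : IsTurnstileStream σ G)
    (hc : 1 ≤ p.2.1) (hck : p.2.1 ≤ p.2.2) (hkn : p.2.2 ≤ p.1)
    (h : Admissible p roots (natGraph G)) (hload : Uncongested p roots (natGraph G))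
    (hcov : Covered p roots (natGraph G))
    (hlen : roots.length = rootCount p) {t : ℕ} (ht : t < 2 * period p) {st : List (List ℕ)}
    (hst : AtMoment roots G p t st) : ∃ st', AtMoment roots G p (t + 1) st' ∧
      algorithm.Leads p (encodeState st) (tape (codeBits p) σ) (encodeState st') := by
  obtain ⟨cur, prev, E, val, rfl, hcn, hcur, hprev, hpl, hpb, hEn, hE, hval⟩ := hst
  have hρ : t % period p < period p := Nat.mod_lt _ (period_pos p)
  have hB := codeBits_pos p
  have hJ : p.2.1 ≤ rootCount p := Nat.le_add_right _ _
  have hpass : 1 + (t + 1) * codeBits p ≤ passCount p := by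
    have := Nat.mul_le_mul_right (codeBits p) ht
    unfold passCount
    rw [Nat.succ_eq_add_one] at this
    omega
  have hfit := AtMoment.fits hc hck hkn h hload hlen hρ.le hcn hcur hpl hpb hEn hE hval.valSpec
  obtain ⟨Z, hZlen, hZlt, hZ, hL⟩ := leads_search hp hσ h hload hρ hcur hprev hpass hfit
    (codeBits p - 1) (by omega)
  have hlt : ∀ x, IsCode p cur prev G x → x < codeBase p := fun x hx => isCode_lt h x hx
  have hcnt : 1 + t * codeBits p + (codeBits p - 1) - 1 = t * codeBits p + (codeBits p - 1) := by
    omega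
  have hmod : (1 + t * codeBits p + (codeBits p - 1) - 1) % codeBits p = codeBits p - 1 := by
    rw [hcnt, mul_comm, Nat.mul_add_mod, Nat.mod_eq_of_lt (by omega)]
  have hdiv : (1 + t * codeBits p + (codeBits p - 1) - 1) / codeBits p = t := by
    rw [hcnt, mul_comm, Nat.mul_add_div hB, Nat.div_eq_of_lt (by omega), add_zero]
  obtain ⟨W, hW, hlead⟩ := leads_onePass (p := p) hσ (hp ▸ sq_lt_codeBase p)
    (cnt := 1 + t * codeBits p + (codeBits p - 1))
    (roots := roots) (cur := cur) (prev := prev) (E := E) (val := val) (Z := Z) (by omega)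
    (fun z hz => by
      have h₁ := hZlt z hz
      have h₂ : 2 ^ (codeBits p - 1 + 1) = codeBase p := by
        rw [Nat.sub_add_cancel hB]
        rfl
      rw [pow_succ] at h₂
      omega)
    (fun W hW hW' => hfit _ (by rw [Nat.succ_mul] at hpass; omega) W (by omega) hW')
  rw [hmod] at hW
  have hmem := mem_refinePrefixes hlt (by omega) hZ hW
  have hfound : ∀ x, x ∈ refinePrefixes p (codeBits p - 1) W ↔
      IsFound p roots (natGraph G) (t % period p) x := fun x => by
    rw [hmem, Nat.sub_self]
    simp only [pow_zero, Nat.div_one, exists_eq_right]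
    exact isLeast_isCode_iff h hcur hprev x
  set found := refinePrefixes p (codeBits p - 1) W
  have hfn : found.Nodup := nodup_refinePrefixes _ _
  have hflt : ∀ x ∈ found, x < codeBase p := fun x hx => by
    obtain ⟨j, v, q, rfl, hact, -, hq⟩ := (hfound x).1 hx
    exact code_lt h.rootCount_le hact.1 (h.parent_lt hq).1 (h.parent_lt hq).2
  obtain ⟨hcur₁, hprev₁⟩ := layerSpec_step h hcur hfound
  have hE₁ := edgeSpec_succ h hE hfound
  have hEn₁ := nodup_addEdges (p := p) (roots := roots) (ρ := t % period p) hEn hfn hflt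
  have hval₁ := hval.succ h hJ hcov hlen ht hE hfound
  have hcn₁ : (nextLayers p roots ((t + 1) % period p) found).Nodup := nodup_nextLayers
  have hpl₁ := length_layer_le h hload hρ.le hcn hcur
  have hpb₁ : ∀ y ∈ cur, y < 2 ^ entryBits p := fun y hy => lt_mul_of_layerSpec h hcur hy
  have hstep : stepSearch p (1 + t * codeBits p + (codeBits p - 1)) roots cur prev W E val =
      mkState (1 + (t + 1) * codeBits p) roots (nextLayers p roots ((t + 1) % period p) found) cur
        (children p [0]) (addEdges p roots E (withDepth p roots (t % period p) found))
        ((relax p roots (addEdges p roots E (withDepth p roots (t % period p) found) ++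
          withDepth p roots (t % period p) found))^[p.1] val) := by
    rw [stepSearch, hmod, hdiv, decide_eq_false (by omega), cond_false, stepLayer]
    congr 1
    rw [Nat.succ_mul]
    omega
  refine ⟨_, ⟨_, _, _, _, rfl, hcn₁, hcur₁, hprev₁, hpl₁, hpb₁, hEn₁, hE₁, hval₁⟩, ?_⟩
  have htape : tape (codeBits p) σ = tape (codeBits p - 1) σ ++ onePass σ := by
    rw [← tape_one, ← tape_add, Nat.sub_add_cancel hB]
  rw [htape]
  refine hL.append (hlead _ hstep ?_)
  exact AtMoment.fits hc hck hkn h hload hlen (Nat.mod_lt _ (period_pos p)).le hcn₁ hcur₁ hpl₁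
    hpb₁ hEn₁ hE₁ hval₁.valSpec _ hpass _ (children_zero_bounds p).1 (children_zero_bounds p).2

theorem AtMoment.iterate {p : Params} (hp : p.1 = n) {σ : List (Update n)}
    (hσ : IsTurnstileStream σ G)
    (hc : 1 ≤ p.2.1) (hck : p.2.1 ≤ p.2.2) (hkn : p.2.2 ≤ p.1)
    (h : Admissible p roots (natGraph G)) (hload : Uncongested p roots (natGraph G))
    (hcov : Covered p roots (natGraph G))
    (hlen : roots.length = rootCount p) {st : List (List ℕ)}
    (hst : AtMoment roots G p 0 st) (t : ℕ) (ht : t ≤ 2 * period p) :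
    ∃ st', AtMoment roots G p t st' ∧
      algorithm.Leads p (encodeState st) (tape (t * codeBits p) σ) (encodeState st') := by
  induction t with
  | zero =>
    refine ⟨st, hst, ?_⟩
    rw [zero_mul]
    exact Algorithm.Leads.nil _
  | succ t ih =>
    obtain ⟨st₁, h₁, hL₁⟩ := ih (by omega)
    obtain ⟨st₂, h₂, hL₂⟩ := h₁.succ hp hσ hc hck hkn h hload hcov hlen (by omega)
    refine ⟨st₂, h₂, ?_⟩
    rw [Nat.succ_mul, tape_add]
    exact hL₁.append hL₂

end Run

end BatchedBFS

end GraphStream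

/-! ### The roots drawn, and correctness for good coins. -/

namespace GraphStream.BatchedBFS

section Roots

variable {n c k : ℕ} (src : Fin c → Fin n)

def sourceList : List ℕ := List.ofFn fun i => (src i : ℕ)

theorem sourceList_getD {i : ℕ} (hi : i < c) : (sourceList src).getD i 0 = src ⟨i, hi⟩ := by
  simp [sourceList, hi]

/-- The block of random bits for the `j`-th root. -/
def block (p : Params) (V j : ℕ) : ℕ := V / (2 ^ blockBits p) ^ j % 2 ^ blockBits p

theorem length_makeRoots (p : Params) (l : List ℕ) (V : ℕ) :
    (makeRoots p l V).length = rootCount p := by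
  simp [makeRoots]

/-- The node of the `j`-th root, for the given random block. -/
def nodeOf (k : ℕ) (j x : ℕ) : ℕ :=
  if hj : j < c then src ⟨j, hj⟩ else x % nodeBase (n, c, k) % n

theorem nodeOf_lt (hn : 0 < n) (j x : ℕ) : nodeOf src k j x < n := by
  unfold nodeOf
  split
  · exact Fin.isLt _
  · exact Nat.mod_lt _ hn

theorem getD_makeRoots {j : ℕ} (hj : j < rootCount (n, c, k)) (V : ℕ) :
    (makeRoots (n, c, k) (sourceList src) V).getD j 0 =
      block (n, c, k) V j / nodeBase (n, c, k) * nodeBase (n, c, k) +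
        nodeOf src k j (block (n, c, k) V j) := by
  by_cases hc : j < c
  · simp [makeRoots, hj, hc, nodeOf, block, sourceList]
  · simp [makeRoots, hj, hc, nodeOf, block]

theorem rootNode_makeRoots (hn : 0 < n) {j : ℕ} (hj : j < rootCount (n, c, k)) (V : ℕ) :
    rootNode (n, c, k) (makeRoots (n, c, k) (sourceList src) V) j =
      nodeOf src k j (block (n, c, k) V j) := by
  rw [rootNode, getD_makeRoots src hj, key_mod]
  exact (nodeOf_lt src hn _ _).trans (lt_nodeBase (n, c, k))

theorem rootDelay_makeRoots (hn : 0 < n) {j : ℕ} (hj : j < rootCount (n, c, k)) (V : ℕ) :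
    rootDelay (n, c, k) (makeRoots (n, c, k) (sourceList src) V) j =
      block (n, c, k) V j / nodeBase (n, c, k) := by
  rw [rootDelay, getD_makeRoots src hj, key_div]
  exact (nodeOf_lt src hn _ _).trans (lt_nodeBase (n, c, k))

theorem block_div_lt (p : Params) (V j : ℕ) : block p V j / nodeBase p < radius p := by
  rw [Nat.div_lt_iff_lt_mul (nodeBase_pos p)]
  refine (Nat.mod_lt _ (by positivity)).trans_le (le_of_eq ?_)
  rw [radius, nodeBase, blockBits, pow_add, mul_comm]

theorem rootNode_source {i : ℕ} (hi : i < c) (V : ℕ) :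
    rootNode (n, c, k) (makeRoots (n, c, k) (sourceList src) V) i = src ⟨i, hi⟩ := by
  rw [rootNode_makeRoots src ((src ⟨i, hi⟩).pos) (Nat.lt_add_right k hi), nodeOf, dif_pos hi]

theorem admissible_makeRoots (hn : 0 < n) (hck : c ≤ k) (hkn : k ≤ n) (G : SimpleGraph (Fin n))
    (V : ℕ) : Admissible (n, c, k) (makeRoots (n, c, k) (sourceList src) V) (natGraph G) where
  rootCount_le := by
    have h : n < nodeBase (n, c, k) := lt_nodeBase (n, c, k)
    show c + k ≤ _
    omega
  lt_of_adj h := natGraph_lt h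
  node_lt j hj := by
    rw [rootNode_makeRoots src hn hj]
    exact nodeOf_lt src hn _ _
  delay_lt j hj := by
    rw [rootDelay_makeRoots src hn hj]
    exact block_div_lt _ _ _
  edist_lt j hj v r hr := by
    rw [rootNode_makeRoots src hn hj] at hr
    exact natGraph_edist_lt (a := ⟨_, nodeOf_lt src hn _ _⟩) hr

theorem valSpec_initialValues (G : SimpleGraph (Fin n)) (V : ℕ) :
    ValSpec (n, c, k) (makeRoots (n, c, k) (sourceList src) V) (natGraph G)
      (initialValues (n, c, k) (sourceList src)) := by
  have hentry : ∀ (i : ℕ) (hi : i < c), ∀ v < n,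
      entry (n, c, k) (initialValues (n, c, k) (sourceList src)) i v =
        if v = src ⟨i, hi⟩ then v else n * nodeBase (n, c, k) := by
    intro i hi v hv
    obtain ⟨h₁, h₂, h₃⟩ := entry_index (p := (n, c, k)) hi hv
    have h₄ := sourceList_getD src hi
    rw [List.getD_eq_getElem?_getD] at h₄
    by_cases he : v = src ⟨i, hi⟩ <;>
      simp_all [entry, initialValues]
  have hN := nodeBase_pos (n, c, k)
  refine ⟨by simp [initialValues], fun i hi v hv => ?_, fun i hi => ?_, fun i hi v hv hlt => ?_⟩
  · rw [hentry i hi v hv]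
    split
    · exact (le_of_lt hv).trans (Nat.le_mul_of_pos_right _ hN)
    · exact le_rfl
  · rw [rootNode_source src hi, hentry i hi _ (Fin.isLt _), if_pos rfl]
  · rw [hentry i hi v hv] at hlt ⊢
    rw [rootNode_source src hi]
    by_cases he : v = src ⟨i, hi⟩
    · exact Or.inl ⟨he, if_pos he⟩
    · rw [if_neg he, Nat.mul_div_cancel _ hN] at hlt
      exact absurd hlt (lt_irrefl _)

theorem start_eq (hc : 1 ≤ c) (hck : c ≤ k) (hkn : k ≤ n) (G : SimpleGraph (Fin n)) :
    (∀ W : List ℕ, W.length ≤ 0 → Fits (n, c, k) (mkState 0 (sourceList src) [] [] W []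
      (initialValues (n, c, k) (sourceList src)))) ∧
    algorithm.start (n, c, k) src =
      encodeState (initialState (n, c, k) (sourceList src)) := by
  have hval := valSpec_initialValues (k := k) src G 0
  have hfit : ∀ W : List ℕ, W.length ≤ 0 → Fits (n, c, k) (mkState 0 (sourceList src) [] [] W []
      (initialValues (n, c, k) (sourceList src))) := by
    intro W hW
    have hW : W = [] := List.length_eq_zero_iff.1 (by omega)
    subst hW
    refine fits_mkState hc hck hkn (Nat.zero_le _) ?_ ?_ (by simp) (by simp) (by simp) (by simp)
      (by simp) (by simp) (by simp) (by simp) hval.length_eq fun a ha => hval.le_of_mem ha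
    · simp [sourceList, rootCount]
    · intro a ha
      obtain ⟨i, rfl⟩ := List.mem_ofFn.1 ha
      refine lt_two_pow_entryBits (i := 0) (j := 1) (x := nodeBase (n, c, k)) (le_of_eq ?_)
        (by norm_num) ((src i).isLt.trans (lt_nodeBase (n, c, k)))
      rw [nodeBase]
      ring
  exact ⟨hfit, capped_of_le (hfit [] le_rfl)⟩

/-- If the roots drawn cover all shortest paths and do not congest the memory, then all the
instances are solved. -/
theorem exists_leads_correct (hc : 1 ≤ c) (hck : c ≤ k) (hkn : k ≤ n) {G : SimpleGraph (Fin n)}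
    {σ : List (Update n)} (hσ : IsTurnstileStream σ G)
    (ω : Fin (algorithm.coins (n, c, k)) → Bool)
    (hload : Uncongested (n, c, k)
      (makeRoots (n, c, k) (sourceList src) (bitsValue (List.ofFn ω))) (natGraph G))
    (hcov : Covered (n, c, k)
      (makeRoots (n, c, k) (sourceList src) (bitsValue (List.ofFn ω))) (natGraph G)) :
    ∃ m ∈ algorithm.correctMemories (n, c, k) G src, algorithm.Leads (n, c, k)
      (algorithm.step ((n, c, k), encodeState (initialState (n, c, k) (sourceList src)), none,
        List.ofFn ω)) (tape (2 * period (n, c, k) * codeBits (n, c, k)) σ) m := by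
  have hn : 0 < n := by omega
  set V := bitsValue (List.ofFn ω) with hV
  set roots := makeRoots (n, c, k) (sourceList src) V with hroots
  have h := admissible_makeRoots src hn hck hkn G V
  have hval := valSpec_initialValues (k := k) src G V
  rw [← hroots] at h hval
  have hlen : roots.length = rootCount (n, c, k) := length_makeRoots _ _ _
  set st := stepStart (n, c, k) (sourceList src) (initialValues (n, c, k) (sourceList src)) V
    with hst
  have hcur : LayerSpec (n, c, k) roots (natGraph G) 0 (nextLayers (n, c, k) roots 0 []) :=
    layerSpec_nextLayers_zero fun x hx => by simp at hx
  have hat : AtMoment roots G (n, c, k) 0 st := by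
    refine ⟨nextLayers (n, c, k) roots 0 [], [], [], _, ?_, nodup_nextLayers, hcur,
      prevSpec_zero (by simp), by simp, by simp, by simp, edgeSpec_zero, progress_zero hval⟩
    rw [hst, stepStart, zero_mul, add_zero]
  have hfit : Fits (n, c, k) st := by
    refine AtMoment.fits (p := (n, c, k)) hc hck hkn h hload hlen (Nat.zero_le _) nodup_nextLayers
      hcur (by simp) (by simp) (by simp) edgeSpec_zero hval 1 ?_ _ (children_zero_bounds _).1
      (children_zero_bounds _).2
    unfold passCount
    omega
  obtain ⟨st', ⟨cur, prev, E, val, rfl, -, -, -, -, -, -, -, hpr⟩, hL⟩ :=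
    hat.iterate rfl hσ hc hck hkn h hload hcov hlen _ le_rfl
  refine ⟨encodeState (mkState (1 + 2 * period (n, c, k) * codeBits (n, c, k)) roots cur prev
    (children (n, c, k) [0]) E val), fun i => ?_, ?_⟩
  · have hsi : rootNode (n, c, k) roots i = src i := rootNode_source src i.isLt V
    have := isBFSSolution (c := c) (k := k) (st := mkState (1 + 2 * period (n, c, k) *
      codeBits (n, c, k)) roots cur prev (children (n, c, k) [0]) E val) hsi rfl hpr.valSpec i.isLt
      fun v r hr => hpr.exact h (Nat.le_add_right c k) hcov i.isLt hr
    simpa only [algorithm, decodeState_encodeState] using this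
  · rw [step_encodeState (st' := st) ?_ hfit]
    · exact hL
    · rfl

theorem leads_first_pass (hc : 1 ≤ c) (hck : c ≤ k) (hkn : k ≤ n) (G : SimpleGraph (Fin n))
    (σ : List (Update n)) : algorithm.Leads (n, c, k) (algorithm.start (n, c, k) src)
      (σ.map fun t => some ((t.1 : ℕ), (t.2.1 : ℕ), t.2.2))
      (encodeState (initialState (n, c, k) (sourceList src))) := by
  obtain ⟨h₁, h₂⟩ := start_eq src hc hck hkn G
  rw [h₂]
  exact leads_edges (p := (n, c, k)) (L := []) σ (by simp) fun W hW _ => h₁ W (le_of_eq hW)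

theorem le_finalDist (hc : 1 ≤ c) (hck : c ≤ k) (hkn : k ≤ n) {G : SimpleGraph (Fin n)}
    {σ : List (Update n)} (hσ : IsTurnstileStream σ G)
    {good : Finset (Fin (algorithm.coins (n, c, k)) → Bool)} {ε : ℝ}
    (hgood : ∀ ω ∈ good, Uncongested (n, c, k)
        (makeRoots (n, c, k) (sourceList src) (bitsValue (List.ofFn ω))) (natGraph G) ∧
      Covered (n, c, k)
        (makeRoots (n, c, k) (sourceList src) (bitsValue (List.ofFn ω))) (natGraph G))
    (hε : (1 - ε) * 2 ^ algorithm.coins (n, c, k) ≤ good.card) :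
    1 - ε ≤ ((algorithm.finalDist (n, c, k) src σ).toOuterMeasure
      (algorithm.correctMemories (n, c, k) G src)).toReal := by
  have htape : tape (algorithm.passes (n, c, k)) σ =
      (σ.map fun t => some ((t.1 : ℕ), (t.2.1 : ℕ), t.2.2)) ++
        none :: tape (2 * period (n, c, k) * codeBits (n, c, k)) σ := by
    rw [show algorithm.passes (n, c, k) = passCount (n, c, k) from rfl, passCount, tape_add,
      tape_one, onePass, List.append_assoc, List.singleton_append]
  rw [Algorithm.finalDist, htape]
  have h₁ := leads_first_pass src hc hck hkn G σ
  have h₂ : ∀ ω ∈ good, ∃ m' ∈ algorithm.correctMemories (n, c, k) G src,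
      algorithm.Leads (n, c, k) (algorithm.step ((n, c, k),
        encodeState (initialState (n, c, k) (sourceList src)), none, List.ofFn ω))
        (tape (2 * period (n, c, k) * codeBits (n, c, k)) σ) m' := fun ω hω =>
    exists_leads_correct src hc hck hkn hσ ω (hgood ω hω).1 (hgood ω hω).2
  generalize algorithm = A at *
  exact Algorithm.le_toOuterMeasure_runFrom h₁ h₂ hε

end Roots

/-- Every memory written has passed through `capped`, so the bound holds for bad coins too. -/
theorem spaceAtMost {n c : ℕ} (p : Params) (src : Fin c → Fin n) (σ : List (Update n)) {S : ℝ}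
    (hS : ((spaceCap p + coinCount p : ℕ) : ℝ) ≤ S) : algorithm.SpaceAtMost p src σ S := by
  intro w _ m hm
  refine le_trans ?_ hS
  have h := Algorithm.support_runFrom_subset (A := algorithm) (p := p)
    (S := {m | m.length ≤ spaceCap p}) (m := algorithm.start p src) (length_capped_le _ _)
    (fun _ _ _ => length_capped_le _ _) w hm
  exact_mod_cast Nat.add_le_add_right h (coinCount p)

end GraphStream.BatchedBFS

/-! ### Coin outcomes as independent blocks; congestion. -/

namespace GraphStream.BatchedBFS

section Blocks

theorem bitsValue_lt (l : List Bool) : bitsValue l < 2 ^ l.length := by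
  induction l with
  | nil => simp [bitsValue]
  | cons b l ih =>
    have : b.toNat ≤ 1 := Bool.toNat_le b
    simp only [bitsValue, List.foldr_cons, List.length_cons, pow_succ] at *
    omega

theorem bitsValue_inj {l l' : List Bool} (hlen : l.length = l'.length)
    (h : bitsValue l = bitsValue l') : l = l' := by
  induction l generalizing l' with
  | nil => exact (List.length_eq_zero_iff.1 hlen.symm).symm
  | cons b l ih =>
    cases l' with
    | nil => simp at hlen
    | cons b' l' =>
      have h₁ : b.toNat ≤ 1 := Bool.toNat_le b
      have h₂ : b'.toNat ≤ 1 := Bool.toNat_le b'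
      simp only [bitsValue, List.foldr_cons] at h
      have h₃ : bitsValue l = bitsValue l' := by
        unfold bitsValue
        omega
      have h₄ : b.toNat = b'.toNat := by omega
      rw [ih (by simpa using hlen) h₃]
      cases b <;> cases b' <;> simp_all

/-- The random blocks of all roots. -/
def blocks (p : Params) (ω : Fin (coinCount p) → Bool) :
    Fin (rootCount p) → Fin (2 ^ blockBits p) :=
  fun j => ⟨block p (bitsValue (List.ofFn ω)) j, Nat.mod_lt _ (by positivity)⟩

/-- The blocks are the digits of the random number in base `2 ^ blockBits`. Injectivity suffices,
since only upper bounds on numbers of bad outcomes are transferred. -/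
theorem blocks_injective (p : Params) : Function.Injective (blocks p) := by
  intro ω ω' h
  have hlt : ∀ ω : Fin (coinCount p) → Bool,
      bitsValue (List.ofFn ω) < (2 ^ blockBits p) ^ rootCount p := fun ω => by
    calc _ < 2 ^ (List.ofFn ω).length := bitsValue_lt (List.ofFn ω)
      _ = _ := by rw [List.length_ofFn, coinCount, mul_comm, pow_mul]
  have h₁ : (finFunctionFinEquiv.symm ⟨_, hlt ω⟩ : Fin (rootCount p) → Fin (2 ^ blockBits p)) =
      finFunctionFinEquiv.symm ⟨_, hlt ω'⟩ := by
    funext j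
    have := congrArg Fin.val (congrFun h j)
    exact Fin.ext this
  have h₂ := congrArg Fin.val (finFunctionFinEquiv.symm.injective h₁)
  exact List.ofFn_injective (bitsValue_inj (by simp) h₂)

end Blocks

theorem card_filter_le_of_injective {α β : Type*} [Fintype α] {f : α → β}
    (hf : Function.Injective f) (P : α → Prop) [DecidablePred P] (S : Finset β)
    (h : ∀ a, P a → f a ∈ S) : (Finset.univ.filter P).card ≤ S.card :=
  Finset.card_le_card_of_injOn f (fun a ha => h a (Finset.mem_filter.1 ha).2) hf.injOn

section Moments

/-- Exponential Markov inequality for sums of independent bounded variables. -/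
theorem card_filter_lt_sum_le {J M n : ℕ} (hn : 0 < n) (X : Fin J → Fin M → ℕ)
    (hX : ∀ j a, X j a ≤ n) {B : ℝ} (hB : ∀ j, ((∑ a, X j a : ℕ) : ℝ) ≤ n * B) (L : ℕ)
    [DecidablePred fun f : Fin J → Fin M => L < ∑ j, X j (f j)] :
    ((Finset.univ.filter fun f : Fin J → Fin M => L < ∑ j, X j (f j)).card : ℝ) ≤
      (M + 2 * B) ^ J * Real.exp (-(L / n)) := by
  have hn' : (0 : ℝ) < n := by exact_mod_cast hn
  have h₁ : ((Finset.univ.filter fun f : Fin J → Fin M => L < ∑ j, X j (f j)).card : ℝ) *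
      Real.exp (L / n) ≤ ∑ f : Fin J → Fin M, ∏ j, Real.exp (X j (f j) / n) := by
    rw [← nsmul_eq_mul, ← Finset.sum_const]
    refine (Finset.sum_le_sum fun f hf => ?_).trans
      (Finset.sum_le_sum_of_subset_of_nonneg (Finset.filter_subset _ _) fun f _ _ => by positivity)
    rw [← Real.exp_sum, ← Finset.sum_div, ← Nat.cast_sum]
    have := (Finset.mem_filter.1 hf).2
    gcongr
  have h₂ : ∑ f : Fin J → Fin M, ∏ j, Real.exp (X j (f j) / n) ≤ (M + 2 * B) ^ J := by
    rw [← Fintype.prod_sum fun j a => Real.exp (X j a / n)]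
    calc ∏ j, ∑ a, Real.exp (X j a / n) ≤ ∏ _j : Fin J, ((M : ℝ) + 2 * B) := by
          refine Finset.prod_le_prod (fun j _ => by positivity) fun j _ => ?_
          calc ∑ a, Real.exp (X j a / n) ≤ ∑ a : Fin M, (1 + 2 * ((X j a : ℝ) / n)) := by
                refine Finset.sum_le_sum fun a _ => ?_
                -- On `[0, 1]` one has `exp y ≤ 1 + y + y ^ 2 ≤ 1 + 2 * y`.
                have hy0 : (0 : ℝ) ≤ X j a / n := by positivity
                have hy1 : (X j a : ℝ) / n ≤ 1 := by
                  rw [div_le_one hn']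
                  exact_mod_cast hX j a
                have := Real.abs_exp_sub_one_sub_id_le (x := (X j a : ℝ) / n)
                  (by rwa [abs_of_nonneg hy0])
                have := (abs_le.1 this).2
                nlinarith
            _ = M + 2 * (((∑ a, X j a : ℕ) : ℝ) / n) := by
                rw [Finset.sum_add_distrib, ← Finset.mul_sum, ← Finset.sum_div]
                simp
            _ ≤ M + 2 * B := by
                have := hB j
                gcongr
                rw [div_le_iff₀ hn']
                linarith
      _ = _ := by simp
  rw [Real.exp_neg, ← div_eq_mul_inv, le_div_iff₀ (Real.exp_pos _)]
  exact h₁.trans h₂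

end Moments

section Congestion

variable {n c k : ℕ} (src : Fin c → Fin n) (G : SimpleGraph (Fin n))

open scoped Classical in
/-- The number of nodes that the `j`-th search reaches at the moment `s`, for the block `x`. -/
noncomputable def reachedAt (k s j x : ℕ) : ℕ :=
  ((Finset.range n).filter fun v => (natGraph G).edist (nodeOf src k j x) v +
    (x / nodeBase (n, c, k) : ℕ) = s).card

/-- The load is a sum of terms that each depend on one block only, as the moment inequality
requires. -/
theorem card_load (hn : 0 < n) (ω : Fin (coinCount (n, c, k)) → Bool) (s : ℕ) :
    (load (n, c, k) (makeRoots (n, c, k) (sourceList src) (bitsValue (List.ofFn ω)))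
      (natGraph G) s).card =
        ∑ j : Fin (rootCount (n, c, k)), reachedAt src G k s j (blocks (n, c, k) ω j) := by
  classical
  rw [load, Finset.card_filter, Finset.sum_product, Finset.sum_range]
  refine Finset.sum_congr rfl fun j _ => ?_
  rw [reachedAt, Finset.card_filter]
  refine Finset.sum_congr rfl fun v _ => ?_
  rw [rootNode_makeRoots src hn j.isLt, rootDelay_makeRoots src hn j.isLt]
  rfl

theorem reachedAt_le (s j x : ℕ) : reachedAt src G k s j x ≤ n := by
  classical
  exact (Finset.card_filter_le _ _).trans (by simp)

theorem nodeOf_congr {j x y : ℕ} (h : x % nodeBase (n, c, k) = y % nodeBase (n, c, k)) :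
    nodeOf src k j x = nodeOf src k j y := by
  unfold nodeOf
  rw [h]

/-- Fix a node `v`. The residue of a block determines the root node and hence its distance to `v`;
then the moment `s` forces the delay, the quotient of the block. So at most `nodeBase` blocks reach
`v` at `s`. -/
theorem sum_reachedAt_le (s j M : ℕ) :
    ∑ a : Fin M, reachedAt src G k s j a ≤ n * nodeBase (n, c, k) := by
  classical
  simp only [reachedAt, Finset.card_filter]
  rw [Finset.sum_comm]
  refine (Finset.sum_le_card_nsmul _ _ (nodeBase (n, c, k)) fun v _ => ?_).trans (by simp)
  rw [← Finset.card_filter]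
  refine (Finset.card_le_card_of_injOn (t := Finset.range (nodeBase (n, c, k)))
    (fun a : Fin M => (a : ℕ) % nodeBase (n, c, k)) (fun a _ => ?_) ?_).trans (by simp)
  · simpa using Nat.mod_lt _ (nodeBase_pos (n, c, k))
  · intro a ha b hb hab
    simp only [Finset.coe_filter, Finset.mem_univ, true_and, Set.mem_ofPred_eq] at ha hb
    have hab : (a : ℕ) % nodeBase (n, c, k) = b % nodeBase (n, c, k) := hab
    rw [← nodeOf_congr src hab] at hb
    have hdiv : (a : ℕ) / nodeBase (n, c, k) = b / nodeBase (n, c, k) := by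
      generalize (natGraph G).edist (nodeOf src k j a) v = e at ha hb
      have he : e ≠ ⊤ := by
        rintro rfl
        rw [top_add] at ha
        exact ENat.natCast_ne_top _ ha.symm
      lift e to ℕ using he
      norm_cast at ha hb
      omega
    refine Fin.ext ?_
    rw [← Nat.div_add_mod (a : ℕ) (nodeBase (n, c, k)), hdiv, hab, Nat.div_add_mod]

end Congestion

section Numeric

theorem lt_radius (p : Params) : 8 * (p.1 / p.2.2 + 1) * nodeBits p < radius p :=
  Nat.lt_pow_succ_log_self Nat.one_lt_two _

theorem mul_le_radius_mul {p : Params} (hk : 0 < p.2.2) :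
    8 * nodeBits p * p.1 ≤ radius p * p.2.2 := by
  have h₁ := lt_radius p
  have h₂ : p.1 ≤ (p.1 / p.2.2 + 1) * p.2.2 := by
    have := Nat.lt_div_mul_add (a := p.1) hk
    rw [Nat.succ_mul]
    omega
  calc 8 * nodeBits p * p.1 ≤ 8 * nodeBits p * ((p.1 / p.2.2 + 1) * p.2.2) := by gcongr
    _ = 8 * (p.1 / p.2.2 + 1) * nodeBits p * p.2.2 := by ring
    _ ≤ _ := by gcongr

theorem two_pow_blockBits (p : Params) : 2 ^ blockBits p = nodeBase p * radius p := by
  rw [blockBits, pow_add]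
  rfl

theorem exp_neg_nodeBits_le (p : Params) (m : ℕ) :
    Real.exp (-((m : ℝ) * nodeBits p)) ≤ ((nodeBase p : ℝ) ^ m)⁻¹ := by
  rw [Real.exp_neg]
  refine inv_anti₀ (pow_pos (by exact_mod_cast nodeBase_pos p) _) ?_
  rw [nodeBase, Nat.cast_pow, ← pow_mul, mul_comm (nodeBits p), ← Nat.cast_mul,
    Nat.cast_ofNat]
  have h : (2 : ℝ) ≤ Real.exp 1 := by
    have := Real.add_one_le_exp (1 : ℝ)
    linarith
  calc (2 : ℝ) ^ (m * nodeBits p) ≤ Real.exp 1 ^ (m * nodeBits p) := by gcongr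
    _ = _ := by rw [← Real.exp_nat_mul, mul_one]

/-- With `M = N * R`, the base is `M * (1 + 2 / R)`, and the power of `1 + 2 / R` is at most `exp (4
k / R) ≤ exp (4 k ^ 2 / n)`. The term `4 k ^ 2` of `layerCap` cancels this, and its term `10 *
nodeBits * n` leaves `exp (-10 * nodeBits) ≤ N ^ (-10)`. -/
theorem pow_exp_le {c k n : ℕ} (hc : 1 ≤ c) (hck : c ≤ k) (hkn : k ≤ n) :
    ((2 ^ blockBits (n, c, k) : ℕ) + 2 * (nodeBase (n, c, k) : ℝ)) ^ rootCount (n, c, k) *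
        Real.exp (-((layerCap (n, c, k) : ℕ) / n)) ≤
      (2 ^ blockBits (n, c, k) : ℝ) ^ rootCount (n, c, k) *
        ((nodeBase (n, c, k) : ℝ) ^ 10)⁻¹ := by
  set p : Params := (n, c, k) with hp
  have hn : (0 : ℝ) < n := by
    have : 0 < n := by omega
    exact_mod_cast this
  have hR : (0 : ℝ) < radius p := by exact_mod_cast radius_pos p
  have hb : (1 : ℝ) ≤ nodeBits p := by exact_mod_cast one_le_nodeBits p
  have hJ : (rootCount p : ℝ) ≤ 2 * k := by
    have : rootCount p ≤ 2 * k := by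
      show c + k ≤ _
      omega
    exact_mod_cast this
  have hRk : 8 * (nodeBits p : ℝ) * n ≤ radius p * k := by
    exact_mod_cast mul_le_radius_mul (p := p) (by show 0 < k; omega)
  have h₁ : ((2 ^ blockBits p : ℕ) + 2 * (nodeBase p : ℝ)) ^ rootCount p ≤
      (2 ^ blockBits p : ℝ) ^ rootCount p * Real.exp (4 * k ^ 2 / n) := by
    have h₂ : ((2 ^ blockBits p : ℕ) + 2 * (nodeBase p : ℝ)) ≤
        (2 ^ blockBits p : ℝ) * Real.exp (2 / radius p) := by
      have h₃ : (2 ^ blockBits p : ℝ) = nodeBase p * radius p := by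
        exact_mod_cast two_pow_blockBits p
      calc ((2 ^ blockBits p : ℕ) + 2 * (nodeBase p : ℝ)) =
          (nodeBase p * radius p : ℝ) * (2 / radius p + 1) := by
            push_cast
            rw [h₃]
            field_simp
            ring
        _ ≤ _ := by
            rw [h₃]
            gcongr
            exact Real.add_one_le_exp _
    calc _ ≤ ((2 ^ blockBits p : ℝ) * Real.exp (2 / radius p)) ^ rootCount p := by gcongr
      _ = (2 ^ blockBits p : ℝ) ^ rootCount p * Real.exp (rootCount p * (2 / radius p)) := by
          rw [mul_pow, Real.exp_nat_mul]
      _ ≤ _ := by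
          gcongr
          rw [mul_div_assoc', div_le_div_iff₀ hR hn]
          have h₄ : (8 : ℝ) * n ≤ radius p * k := by nlinarith
          have hk0 : (0 : ℝ) ≤ k := by positivity
          nlinarith
  have h₅ : Real.exp (-((layerCap p : ℕ) / n)) =
      Real.exp (-(4 * k ^ 2 / n)) * Real.exp (-((10 : ℕ) * nodeBits p)) := by
    rw [← Real.exp_add]
    congr 1
    rw [show layerCap p = 4 * k ^ 2 + 10 * nodeBits p * n from rfl]
    push_cast
    field_simp
    ring
  calc _ ≤ (2 ^ blockBits p : ℝ) ^ rootCount p * Real.exp (4 * k ^ 2 / n) *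
        (Real.exp (-(4 * k ^ 2 / n)) * Real.exp (-((10 : ℕ) * nodeBits p))) := by
        rw [h₅]
        gcongr
    _ = (2 ^ blockBits p : ℝ) ^ rootCount p * Real.exp (-((10 : ℕ) * nodeBits p)) := by
        rw [mul_assoc, ← mul_assoc (Real.exp _), ← Real.exp_add, add_neg_cancel, Real.exp_zero,
          one_mul]
    _ ≤ _ := by
        gcongr
        exact exp_neg_nodeBits_le p 10

theorem period_succ_le (p : Params) : period p + 1 ≤ nodeBase p ^ 8 := by
  have h₁ := radius_le' p
  have h₂ := one_le_nodeBits p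
  have h₃ : 1 ≤ 2 ^ (4 + 2 * nodeBits p) := Nat.one_le_two_pow
  calc period p + 1 ≤ 4 * 2 ^ (4 + 2 * nodeBits p) := by
        unfold period
        omega
    _ = 2 ^ (6 + 2 * nodeBits p) := by ring
    _ ≤ 2 ^ (nodeBits p * 8) := Nat.pow_le_pow_right two_pos (by omega)
    _ = _ := by rw [nodeBase, ← pow_mul]

end Numeric

section CongestionBound

/-- A union bound on top of `card_filter_lt_sum_le`. -/
theorem card_filter_exists_lt_sum_le {Ω : Type*} [Fintype Ω] {J M n : ℕ} (hn : 0 < n)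
    {f : Ω → Fin J → Fin M} (hf : Function.Injective f) (X : ℕ → Fin J → Fin M → ℕ)
    (hX : ∀ s j a, X s j a ≤ n) {B : ℝ} (hB : ∀ s j, ((∑ a, X s j a : ℕ) : ℝ) ≤ n * B) (L T : ℕ)
    (P : Ω → Prop) [DecidablePred P] (hP : ∀ ω, P ω → ∃ s ≤ T, L < ∑ j, X s j (f ω j)) :
    ((Finset.univ.filter P).card : ℝ) ≤
      (T + 1 : ℕ) * ((M + 2 * B) ^ J * Real.exp (-(L / n))) := by
  classical
  have h₁ : (Finset.univ.filter P).card ≤ ((Finset.range (T + 1)).biUnion fun s =>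
      Finset.univ.filter fun g : Fin J → Fin M => L < ∑ j, X s j (g j)).card := by
    refine card_filter_le_of_injective hf P _ fun ω hω => ?_
    obtain ⟨s, hs, hlt⟩ := hP ω hω
    simp only [Finset.mem_biUnion, Finset.mem_range, Finset.mem_filter, Finset.mem_univ, true_and]
    exact ⟨s, by omega, hlt⟩
  have h₂ := h₁.trans Finset.card_biUnion_le
  calc _ ≤ ((∑ s ∈ Finset.range (T + 1), (Finset.univ.filter fun g : Fin J → Fin M =>
        L < ∑ j, X s j (g j)).card : ℕ) : ℝ) := Nat.cast_le.2 h₂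
    _ = ∑ s ∈ Finset.range (T + 1), ((Finset.univ.filter fun g : Fin J → Fin M =>
        L < ∑ j, X s j (g j)).card : ℝ) := Nat.cast_sum _ _
    _ ≤ ∑ s ∈ Finset.range (T + 1), ((M + 2 * B) ^ J * Real.exp (-(L / n))) :=
        Finset.sum_le_sum fun s _ => card_filter_lt_sum_le hn (X s) (hX s) (hB s) L
    _ = _ := by rw [Finset.sum_const, nsmul_eq_mul, Finset.card_range]

variable {n c k : ℕ} (src : Fin c → Fin n) (G : SimpleGraph (Fin n))

theorem exists_lt_sum_reachedAt (hn : 0 < n) (ω : Fin (coinCount (n, c, k)) → Bool)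
    (hω : ¬ Uncongested (n, c, k)
      (makeRoots (n, c, k) (sourceList src) (bitsValue (List.ofFn ω))) (natGraph G)) :
    ∃ s ≤ period (n, c, k), layerCap (n, c, k) <
      ∑ j : Fin (rootCount (n, c, k)), reachedAt src G k s j (blocks (n, c, k) ω j) := by
  by_contra h
  push Not at h
  exact hω fun s hs => (card_load src G hn ω s).trans_le (h s hs)

theorem sq_inv_of_period {T N X : ℝ} (hT : T ≤ N ^ 8) (hN : 0 < N) (hX : 0 ≤ X) :
    T * (X * (N ^ 10)⁻¹) ≤ X * (N ^ 2)⁻¹ :=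
  calc T * (X * (N ^ 10)⁻¹) ≤ N ^ 8 * (X * (N ^ 10)⁻¹) := by gcongr
    _ = _ := by field_simp

open scoped Classical in
-- The union bound over at most `N ^ 8` moments leaves `N ^ (-2)` of the `N ^ (-10)` for a single
-- moment.
theorem card_congested_le (hc : 1 ≤ c) (hck : c ≤ k) (hkn : k ≤ n) :
    ((Finset.univ.filter fun ω : Fin (coinCount (n, c, k)) → Bool => ¬ Uncongested (n, c, k)
      (makeRoots (n, c, k) (sourceList src) (bitsValue (List.ofFn ω))) (natGraph G)).card : ℝ) ≤
      (2 ^ blockBits (n, c, k) : ℝ) ^ rootCount (n, c, k) *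
        ((nodeBase (n, c, k) : ℝ) ^ 2)⁻¹ := by
  have hn : 0 < n := hc.trans (hck.trans hkn)
  have hB : ∀ s, ∀ j : Fin (rootCount (n, c, k)), ((∑ a : Fin (2 ^ blockBits (n, c, k)),
      reachedAt src G k s j a : ℕ) : ℝ) ≤ n * (nodeBase (n, c, k) : ℝ) := fun s j =>
    (Nat.cast_le.2 (sum_reachedAt_le src G s j _)).trans_eq (Nat.cast_mul _ _)
  have h₁ := card_filter_exists_lt_sum_le hn (blocks_injective (n, c, k))
    (fun s j a => reachedAt src G k s j a) (fun s j a => reachedAt_le src G s j a) hB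
    (layerCap (n, c, k)) (period (n, c, k)) _ (exists_lt_sum_reachedAt src G hn)
  have h₂ := mul_le_mul_of_nonneg_left (pow_exp_le hc hck hkn)
    (Nat.cast_nonneg (α := ℝ) (period (n, c, k) + 1))
  have hT : ((period (n, c, k) + 1 : ℕ) : ℝ) ≤ (nodeBase (n, c, k) : ℝ) ^ 8 :=
    (Nat.cast_le.2 (period_succ_le (n, c, k))).trans_eq (Nat.cast_pow _ _)
  exact h₁.trans (h₂.trans (sq_inv_of_period hT (Nat.cast_pos.2 (nodeBase_pos _))
    (pow_nonneg (pow_nonneg zero_le_two _) _)))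

end CongestionBound

end GraphStream.BatchedBFS

/-! ### Random roots hit all long shortest paths. -/

namespace GraphStream.BatchedBFS

section Hitting

/-- The probability that `k` independent uniform samples all miss a set. -/
theorem card_filter_forall_notMem_le {c k M : ℕ} (S : Finset (Fin M)) {q : ℝ}
    (hS : q * M ≤ S.card) [DecidablePred fun f : Fin (c + k) → Fin M => ∀ j, c ≤ j.val → f j ∉ S] :
    ((Finset.univ.filter fun f : Fin (c + k) → Fin M => ∀ j, c ≤ j.val → f j ∉ S).card : ℝ) ≤
      (M : ℝ) ^ (c + k) * Real.exp (-(k * q)) := by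
  classical
  have h₁ : (Finset.univ.filter fun f : Fin (c + k) → Fin M => ∀ j, c ≤ j.val → f j ∉ S) ⊆
      Fintype.piFinset fun j : Fin (c + k) => if c ≤ j.val then Sᶜ else Finset.univ := by
    intro f hf
    refine Fintype.mem_piFinset.2 fun j => ?_
    split_ifs with hj
    · exact Finset.mem_compl.2 ((Finset.mem_filter.1 hf).2 j hj)
    · exact Finset.mem_univ _
  have h₂ := Finset.card_le_card h₁
  rw [Fintype.card_piFinset, Fin.prod_univ_add] at h₂
  simp only [Fin.val_castAdd, Fin.val_natAdd, Fin.is_lt, not_le.2, if_false, Finset.card_univ,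
    Fintype.card_fin, Nat.le_add_right, if_true, Finset.prod_const] at h₂
  -- This is `1 - q ≤ exp (-q)`.
  have h₃ : ((Sᶜ).card : ℝ) ≤ M * Real.exp (-q) := by
    have h₄ : ((Sᶜ).card : ℝ) = M - S.card := by
      rw [Finset.card_compl, Fintype.card_fin, Nat.cast_sub]
      simpa using Finset.card_le_univ S
    have h₅ := Real.add_one_le_exp (-q)
    have h₆ : (0 : ℝ) ≤ M := Nat.cast_nonneg _
    rw [h₄]
    nlinarith
  calc _ ≤ ((M ^ c * (Sᶜ).card ^ k : ℕ) : ℝ) := Nat.cast_le.2 h₂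
    _ = (M : ℝ) ^ c * ((Sᶜ).card : ℝ) ^ k := by push_cast; rfl
    _ ≤ (M : ℝ) ^ c * (M * Real.exp (-q)) ^ k := by gcongr
    _ = _ := by
      rw [mul_pow, ← Real.exp_nat_mul, pow_add, mul_neg]
      ring

theorem card_filter_exists_le {Ω α ι : Type*} [Fintype Ω] {f : Ω → α}
    (hf : Function.Injective f) (I : Finset ι) (bad : ι → Finset α) {B : ℝ}
    (hB : ∀ i ∈ I, ((bad i).card : ℝ) ≤ B) (P : Ω → Prop) [DecidablePred P]
    (hP : ∀ ω, P ω → ∃ i ∈ I, f ω ∈ bad i) :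
    ((Finset.univ.filter P).card : ℝ) ≤ I.card * B := by
  classical
  have h₁ : (Finset.univ.filter P).card ≤ (I.biUnion bad).card :=
    card_filter_le_of_injective hf P _ fun ω hω => Finset.mem_biUnion.2 (hP ω hω)
  calc _ ≤ ((∑ i ∈ I, (bad i).card : ℕ) : ℝ) := Nat.cast_le.2 (h₁.trans Finset.card_biUnion_le)
    _ = ∑ i ∈ I, ((bad i).card : ℝ) := Nat.cast_sum _ _
    _ ≤ ∑ _i ∈ I, B := Finset.sum_le_sum hB
    _ = _ := by rw [Finset.sum_const, nsmul_eq_mul]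

end Hitting

/-- Each residue `u a` has `R` representatives below `N * R`. -/
theorem sq_le_card_filter_mod {N R M : ℕ} (hM : N * R = M) {u : ℕ → ℕ} (hu : ∀ a < R, u a < N)
    (hinj : ∀ a < R, ∀ b < R, u a = u b → a = b) (P : ℕ → Prop)
    [DecidablePred fun x : Fin M => P (x % N)] (hP : ∀ a < R, P (u a)) :
    R * R ≤ (Finset.univ.filter fun x : Fin M => P (x % N)).card := by
  have hmod : ∀ e, ∀ a < R, (e * N + u a) % N = u a := fun e a ha => by
    rw [mul_comm, Nat.mul_add_mod, Nat.mod_eq_of_lt (hu a ha)]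
  have hlt : ∀ e < R, ∀ a < R, e * N + u a < M := fun e he a ha => by
    calc e * N + u a < (e + 1) * N := by
          rw [Nat.succ_mul]
          exact Nat.add_lt_add_left (hu a ha) _
      _ ≤ R * N := Nat.mul_le_mul_right _ he
      _ = M := by rw [Nat.mul_comm, hM]
  calc R * R = (Finset.range R ×ˢ Finset.range R).card := by simp
    _ ≤ ((Finset.univ.filter fun x : Fin M => P (x % N)).map Fin.valEmbedding).card := by
      refine Finset.card_le_card_of_injOn (fun z : ℕ × ℕ => z.1 * N + u z.2) (fun z hz => ?_) ?_
      · obtain ⟨h₁, h₂⟩ := Finset.mem_product.1 hz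
        rw [Finset.mem_range] at h₁ h₂
        refine Finset.mem_map.2 ⟨⟨_, hlt _ h₁ _ h₂⟩,
          Finset.mem_filter.2 ⟨Finset.mem_univ _, ?_⟩, rfl⟩
        show P ((z.1 * N + u z.2) % N)
        rw [hmod _ _ h₂]
        exact hP _ h₂
      · rintro ⟨e, a⟩ hz ⟨e', a'⟩ hz' heq
        obtain ⟨h₁, h₂⟩ := Finset.mem_product.1 hz
        obtain ⟨h₁', h₂'⟩ := Finset.mem_product.1 hz'
        rw [Finset.mem_range] at h₁ h₂ h₁' h₂'
        change e * N + u a = e' * N + u a' at heq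
        have h₃ : u a = u a' := by rw [← hmod e a h₂, heq, hmod e' a' h₂']
        have h₄ : e = e' := by
          have hN : 0 < N := (Nat.zero_le _).trans_lt (hu a h₂)
          rw [h₃] at heq
          exact Nat.eq_of_mul_eq_mul_right hN (Nat.add_right_cancel heq)
        have h₅ : a = a' := hinj _ h₂ _ h₂' h₃
        rw [h₄, h₅]
    _ = _ := Finset.card_map _

section Cover

/-- The node `u ≠ y` lies on a shortest path from `x` to `y`, which has length `R`. -/
def Between (H : SimpleGraph ℕ) (R x y u : ℕ) : Prop :=
  ∃ d, 1 ≤ d ∧ d ≤ R ∧ H.edist u y = d ∧ H.edist x u + d = R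

variable {n c k : ℕ} (src : Fin c → Fin n) (G : SimpleGraph (Fin n))

/-- For a node within the radius the source itself is the root. Otherwise a root on a shortest path
through the last `R` steps before the node serves, by the triangle inequality. -/
theorem exists_between_imp_covered {p : Params} {roots : List ℕ} {H : SimpleGraph ℕ}
    (hc : p.2.1 ≤ rootCount p)
    (h : ∀ x y, H.edist x y = radius p → ∃ j < rootCount p,
      Between H (radius p) x y (rootNode p roots j)) : Covered p roots H := by
  intro i hi v r hr hr0
  by_cases hrR : r ≤ radius p
  · exact ⟨i, by omega, r, by omega, hrR, hr, by simp⟩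
  · obtain ⟨x, h₁, h₂⟩ := SimpleGraph.exists_edist_eq_of_edist_eq_add
      (a := r - radius p) (b := radius p) (hr.trans (by congr 1; omega))
    obtain ⟨j, hj, d, hd1, hdR, hd, hsum⟩ := h x v h₂
    refine ⟨j, hj, d, hd1, hdR, hd, le_antisymm ?_ ?_⟩
    · calc _ ≤ (H.edist (rootNode p roots i) x + H.edist x (rootNode p roots j)) + d := by
            gcongr
            exact SimpleGraph.edist_triangle
        _ = ((r - radius p : ℕ) : ℕ∞) + (radius p : ℕ) := by rw [add_assoc, hsum, h₁]
        _ = r := by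
          rw [← Nat.cast_add]
          congr 1
          omega
    · rw [← hr, ← hd]
      exact SimpleGraph.edist_triangle

open scoped Classical in
/-- The random blocks whose node lies between `x` and `y`. -/
noncomputable def blocksBetween (n c k : ℕ) (H : SimpleGraph ℕ) (x y : ℕ) :
    Finset (Fin (2 ^ blockBits (n, c, k))) :=
  Finset.univ.filter fun a =>
    Between H (radius (n, c, k)) x y (a.val % nodeBase (n, c, k) % n)

/-- The path offers `R` distinct nodes other than `y`, one for each distance `a < R` from `x`, and
each comes from `R` blocks, one per delay. Hence a fraction of at least `R / N` of all blocks is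
good. -/
theorem sq_radius_le_card_blocksBetween {H : SimpleGraph ℕ} {x y : ℕ}
    (hH : ∀ u, ∀ d : ℕ, H.edist x u = d → u < n)
    (h : H.edist x y = radius (n, c, k)) :
    radius (n, c, k) * radius (n, c, k) ≤ (blocksBetween n c k H x y).card := by
  classical
  have h₁ : ∀ a, ∃ u, a < radius (n, c, k) → H.edist x u = a ∧
      H.edist u y = (radius (n, c, k) - a : ℕ) := fun a => by
    by_cases ha : a < radius (n, c, k)
    · obtain ⟨u, hu⟩ := SimpleGraph.exists_edist_eq_of_edist_eq_add
        (a := a) (b := radius (n, c, k) - a) (h.trans (by congr 1; omega))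
      exact ⟨u, fun _ => hu⟩
    · exact ⟨0, fun h => absurd h ha⟩
  choose u hu using h₁
  have hun : ∀ a < radius (n, c, k), u a < n := fun a ha => hH _ _ (hu a ha).1
  refine sq_le_card_filter_mod (two_pow_blockBits (n, c, k)).symm
    (fun a ha => (hun a ha).trans (lt_nodeBase (n, c, k))) (fun a ha b hb hab => ?_)
    (fun v => Between H (radius (n, c, k)) x y (v % n)) fun a ha => ?_
  · have h₁ := (hu a ha).1
    rw [hab, (hu b hb).1] at h₁
    exact (Nat.cast_inj.1 h₁).symm
  · obtain ⟨h₃, h₄⟩ := hu a ha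
    rw [Nat.mod_eq_of_lt (hun a ha)]
    refine ⟨_, by omega, Nat.sub_le _ _, h₄, ?_⟩
    rw [h₃, ← Nat.cast_add]
    congr 1
    omega

open scoped Classical in
/-- The random choices for which no block lies between `x` and `y`. -/
noncomputable def missed (n c k : ℕ) (H : SimpleGraph ℕ) (x y : ℕ) :
    Finset (Fin (rootCount (n, c, k)) → Fin (2 ^ blockBits (n, c, k))) :=
  Finset.univ.filter fun f => ∀ j, c ≤ j.val → f j ∉ blocksBetween n c k H x y

theorem natGraph_lt_of_edist {G : SimpleGraph (Fin n)} {x y r : ℕ} (hr : 0 < r)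
    (h : (natGraph G).edist x y = r) :
    x < n ∧ ∀ u, ∀ d : ℕ, (natGraph G).edist x u = d → u < n := by
  obtain ⟨u, hu, -⟩ := SimpleGraph.exists_edist_eq_of_edist_eq_add
    (a := 1) (b := r - 1) (h.trans (by congr 1; omega))
  have hx := natGraph_lt (SimpleGraph.edist_eq_one_iff_adj.1 (hu.trans Nat.cast_one))
  exact ⟨hx, fun u d hd => lt_of_natGraph_edist (a := ⟨x, hx⟩) hd⟩

theorem exists_missed (hn : 0 < n) (ω : Fin (coinCount (n, c, k)) → Bool)
    (hω : ¬ Covered (n, c, k)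
      (makeRoots (n, c, k) (sourceList src) (bitsValue (List.ofFn ω))) (natGraph G)) :
    ∃ x y, (natGraph G).edist x y = radius (n, c, k) ∧
      blocks (n, c, k) ω ∈ missed n c k (natGraph G) x y := by
  classical
  by_contra h
  refine hω (exists_between_imp_covered (Nat.le_add_right _ _) fun x y hxy => ?_)
  have h' : ¬ ∀ j : Fin (rootCount (n, c, k)), c ≤ j.val →
      blocks (n, c, k) ω j ∉ blocksBetween n c k (natGraph G) x y := fun hall =>
    h ⟨x, y, hxy, Finset.mem_filter.2 ⟨Finset.mem_univ _, hall⟩⟩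
  push Not at h'
  obtain ⟨j, hj, hmem⟩ := h'
  refine ⟨j, j.isLt, ?_⟩
  have := (Finset.mem_filter.1 hmem).2
  rw [rootNode_makeRoots src hn j.isLt, nodeOf, dif_neg (not_lt.2 hj)]
  exact this

/-- Since `N ≤ 2 n` and `8 * nodeBits * n ≤ R * k`, the exponent `k * R / N` is at least `4 *
nodeBits`. -/
theorem card_missed_le (hc : 1 ≤ c) (hck : c ≤ k) (hkn : k ≤ n) {x y : ℕ}
    (h : (natGraph G).edist x y = radius (n, c, k)) :
    ((missed n c k (natGraph G) x y).card : ℝ) ≤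
      (2 ^ blockBits (n, c, k) : ℝ) ^ rootCount (n, c, k) * ((nodeBase (n, c, k) : ℝ) ^ 4)⁻¹ := by
  have hN : (0 : ℝ) < nodeBase (n, c, k) := Nat.cast_pos.2 (nodeBase_pos _)
  have hS : (radius (n, c, k) / nodeBase (n, c, k) : ℝ) * (2 ^ blockBits (n, c, k) : ℕ) ≤
      (blocksBetween n c k (natGraph G) x y).card := by
    have h₁ := Nat.cast_le (α := ℝ).2 (sq_radius_le_card_blocksBetween
      (natGraph_lt_of_edist (radius_pos _) h).2 h)
    refine le_trans (le_of_eq ?_) h₁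
    rw [two_pow_blockBits, Nat.cast_mul, Nat.cast_mul]
    field_simp
  classical
  refine (card_filter_forall_notMem_le (c := c) (k := k) _ hS).trans ?_
  rw [Nat.cast_pow, Nat.cast_ofNat, show rootCount (n, c, k) = c + k from rfl]
  gcongr
  refine (Real.exp_le_exp.2 ?_).trans (exp_neg_nodeBits_le (n, c, k) 4)
  have h₂ : 8 * (nodeBits (n, c, k) : ℝ) * n ≤ radius (n, c, k) * k := by
    have := Nat.cast_le (α := ℝ).2 (mul_le_radius_mul (p := (n, c, k)) (hc.trans hck))
    push_cast at this
    exact this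
  have h₃ : (nodeBase (n, c, k) : ℝ) ≤ 2 * n := by
    have := Nat.cast_le (α := ℝ).2 (nodeBase_le (p := (n, c, k)) (hc.trans (hck.trans hkn)))
    push_cast at this
    exact this
  rw [neg_le_neg_iff, mul_div_assoc', le_div_iff₀ hN]
  have h₄ : (0 : ℝ) ≤ nodeBits (n, c, k) := Nat.cast_nonneg _
  push_cast
  nlinarith

open scoped Classical in
-- Covering depends only on pairs at distance exactly `R`; a union bound over at most `N ^ 2` of
-- them leaves `N ^ (-2)`.
theorem card_uncovered_le (hc : 1 ≤ c) (hck : c ≤ k) (hkn : k ≤ n) :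
    ((Finset.univ.filter fun ω : Fin (coinCount (n, c, k)) → Bool => ¬ Covered (n, c, k)
      (makeRoots (n, c, k) (sourceList src) (bitsValue (List.ofFn ω))) (natGraph G)).card : ℝ) ≤
      (2 ^ blockBits (n, c, k) : ℝ) ^ rootCount (n, c, k) *
        ((nodeBase (n, c, k) : ℝ) ^ 2)⁻¹ := by
  have hn : 0 < n := hc.trans (hck.trans hkn)
  have hN : (0 : ℝ) < nodeBase (n, c, k) := Nat.cast_pos.2 (nodeBase_pos _)
  have h₁ := card_filter_exists_le (blocks_injective (n, c, k))
    ((Finset.range n ×ˢ Finset.range n).filter fun z =>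
      (natGraph G).edist z.1 z.2 = radius (n, c, k))
    (fun z => missed n c k (natGraph G) z.1 z.2)
    (fun z hz => card_missed_le G hc hck hkn (Finset.mem_filter.1 hz).2)
    (fun ω => ¬ Covered (n, c, k)
      (makeRoots (n, c, k) (sourceList src) (bitsValue (List.ofFn ω))) (natGraph G))
    fun ω hω => by
      obtain ⟨x, y, hxy, hj⟩ := exists_missed src G hn ω hω
      obtain ⟨hx, hu⟩ := natGraph_lt_of_edist (radius_pos _) hxy
      exact ⟨(x, y), Finset.mem_filter.2 ⟨Finset.mem_product.2 ⟨Finset.mem_range.2 hx,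
        Finset.mem_range.2 (hu y _ hxy)⟩, hxy⟩, hj⟩
  refine h₁.trans ?_
  have h₂ : (((Finset.range n ×ˢ Finset.range n).filter fun z =>
      (natGraph G).edist z.1 z.2 = radius (n, c, k)).card : ℝ) ≤
      (nodeBase (n, c, k) : ℝ) ^ 2 := by
    have h₃ : (n : ℝ) ≤ nodeBase (n, c, k) := Nat.cast_le.2 (lt_nodeBase (n, c, k)).le
    refine (Nat.cast_le.2 (Finset.card_filter_le _ _)).trans ?_
    rw [Finset.card_product, Finset.card_range, Nat.cast_mul, sq]
    gcongr
  calc _ ≤ (nodeBase (n, c, k) : ℝ) ^ 2 * ((2 ^ blockBits (n, c, k) : ℝ) ^ rootCount (n, c, k) *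
        ((nodeBase (n, c, k) : ℝ) ^ 4)⁻¹) := by gcongr
    _ = _ := by
        generalize (2 ^ blockBits (n, c, k) : ℝ) ^ rootCount (n, c, k) = X
        field_simp

end Cover

/-! ### Success probability and resource bounds. -/

section Success

open scoped Classical in
theorem le_card_filter_and {Ω : Type*} [Fintype Ω] (P Q : Ω → Prop) {δ ε : ℝ}
    (hP : ((Finset.univ.filter fun ω => ¬ P ω).card : ℝ) ≤ Fintype.card Ω * δ)
    (hQ : ((Finset.univ.filter fun ω => ¬ Q ω).card : ℝ) ≤ Fintype.card Ω * δ)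
    (hδ : 2 * δ ≤ ε) :
    (1 - ε) * Fintype.card Ω ≤ ((Finset.univ.filter fun ω => P ω ∧ Q ω).card : ℝ) := by
  have h₁ : Fintype.card Ω ≤ (Finset.univ.filter fun ω => P ω ∧ Q ω).card +
      ((Finset.univ.filter fun ω => ¬ P ω).card + (Finset.univ.filter fun ω => ¬ Q ω).card) := by
    rw [← Finset.card_univ]
    refine le_trans (Finset.card_le_card fun ω _ => ?_) ((Finset.card_union_le _ _).trans
      (Nat.add_le_add_left (Finset.card_union_le _ _) _))
    simp only [Finset.mem_union, Finset.mem_filter, Finset.mem_univ, true_and]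
    tauto
  have h₂ : (Fintype.card Ω : ℝ) ≤ (Finset.univ.filter fun ω => P ω ∧ Q ω).card +
      ((Finset.univ.filter fun ω => ¬ P ω).card + (Finset.univ.filter fun ω => ¬ Q ω).card) := by
    exact_mod_cast h₁
  have h₃ : (0 : ℝ) ≤ Fintype.card Ω := Nat.cast_nonneg _
  nlinarith

variable {n c k : ℕ} (src : Fin c → Fin n) (G : SimpleGraph (Fin n))

/-- Congestion and failure to cover each cost `N ^ (-2)`; together they stay below `1 / n`, so the
exponent `1` is attained. -/
theorem two_mul_inv_sq_le {n N : ℕ} (hn : 0 < n) (h : n < N) :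
    2 * ((N : ℝ) ^ 2)⁻¹ ≤ 1 / n := by
  have h₁ : (0 : ℝ) < n := Nat.cast_pos.2 hn
  have h₂ : (n : ℝ) + 1 ≤ N := by exact_mod_cast h
  have h₃ : (0 : ℝ) < N := by linarith
  have h₄ : (1 : ℝ) ≤ n := by exact_mod_cast hn
  rw [← div_eq_mul_inv, div_le_div_iff₀ (by positivity) h₁]
  nlinarith

open scoped Classical in
theorem le_card_good (hc : 1 ≤ c) (hck : c ≤ k) (hkn : k ≤ n) :
    (1 - 1 / (n : ℝ)) * 2 ^ coinCount (n, c, k) ≤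
      ((Finset.univ.filter fun ω : Fin (coinCount (n, c, k)) → Bool =>
        Uncongested (n, c, k)
          (makeRoots (n, c, k) (sourceList src) (bitsValue (List.ofFn ω))) (natGraph G) ∧
        Covered (n, c, k)
          (makeRoots (n, c, k) (sourceList src) (bitsValue (List.ofFn ω))) (natGraph G)).card :
            ℝ) := by
  have hcard : (Fintype.card (Fin (coinCount (n, c, k)) → Bool) : ℝ) =
      2 ^ coinCount (n, c, k) := by
    rw [Fintype.card_fun, Fintype.card_bool, Fintype.card_fin, Nat.cast_pow, Nat.cast_ofNat]
  have hpow : (2 ^ blockBits (n, c, k) : ℝ) ^ rootCount (n, c, k) =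
      Fintype.card (Fin (coinCount (n, c, k)) → Bool) := by
    rw [hcard, ← pow_mul, Nat.mul_comm]
    rfl
  rw [← hcard]
  exact le_card_filter_and _ _ (hpow ▸ card_congested_le src G hc hck hkn)
    (hpow ▸ card_uncovered_le src G hc hck hkn)
    (two_mul_inv_sq_le (hc.trans (hck.trans hkn)) (lt_nodeBase (n, c, k)))

theorem one_sub_inv_le_finalDist (hc : 1 ≤ c) (hck : c ≤ k) (hkn : k ≤ n) {σ : List (Update n)}
    (hσ : IsTurnstileStream σ G) :
    1 - 1 / (n : ℝ) ≤ ((algorithm.finalDist (n, c, k) src σ).toOuterMeasure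
      (algorithm.correctMemories (n, c, k) G src)).toReal := by
  classical
  exact le_finalDist src hc hck hkn hσ (fun ω hω => (Finset.mem_filter.1 hω).2)
    (le_card_good src G hc hck hkn)

end Success

section Resources

theorem nodeBits_le {p : Params} (hn : 1 ≤ p.1) :
    (nodeBits p : ℝ) ≤ 2 * (1 + Real.log p.1) := by
  have hn' : (1 : ℝ) ≤ p.1 := by exact_mod_cast hn
  have h₁ : (2 : ℝ) ^ Nat.log 2 p.1 ≤ p.1 := by
    exact_mod_cast Nat.pow_log_le_self 2 (by omega : p.1 ≠ 0)
  have h₂ := Real.log_le_log (by positivity) h₁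
  rw [Real.log_pow] at h₂
  have h₃ := Real.log_two_gt_d9
  have h₄ : (0 : ℝ) ≤ Nat.log 2 p.1 := Nat.cast_nonneg _
  rw [nodeBits, Nat.cast_add, Nat.cast_one]
  nlinarith

theorem radius_le (p : Params) : radius p ≤ 16 * (p.1 / p.2.2 + 1) * nodeBits p := by
  have : 2 ^ Nat.log 2 (8 * (p.1 / p.2.2 + 1) * nodeBits p) ≤
      8 * (p.1 / p.2.2 + 1) * nodeBits p := by
    refine Nat.pow_log_le_self 2 ?_
    have := one_le_nodeBits p
    positivity
  rw [radius, radiusBits, pow_succ]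
  linarith

theorem radiusBits_le (p : Params) : radiusBits p ≤ 4 + 2 * nodeBits p :=
  (Nat.pow_le_pow_iff_right Nat.one_lt_two).1 (radius_le' p)

theorem passes_le {n c k : ℕ} (hk : 1 ≤ k) (hkn : k ≤ n) :
    (passCount (n, c, k) : ℝ) ≤ 2100 * ((n : ℝ) / k) * (1 + Real.log n) ^ 2 := by
  have hn : 1 ≤ n := hk.trans hkn
  have hb := nodeBits_le (p := (n, c, k)) hn
  have hb1 : (1 : ℝ) ≤ nodeBits (n, c, k) := by exact_mod_cast one_le_nodeBits (n, c, k)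
  have hR : (radius (n, c, k) : ℝ) ≤ 16 * ((n / k : ℕ) + 1) * nodeBits (n, c, k) := by
    exact_mod_cast radius_le (n, c, k)
  have hk' : (0 : ℝ) < k := by exact_mod_cast hk
  have hdiv : ((n / k : ℕ) : ℝ) ≤ (n : ℝ) / k := Nat.cast_div_le
  have hx : (1 : ℝ) ≤ (n : ℝ) / k := by
    rw [le_div_iff₀ hk', one_mul]
    exact_mod_cast hkn
  rw [show passCount (n, c, k) = 1 + 2 * (2 * radius (n, c, k)) * (3 * nodeBits (n, c, k) + 1)
    from rfl]
  push_cast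
  generalize (nodeBits (n, c, k) : ℝ) = b at *
  generalize (radius (n, c, k) : ℝ) = R at *
  generalize ((n / k : ℕ) : ℝ) = d at *
  generalize (n : ℝ) / k = x at *
  generalize 1 + Real.log (n : ℝ) = l at *
  have h₁ : R ≤ 32 * x * b := hR.trans (by nlinarith)
  have h₂ : 2 * (2 * R) * (3 * b + 1) ≤ 4 * (32 * x * b) * (4 * b) := by
    have : 3 * b + 1 ≤ 4 * b := by linarith
    have h0 : 0 ≤ 3 * b + 1 := by linarith
    have h0' : 0 ≤ 32 * x * b := by positivity
    nlinarith
  have h₃ : b ^ 2 ≤ (2 * l) ^ 2 := by gcongr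
  have h₄ : (1 : ℝ) ≤ b ^ 2 := one_le_pow₀ hb1
  nlinarith

theorem space_le {n c k : ℕ} (hc : 1 ≤ c) (hck : c ≤ k) (hkn : k ≤ n) :
    ((spaceCap (n, c, k) + coinCount (n, c, k) : ℕ) : ℝ) ≤
      25000 * ((c : ℝ) * n + (k : ℝ) ^ 2) * (1 + Real.log n) ^ 2 := by
  have hn : 1 ≤ n := hc.trans (hck.trans hkn)
  have hb := nodeBits_le (p := (n, c, k)) hn
  have hb1 := one_le_nodeBits (n, c, k)
  have hr := radiusBits_le (n, c, k)
  have h : spaceCap (n, c, k) + coinCount (n, c, k) ≤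
      6100 * (c * n + k ^ 2) * nodeBits (n, c, k) ^ 2 := by
    rw [show spaceCap (n, c, k) = 6000 * (c * n + k ^ 2) * nodeBits (n, c, k) ^ 2 from rfl,
      show coinCount (n, c, k) = (c + k) * (nodeBits (n, c, k) + radiusBits (n, c, k)) from rfl]
    generalize nodeBits (n, c, k) = b at *
    generalize radiusBits (n, c, k) = r at *
    have h₁ : c + k ≤ 2 * (c * n + k ^ 2) := by nlinarith
    have h₂ : b + r ≤ 7 * b ^ 2 := by nlinarith
    have h₃ := Nat.mul_le_mul h₁ h₂
    nlinarith
  have hX : (0 : ℝ) ≤ (c : ℝ) * n + (k : ℝ) ^ 2 := by positivity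
  calc _ ≤ ((6100 * (c * n + k ^ 2) * nodeBits (n, c, k) ^ 2 : ℕ) : ℝ) := Nat.cast_le.2 h
    _ = 6100 * ((c : ℝ) * n + (k : ℝ) ^ 2) * (nodeBits (n, c, k) : ℝ) ^ 2 := by push_cast; rfl
    _ ≤ 6100 * ((c : ℝ) * n + (k : ℝ) ^ 2) * (2 * (1 + Real.log n)) ^ 2 := by gcongr
    _ = 24400 * (((c : ℝ) * n + (k : ℝ) ^ 2) * (1 + Real.log n) ^ 2) := by ring
    _ ≤ 25000 * (((c : ℝ) * n + (k : ℝ) ^ 2) * (1 + Real.log n) ^ 2) := by gcongr; norm_num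
    _ = _ := by ring

end Resources

end GraphStream.BatchedBFS

theorem mainTheorem9 :
    ∃ (A : GraphStream.Algorithm) (C : ℝ) (a : ℕ) (δ : ℝ), 0 < C ∧ 0 < δ ∧
      ∀ n c k : ℕ, 1 ≤ c → c ≤ k → k ≤ n →
        (A.passes (n, c, k) : ℝ) ≤ C * ((n : ℝ) / k) * (1 + Real.log n) ^ a ∧
        ∀ (G : SimpleGraph (Fin n)) (src : Fin c → Fin n) (σ : List (GraphStream.Update n)),
          GraphStream.IsTurnstileStream σ G →
            A.SpaceAtMost (n, c, k) src σ
              (C * ((c : ℝ) * n + (k : ℝ) ^ 2) * (1 + Real.log n) ^ a) ∧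
            1 - 1 / (n : ℝ) ^ δ ≤
              ((A.finalDist (n, c, k) src σ).toOuterMeasure
                (A.correctMemories (n, c, k) G src)).toReal := by
  refine ⟨GraphStream.BatchedBFS.algorithm, 25000, 2, 1, by norm_num, one_pos,
    fun n c k hc hck hkn => ⟨?_, fun G src σ hσ => ⟨?_, ?_⟩⟩⟩
  · refine (GraphStream.BatchedBFS.passes_le (hc.trans hck) hkn).trans ?_
    gcongr
    norm_num
  · exact GraphStream.BatchedBFS.spaceAtMost _ src σ
      (GraphStream.BatchedBFS.space_le hc hck hkn)
  · rw [Real.rpow_one]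
    exact GraphStream.BatchedBFS.one_sub_inv_le_finalDist src G hc hck hkn hσ
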